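/- \textbf{Setting.} Let $l_1,\dots,l_p$ be block lengths with $n=\sum_a l_a$, write $x\in\mathbb R^n$ as $x=(x^{(1)},\dots,x^{(p)})$ with $x^{(a)}=(x_{a,1},\dots,x_{a,l_a})$, and consider $$\dot x=f(x,u):=\bar A x+\bar f(x,u),\qquad y=\bar C x,\qquad u(t)\in\mathbb R^m,$$ where $\bar A=\mathrm{diag}(\bar A_1,\dots,\bar A_p)$, $\bar A_a\in\mathbb R^{l_a\times l_a}$ has ones on the first superdiagonal and zeros elsewhere, and $\bar C=\mathrm{diag}(\bar C_1,\dots,\bar C_p)$ with $\bar C_a=[1\;0\cdots 0]\in\mathbb R^{1\times l_a}$. Assume that $\bar f=(f_{i,j})$ is twice continuously differentiable, globally Lipschitz in $x$ uniformly in $u$, that the Hessian with respect to $x$ of each component of $\bar f$ is bounded on $\mathbb R^n\times\mathbb R^m$, and that $\partial f_{i,j}/\partial x_{v,w}=0$ for all $i,v\le p$ and all $w>j$. Norms are Euclidean norms and the induced matrix norms. Inputs $u$ and weights $G_1$ are piecewise continuous on $[0,\infty)$; solutions of differential equations are continuous and satisfy the equation except on a locally finite set of times. For $0\le k\le n$,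 the \emph{extended subspace observer} of order $k$ is $$\begin{aligned}\dot{\hat x}&=f(\hat x,u)+L(t)\,[y-\bar C\hat x],\\ \dot P_1&=B_1P_1+P_1B_1^{\top}-P_1(\bar C\bar Q)^{\top}(\bar C\bar Q)P_1+G_1(t),\\ \dot{\bar Q}&=(I-\bar Q\bar Q^{\top})A\bar Q+\bar QS_1,\end{aligned}$$ with $A(t)=\frac{\partial f}{\partial x}(\hat x(t),u(t))$, $L=\bar QP_1(\bar C\bar Q)^{\top}$, $B_1=\bar Q^{\top}A\bar Q-S_1$, where $S_1$ is skew-symmetric with entries $s_{ij}=\bar q_i^{\top}A\bar q_j$ for $i>j$ ($\bar q_i$ the columns of $\bar Q(t)\in\mathbb R^{n\times k}$), and $\bar Q(0)^{\top}\bar Q(0)=I_k$. Put $\eta(e,x,u)=f(x+e,u)-f(x,u)-\frac{\partial f}{\partial x}(x,u)\,e$. For a trajectory of the observer, let $Q(t)=[\bar Q(t)\;\bar Q_\perp(t)]\in\mathbb R^{n\times n}$ be a solution of $\dot Q=QS$ with $Q(0)$ orthogonal, where $S$ is skew-symmetric with entries $s_{ij}=q_i^\top Aq_j$ for $i>j$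 ($q_i$ the columns of $Q$). Let $j^\star$ be the first integer $0\le j^\star\le n$ such that the upper Bohl exponents $\limsup_{H\to\infty,\,s\to\infty}\frac1H\int_s^{s+H}q_i^{\top}Aq_i\,d\tau$ are negative for $i=j^\star+1,\dots,n$. \textbf{Theorem.} Under these assumptions: (a3) There are $\epsilon,\kappa>0$ such that $\|\eta(e,x,u)\|\le\kappa\|e\|^2$ for all $x,e\in\mathbb R^n$ with $\|e\|\le\epsilon$ and all $u\in\mathbb R^m$. Moreover, for every $0\le k\le n$, every $P_0\succ0$ in $\mathbb R^{k\times k}$ and all $0<g_1\le g_2$ there are positive constants $\alpha,p_1,p_2$ such that for every symmetric $G_1$ with $g_1I\preceq G_1(t)\preceq g_2I$ for all $t\ge 0$, every input $u$, every solution $x$ of the system on $[0,\infty)$ with output $y=\bar Cx$, every $\hat x_0\in\mathbb R^n$ and every $\bar Q_0\in\mathbb R^{n\times k}$ with $\bar Q_0^\top\bar Q_0=I_k$, the observer has a trajectory on all of $[0,\infty)$ with $\hat x(0)=\hat x_0$, $P_1(0)=P_0$, $\bar Q(0)=\bar Q_0$, and every such trajectory satisfies: (a1) $\|A(t)\|\le\alpha$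 for all $t\ge0$; (a2) $p_1I\preceq P_1(t)\preceq p_2I$ for all $t\ge0$; and, whenever $j^\star\le k$ (for some completion $Q$ as above), the origin is a locally uniformly exponentially stable equilibrium of the estimation error dynamics $$\dot e=[A(t)-L(t)\bar C]\,e+\eta(e,\hat x(t),u(t)),$$ in which $\hat x(t)$, $A(t)$ and $L(t)$ are taken along the observer trajectory. That is, there are $\mu,\rho>0$ and $K\ge1$ such that for all $t_0\ge0$ and all $\|e_0\|\le\rho$ a solution with $e(t_0)=e_0$ exists on $[t_0,\infty)$, and every such solution satisfies $\|e(t)\|\le Ke^{-\mu(t-t_0)}\|e_0\|$ for all $t\ge t_0$. -/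

import Mathlib

open Set Filter Topology
open scoped Matrix Matrix.Norms.L2Operator

noncomputable section

namespace SubspaceObserver

/-! Matrices carry the norm induced by the Euclidean norm. -/

/-! ### Differential equations -/

/-- `x` is a solution on `[t₀, ∞)` of `ẋ = F(t, x)`: it is continuous there and satisfies the equation
at all times but those of a locally finite exceptional set (the jump times of the data). -/
def SolvesFrom {E : Type*} [NormedAddCommGroup E] [NormedSpace ℝ E]
    (t₀ : ℝ) (F : ℝ → E → E) (x : ℝ → E) : Prop :=
  ContinuousOn x (Ici t₀) ∧
    ∃ D : Set ℝ, (∀ T : ℝ, (D ∩ Icc t₀ T).Finite) ∧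
      ∀ t : ℝ, t₀ ≤ t → t ∉ D → HasDerivWithinAt x (F t (x t)) (Ici t₀) t

/-- Piecewise continuity on `[0, ∞)`: finitely many discontinuities in every bounded interval, with
one-sided limits everywhere. -/
def PiecewiseContinuous {E : Type*} [NormedAddCommGroup E] (g : ℝ → E) : Prop :=
  (∃ D : Set ℝ, (∀ T : ℝ, (D ∩ Icc 0 T).Finite) ∧
      ∀ t : ℝ, 0 ≤ t → t ∉ D → ContinuousWithinAt g (Ici 0) t) ∧
    (∀ t : ℝ, 0 ≤ t → ∃ a : E, Tendsto g (𝓝[>] t) (𝓝 a)) ∧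
    (∀ t : ℝ, 0 < t → ∃ a : E, Tendsto g (𝓝[<] t) (𝓝 a))

/-- The origin is a (locally) uniformly exponentially stable equilibrium of `ẋ = F(t, x)`, `t ≥ 0`:
the constants `μ`, `ρ`, `K` do not depend on the initial time `t₀`. Solutions that start in the ball of
radius `ρ` exist on `[t₀, ∞)`. -/
def LocallyUniformlyExponentiallyStable {E : Type*} [NormedAddCommGroup E] [NormedSpace ℝ E]
    (F : ℝ → E → E) : Prop :=
  (∀ t : ℝ, 0 ≤ t → F t 0 = 0) ∧
    ∃ μ ρ K : ℝ, 0 < μ ∧ 0 < ρ ∧ 1 ≤ K ∧ ∀ t₀ : ℝ, 0 ≤ t₀ →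
      (∀ x₀ : E, ‖x₀‖ ≤ ρ → ∃ x : ℝ → E, SolvesFrom t₀ F x ∧ x t₀ = x₀) ∧
      ∀ x : ℝ → E, SolvesFrom t₀ F x → ‖x t₀‖ ≤ ρ →
        ∀ t : ℝ, t₀ ≤ t → ‖x t‖ ≤ K * Real.exp (-μ * (t - t₀)) * ‖x t₀‖

section General

variable {ι κ U : Type*} [Fintype ι] [DecidableEq ι] [Fintype κ] [DecidableEq κ]

/-- The Jacobian matrix `∂f/∂x` at `(x, u)`. -/
def jacobian (f : EuclideanSpace ℝ ι → U → EuclideanSpace ℝ ι) (x : EuclideanSpace ℝ ι) (u : U) :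
    Matrix ι ι ℝ :=
  Matrix.of fun i j => (fderiv ℝ (fun z => f z u) x (EuclideanSpace.single j 1)) i

/-- The remainder `η(e, x, u) = f(x + e, u) - f(x, u) - (∂f/∂x)(x, u) e` of the first order Taylor
expansion. -/
def taylorRemainder (f : EuclideanSpace ℝ ι → U → EuclideanSpace ℝ ι)
    (e x : EuclideanSpace ℝ ι) (u : U) : EuclideanSpace ℝ ι :=
  f (x + e) u - f x u - Matrix.toEuclideanLin (jacobian f x u) e

/-! ### Continuous QR decomposition -/

/-- The skew-symmetric matrix with entries `s_ij = q_iᵀ A q_j` for `i > j`, where `q_i` is the `i`-th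
column of `Q`. -/
def skewPart {k : ℕ} (A : Matrix ι ι ℝ) (Q : Matrix ι (Fin k) ℝ) : Matrix (Fin k) (Fin k) ℝ :=
  Matrix.of fun i j =>
    if j < i then (Qᵀ * A * Q) i j else if i < j then -(Qᵀ * A * Q) j i else 0

/-- `B₁ = Q̄ᵀ A Q̄ - S₁`. -/
def reducedB {k : ℕ} (A : Matrix ι ι ℝ) (Q : Matrix ι (Fin k) ℝ) : Matrix (Fin k) (Fin k) ℝ :=
  Qᵀ * A * Q - skewPart A Q

/-- `Q : [0, ∞) → ℝ^{n × n}` is the orthogonal factor of a continuous QR decomposition of a fundamental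
solution of `ẋ = A(t) x`, i.e. `Q(0)` is orthogonal and `Q̇ = Q S`. -/
def IsQRFactor (A : ℝ → Matrix ι ι ℝ) (Q : ℝ → Matrix ι (Fin (Fintype.card ι)) ℝ) : Prop :=
  (Q 0)ᵀ * Q 0 = 1 ∧ Q 0 * (Q 0)ᵀ = 1 ∧ SolvesFrom 0 (fun t Z => Z * skewPart (A t) Z) Q

/-- The upper Bohl exponent of a scalar function: the limit superior of `(1/H) ∫_s^{s+H} b` as
`H → ∞` and `s → ∞`. -/
def upperBohl (b : ℝ → ℝ) : EReal :=
  limsup (fun q : ℝ × ℝ => ((q.1⁻¹ * ∫ τ in q.2..(q.2 + q.1), b τ : ℝ) : EReal)) (atTop ×ˢ atTop)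

/-- The first integer `0 ≤ j ≤ n` such that the upper Bohl exponents of `q_iᵀ A q_i` are negative for
`i = j + 1, …, n` (which in zero-based numbering are the columns `i ≥ j`). -/
def jStar (A : ℝ → Matrix ι ι ℝ) (Q : ℝ → Matrix ι (Fin (Fintype.card ι)) ℝ) : ℕ :=
  sInf {j : ℕ | j ≤ Fintype.card ι ∧ ∀ i : Fin (Fintype.card ι), j ≤ (i : ℕ) →
    upperBohl (fun t => ((Q t)ᵀ * A t * Q t) i i) < 0}

/-! ### The extended subspace observer -/

/-- The observer gain `L = Q̄ P₁ C̄ᵀ` with `C̄ = C Q̄`. -/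
def gain {k : ℕ} (C : Matrix κ ι ℝ) (P : Matrix (Fin k) (Fin k) ℝ) (Q : Matrix ι (Fin k) ℝ) :
    Matrix ι κ ℝ :=
  Q * P * (C * Q)ᵀ

/-- `(x̂, P₁, Q̄)` is a trajectory on `[0, ∞)` of the extended subspace observer for `ẋ = f(x, u)`,
`y = C x`, driven by the input `u` and the output `y`, with the Riccati weight `G₁`. The linearization
is `A(t) = (∂f/∂x)(x̂(t), u(t))`. -/
structure IsObserverTrajectory {k : ℕ} (f : EuclideanSpace ℝ ι → U → EuclideanSpace ℝ ι)
    (C : Matrix κ ι ℝ) (u : ℝ → U) (y : ℝ → EuclideanSpace ℝ κ)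
    (G : ℝ → Matrix (Fin k) (Fin k) ℝ)
    (xh : ℝ → EuclideanSpace ℝ ι) (P : ℝ → Matrix (Fin k) (Fin k) ℝ)
    (Q : ℝ → Matrix ι (Fin k) ℝ) : Prop where
  state : SolvesFrom 0 (fun t z =>
    f z (u t) + Matrix.toEuclideanLin (gain C (P t) (Q t)) (y t - Matrix.toEuclideanLin C z)) xh
  riccati : SolvesFrom 0 (fun t X =>
    reducedB (jacobian f (xh t) (u t)) (Q t) * X + X * (reducedB (jacobian f (xh t) (u t)) (Q t))ᵀ
      - X * (C * Q t)ᵀ * (C * Q t) * X + G t) P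
  qr : SolvesFrom 0 (fun t Z =>
    (1 - Z * Zᵀ) * jacobian f (xh t) (u t) * Z + Z * skewPart (jacobian f (xh t) (u t)) Z) Q

/-- The right-hand side `[A(t) - L(t) C] e + η(e, x̂(t), u(t))` of the estimation error dynamics along
an observer trajectory. -/
def errorField {k : ℕ} (f : EuclideanSpace ℝ ι → U → EuclideanSpace ℝ ι)
    (C : Matrix κ ι ℝ) (u : ℝ → U) (xh : ℝ → EuclideanSpace ℝ ι)
    (P : ℝ → Matrix (Fin k) (Fin k) ℝ) (Q : ℝ → Matrix ι (Fin k) ℝ)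
    (t : ℝ) (e : EuclideanSpace ℝ ι) : EuclideanSpace ℝ ι :=
  Matrix.toEuclideanLin (jacobian f (xh t) (u t) - gain C (P t) (Q t) * C) e
    + taylorRemainder f e (xh t) (u t)

end General

/-! ### The uniformly observable canonical form -/

/-- The coordinates `x_{a,i}`, `a = 1, …, p`, `i = 1, …, l_a` (numbered from zero here). -/
abbrev StateIndex {p : ℕ} (l : Fin p → ℕ) : Type := Σ a : Fin p, Fin (l a)

/-- `Ā = diag(Ā₁, …, Ā_p)`, each block with ones on the first superdiagonal and zeros elsewhere. -/
def Abar {p : ℕ} (l : Fin p → ℕ) : Matrix (StateIndex l) (StateIndex l) ℝ :=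
  Matrix.of fun r s => if r.1 = s.1 ∧ (s.2 : ℕ) = (r.2 : ℕ) + 1 then 1 else 0

/-- `C̄ = diag(C̄₁, …, C̄_p)` with the row blocks `C̄_a = [1 0 ⋯ 0]`. -/
def Cbar {p : ℕ} (l : Fin p → ℕ) : Matrix (Fin p) (StateIndex l) ℝ :=
  Matrix.of fun a s => if a = s.1 ∧ (s.2 : ℕ) = 0 then 1 else 0

/-- The right-hand side `Ā x + f̄(x, u)`. -/
def canonicalField {p m : ℕ} (l : Fin p → ℕ)
    (fbar : EuclideanSpace ℝ (StateIndex l) → EuclideanSpace ℝ (Fin m) →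
      EuclideanSpace ℝ (StateIndex l))
    (x : EuclideanSpace ℝ (StateIndex l)) (u : EuclideanSpace ℝ (Fin m)) :
    EuclideanSpace ℝ (StateIndex l) :=
  Matrix.toEuclideanLin (Abar l) x + fbar x u

end SubspaceObserver

end

set_option linter.unusedSectionVars false

noncomputable section

namespace SubspaceObserver

/-! ### Calculus with a finite exceptional set -/

section Calculus

variable {E : Type*} [NormedAddCommGroup E] [NormedSpace ℝ E]

/-! Taylor remainder and Jacobian. The linear part `Ā x` has no Taylor remainder, so (a3) is the
mean value inequality applied twice to the components of `f̄` with bounded Hessian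
(`norm_taylorRemainder_le`). The global Lipschitz constant bounds the Jacobian by `‖Ā‖ + Λ`, which
is (a1).

Riccati bounds. The columns of `Q̄` stay orthonormal because the defect `Q̄ᵀQ̄ - 1` solves a linear
homogeneous equation. With `H = (C̄Q̄)ᵀ(C̄Q̄)`, the bounds (a2) come from comparing `P₁` with a
subsolution and a supersolution; in both cases the difference solves a Lyapunov equation with
nonnegative forcing and remains positive semidefinite (`lyapunov_nonneg`). The subsolution is a
small multiple of the identity (`ReducedTrajectory.lower_bound`). The supersolution encodes uniform
observability without a Gramian. There is one constant positive definite `S` such that `2 zᵀSAz ≤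
c|C̄z|² - γ|z|²` for every admissible Jacobian `A` (`exists_observability_form`): `S` is built for
the pure shift by induction on the block length and then rescaled by powers of a large `θ` along the
depth of the coordinates. The rescaling multiplies the shift by `θ`, while the triangular structure
keeps the conjugated `∂f̄/∂x` bounded. For large `β`, the matrix `β (Q̄ᵀSQ̄)⁻¹` dominates `P₁`
(`ReducedTrajectory.upper_bound`). The bounds depend only on the problem data, `P₀` and the bounds
on `G₁`.

Existence. The observer field is `C¹`. Bounded `Q̄` and `P₁` give a bounded gain, so `x̂` grows at
most exponentially on bounded intervals. Such a priori bounds turn Picard iteration for a truncated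
field into global existence (`exists_solvesFrom`).

Stability. Split `e` into `w = Q̄ᵀe` and its component orthogonal to the range of `Q̄`. On the
range, `wᵀP₁⁻¹w` decays because of the weight `G₁`, up to a coupling with the orthogonal component
(`exists_subspace_lyapunov`). The orthogonal component is described by the last `n - k` coordinates
of `Qᵀe` for the completed QR factor. The gain has its range in that of `Q̄` and does not act on
these coordinates, and their linear part is upper triangular with diagonal `qᵢᵀAqᵢ`. Negative upper
Bohl exponents give bounded weights `exp (2 φᵢ)` with a common decay rate, and geometric factors `θ
^ i` absorb the off-diagonal terms (`exists_cascade_lyapunov`). The sum of the first function and a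
large multiple of the second is a quadratic Lyapunov function, and the remainder adds only a cubic
term (`exists_exp_decay`, `exp_decay_of_lyapunov`). -/

/-- `f` is continuous on `[a, b]` and has derivative `f'` on `(a, b)` up to finitely many points. -/
def PDeriv (a b : ℝ) (f f' : ℝ → E) : Prop :=
  ContinuousOn f (Icc a b) ∧ ∀ᶠ t in cofinite, t ∈ Ioo a b → HasDerivAt f (f' t) t

theorem PDeriv.restrict {a b a' b' : ℝ} {f f' : ℝ → E} (h : PDeriv a b f f') (ha : a ≤ a')
    (hb : b' ≤ b) : PDeriv a' b' f f' :=
  ⟨h.1.mono (Icc_subset_Icc ha hb), h.2.mono fun _ ht h' => ht (Ioo_subset_Ioo ha hb h')⟩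

theorem PDeriv.congr_deriv {a b : ℝ} {f f' g' : ℝ → E} (h : PDeriv a b f f')
    (hg : ∀ t ∈ Ioo a b, f' t = g' t) : PDeriv a b f g' :=
  ⟨h.1, h.2.mono fun t ht h' => hg t h' ▸ ht h'⟩

theorem PDeriv.add {a b : ℝ} {f f' g g' : ℝ → E} (h : PDeriv a b f f') (h2 : PDeriv a b g g') :
    PDeriv a b (fun t => f t + g t) (fun t => f' t + g' t) :=
  ⟨h.1.add h2.1, by
    filter_upwards [h.2, h2.2] with t ht ht2 hm using (ht hm).add (ht2 hm)⟩

theorem PDeriv.sub {a b : ℝ} {f f' g g' : ℝ → E} (h : PDeriv a b f f') (h2 : PDeriv a b g g') :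
    PDeriv a b (fun t => f t - g t) (fun t => f' t - g' t) :=
  ⟨h.1.sub h2.1, by
    filter_upwards [h.2, h2.2] with t ht ht2 hm using (ht hm).sub (ht2 hm)⟩

theorem PDeriv.of_hasDerivAt {a b : ℝ} {f f' : ℝ → E} (h : ∀ t, HasDerivAt f (f' t) t) :
    PDeriv a b f f' :=
  ⟨fun t _ => (h t).continuousAt.continuousWithinAt, Eventually.of_forall fun t _ => h t⟩

theorem PDeriv.prodMk {F : Type*} [NormedAddCommGroup F] [NormedSpace ℝ F] {a b : ℝ}
    {f f' : ℝ → E} {g g' : ℝ → F} (h : PDeriv a b f f') (h2 : PDeriv a b g g') :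
    PDeriv a b (fun t => (f t, g t)) (fun t => (f' t, g' t)) :=
  ⟨h.1.prodMk h2.1, by
    filter_upwards [h.2, h2.2] with t ht ht2 hm using (ht hm).prodMk (ht2 hm)⟩

theorem PDeriv.clm {F : Type*} [NormedAddCommGroup F] [NormedSpace ℝ F] {a b : ℝ}
    {f f' : ℝ → E} (L : E →L[ℝ] F) (h : PDeriv a b f f') :
    PDeriv a b (fun t => L (f t)) (fun t => L (f' t)) :=
  ⟨L.continuous.comp_continuousOn h.1, by
    filter_upwards [h.2] with t ht hm using L.hasFDerivAt.comp_hasDerivAt t (ht hm)⟩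

theorem PDeriv.bilin {F G : Type*} [NormedAddCommGroup F] [NormedSpace ℝ F]
    [NormedAddCommGroup G] [NormedSpace ℝ G] {a b : ℝ}
    {f f' : ℝ → E} {g g' : ℝ → F} {B : E × F → G} (hB : IsBoundedBilinearMap ℝ B)
    (h : PDeriv a b f f') (h2 : PDeriv a b g g') :
    PDeriv a b (fun t => B (f t, g t)) (fun t => B (f t, g' t) + B (f' t, g t)) :=
  ⟨hB.continuous.comp_continuousOn (h.1.prodMk h2.1), by
    filter_upwards [h.2, h2.2] with t ht ht2 hm
    have := (hB.hasFDerivAt (f t, g t)).comp_hasDerivAt t ((ht hm).prodMk (ht2 hm))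
    simpa [Function.comp_def] using this⟩

theorem PDeriv.smul {a b : ℝ} {c c' : ℝ → ℝ} {f f' : ℝ → E}
    (h : PDeriv a b c c') (h2 : PDeriv a b f f') :
    PDeriv a b (fun t => c t • f t) (fun t => c t • f' t + c' t • f t) :=
  PDeriv.bilin isBoundedBilinearMap_smul h h2

theorem PDeriv.mul {a b : ℝ} {c c' f f' : ℝ → ℝ}
    (h : PDeriv a b c c') (h2 : PDeriv a b f f') :
    PDeriv a b (fun t => c t * f t) (fun t => c t * f' t + c' t * f t) :=
  h.smul h2

theorem PDeriv.sum {ι : Type*} {s : Finset ι} {a b : ℝ} {f f' : ι → ℝ → E}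
    (h : ∀ i ∈ s, PDeriv a b (f i) (f' i)) :
    PDeriv a b (fun t => ∑ i ∈ s, f i t) (fun t => ∑ i ∈ s, f' i t) :=
  ⟨continuousOn_finsetSum _ fun i hi => (h i hi).1, by
    have : ∀ᶠ t in cofinite, ∀ i ∈ s, t ∈ Ioo a b → HasDerivAt (f i) (f' i t) t :=
      (eventually_all_finset s).2 fun i hi => (h i hi).2
    filter_upwards [this] with t ht hm
    exact HasDerivAt.fun_sum fun i hi => ht i hi hm⟩

/-- Splitting at the exceptional points: a transitive relation between the values at the end points
of intervals of differentiability holds between the end points. -/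
theorem PDeriv.induction {f f' : ℝ → E} (p : ℝ → ℝ → Prop)
    (hp : ∀ a b, a < b → ContinuousOn f (Icc a b) → (∀ t ∈ Ioo a b, HasDerivAt f (f' t) t) →
      ∀ x ∈ Icc a b, ∀ y ∈ Icc a b, x ≤ y → p x y)
    (htrans : ∀ x y z, x ≤ y → y ≤ z → p x y → p y z → p x z) {a b : ℝ} (hab : a < b)
    (h : PDeriv a b f f') : p a b := by
  have key : ∀ D : Finset ℝ, ∀ a b : ℝ, a < b → ContinuousOn f (Icc a b) →
      (∀ t ∈ Ioo a b, t ∉ D → HasDerivAt f (f' t) t) → p a b := by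
    intro D
    induction D using Finset.induction_on with
    | empty =>
      intro a b hab hc hd
      exact hp a b hab hc (fun t ht => hd t ht (by simp)) a (left_mem_Icc.2 hab.le) b
        (right_mem_Icc.2 hab.le) hab.le
    | insert d D hdD ih =>
      intro a b hab hc hd
      by_cases hdm : d ∈ Ioo a b
      · refine htrans a d b hdm.1.le hdm.2.le ?_ ?_
        · refine ih a d hdm.1 (hc.mono (Icc_subset_Icc_right hdm.2.le)) fun t ht htD => ?_
          exact hd t ⟨ht.1, ht.2.trans hdm.2⟩ (by simp [htD, ht.2.ne])
        · refine ih d b hdm.2 (hc.mono (Icc_subset_Icc_left hdm.1.le)) fun t ht htD => ?_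
          exact hd t ⟨hdm.1.trans ht.1, ht.2⟩ (by simp [htD, ht.1.ne'])
      · refine ih a b hab hc fun t ht htD => hd t ht ?_
        simp only [Finset.mem_insert, not_or]
        exact ⟨fun h => hdm (h ▸ ht), htD⟩
  refine key (eventually_cofinite.1 h.2).toFinset a b hab h.1 fun t ht htD => ?_
  simp only [Finite.mem_toFinset, mem_ofPred_eq, not_not] at htD
  exact htD ht

theorem PDeriv.le_of_nonneg {a b : ℝ} {f f' : ℝ → ℝ} (hab : a ≤ b) (h : PDeriv a b f f')
    (h0 : ∀ t ∈ Ioo a b, 0 ≤ f' t) : f a ≤ f b := by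
  rcases hab.eq_or_lt with rfl | hab
  · exact le_rfl
  -- `PDeriv.induction` quantifies over arbitrary subintervals, which need not lie in `[a, b]`.
  -- Replacing `f'` by zero outside `(a, b)` keeps the sign condition available on all of them.
  have h' : PDeriv a b f (fun t => if t ∈ Ioo a b then f' t else 0) :=
    h.congr_deriv fun t ht => by simp [ht]
  refine PDeriv.induction (f := f) (fun x y => f x ≤ f y) ?_ (fun _ _ _ _ _ => le_trans) hab h'
  intro a' b' hab' hc hd x hx y hy hxy
  have hd' : ∀ t ∈ interior (Icc a' b'),
      HasDerivAt f (if t ∈ Ioo a b then f' t else 0) t := fun t ht =>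
    hd t (by simpa using ht)
  refine monotoneOn_of_deriv_nonneg (convex_Icc a' b') hc
    (fun t ht => (hd' t ht).differentiableAt.differentiableWithinAt) (fun t ht => ?_) hx hy hxy
  rw [(hd' t ht).deriv]
  split_ifs with hm
  · exact h0 t hm
  · exact le_rfl

/-- The integrating factor `exp (-c t)` makes `exp (-c t) * f t` nonincreasing. No sign of `c` or
`f` is needed, so the lemma serves for growth as well as for decay. -/
theorem PDeriv.le_mul_exp {a b c : ℝ} {f f' : ℝ → ℝ} (hab : a ≤ b) (h : PDeriv a b f f')
    (h0 : ∀ t ∈ Ioo a b, f' t ≤ c * f t) : f b ≤ f a * Real.exp (c * (b - a)) := by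
  have he : PDeriv a b (fun t => -Real.exp (-c * t)) (fun t => c * Real.exp (-c * t)) :=
    .of_hasDerivAt fun t => by
      have := (((hasDerivAt_id t).const_mul (-c)).exp).neg
      simpa [mul_comm, Pi.neg_def] using this
  have := (he.mul h).le_of_nonneg hab fun t ht => by
    have := h0 t ht
    have := Real.exp_pos (-c * t)
    nlinarith
  have hb := Real.exp_pos (c * b)
  have e1 : Real.exp (c * b) * Real.exp (-c * b) = 1 := by rw [← Real.exp_add]; simp
  have e2 : Real.exp (c * (b - a)) = Real.exp (c * b) * Real.exp (-c * a) := by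
    rw [← Real.exp_add]; ring_nf
  rw [e2]
  calc f b = Real.exp (c * b) * (Real.exp (-c * b) * f b) := by rw [← mul_assoc, e1, one_mul]
    _ ≤ Real.exp (c * b) * (Real.exp (-c * a) * f a) := by
        apply mul_le_mul_of_nonneg_left _ hb.le; linarith
    _ = _ := by ring

/-- Grönwall's inequality holds between consecutive exceptional points, and the exponential bounds
multiply across them. -/
theorem PDeriv.norm_le_mul_exp {a b K : ℝ} {f f' : ℝ → E} (hab : a ≤ b) (h : PDeriv a b f f')
    (h0 : ∀ t ∈ Ioo a b, ‖f' t‖ ≤ K * ‖f t‖) : ‖f b‖ ≤ ‖f a‖ * Real.exp (K * (b - a)) := by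
  rcases hab.eq_or_lt with rfl | hab
  · simp
  classical
  have h' : PDeriv a b f (fun t => if t ∈ Ioo a b then f' t else 0) :=
    h.congr_deriv fun t ht => by simp [ht]
  have main : (a ≤ a ∧ b ≤ b → ‖f b‖ ≤ ‖f a‖ * Real.exp (K * (b - a))) := by
    refine PDeriv.induction (f := f)
      (fun x y => a ≤ x ∧ y ≤ b → ‖f y‖ ≤ ‖f x‖ * Real.exp (K * (y - x))) ?_ ?_ hab h'
    · intro a' b' hab' hc hd x hx y hy hxy hbd
      rcases hxy.eq_or_lt with rfl | hxy
      · simp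
      -- The derivative may fail to exist at the left end point `x`, so Grönwall's inequality starts
      -- at an interior `z`, which then tends to `x`.
      have step : ∀ z ∈ Ioo x y, ‖f y‖ ≤ ‖f z‖ * Real.exp (K * (y - z)) := by
        intro z hz
        have hder : ∀ t ∈ Ico z y, HasDerivAt f (f' t) t := fun t ht => by
          have := hd t ⟨hx.1.trans_lt (hz.1.trans_le ht.1), ht.2.trans_le hy.2⟩
          rwa [if_pos ⟨hbd.1.trans_lt (hz.1.trans_le ht.1), ht.2.trans_le hbd.2⟩] at this
        have := norm_le_gronwallBound_of_norm_deriv_right_le (f := f) (f' := f') (δ := ‖f z‖)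
          (K := K) (ε := 0) (a := z) (b := y)
          (hc.mono (Icc_subset_Icc (hx.1.trans hz.1.le) hy.2))
          (fun t ht => (hder t ht).hasDerivWithinAt) le_rfl
          (fun t ht => by
            simpa using h0 t ⟨hbd.1.trans_lt (hz.1.trans_le ht.1), ht.2.trans_le hbd.2⟩)
          y (right_mem_Icc.2 hz.2.le)
        rwa [gronwallBound_ε0] at this
      have hcx : Tendsto (fun z => ‖f z‖ * Real.exp (K * (y - z))) (𝓝[Ioo x y] x)
          (𝓝 (‖f x‖ * Real.exp (K * (y - x)))) := by
        have h1 : ContinuousWithinAt f (Ioo x y) x :=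
          (hc x hx).mono fun t ht => ⟨hx.1.trans ht.1.le, ht.2.le.trans hy.2⟩
        have h2 : ContinuousWithinAt (fun z => Real.exp (K * (y - z))) (Ioo x y) x := by fun_prop
        exact h1.norm.mul h2
      have : (𝓝[Ioo x y] x).NeBot := by
        rw [nhdsWithin_Ioo_eq_nhdsGT hxy]; infer_instance
      exact ge_of_tendsto hcx (eventually_mem_nhdsWithin.mono step)
    · intro x y z hxy hyz h1 h2 hbd
      calc ‖f z‖ ≤ ‖f y‖ * Real.exp (K * (z - y)) := h2 ⟨hbd.1.trans hxy, hbd.2⟩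
        _ ≤ ‖f x‖ * Real.exp (K * (y - x)) * Real.exp (K * (z - y)) := by
            gcongr; exact h1 ⟨hbd.1, hyz.trans hbd.2⟩
        _ = _ := by rw [mul_assoc, ← Real.exp_add]; ring_nf
  exact main ⟨le_rfl, le_rfl⟩

theorem PDeriv.eq_zero {a b K : ℝ} {f f' : ℝ → E} (h : PDeriv a b f f')
    (h0 : ∀ t ∈ Ioo a b, ‖f' t‖ ≤ K * ‖f t‖) (ha : f a = 0) : ∀ t ∈ Icc a b, f t = 0 := by
  intro t ht
  have := (h.restrict le_rfl ht.2).norm_le_mul_exp ht.1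
    (fun s hs => h0 s (Ioo_subset_Ioo_right ht.2 hs))
  simpa [ha] using this

/-- Adjoining the constant function `1` makes the affine bound homogeneous: in the maximum norm, the
pair `(f, 1)` satisfies a linear bound with constant `K + ε`. -/
theorem PDeriv.norm_le_of_linear_growth {a b K ε : ℝ} {f f' : ℝ → E} (hab : a ≤ b) (hK : 0 ≤ K)
    (hε : 0 ≤ ε) (h : PDeriv a b f f') (h0 : ∀ t ∈ Ioo a b, ‖f' t‖ ≤ K * ‖f t‖ + ε) :
    ‖f b‖ ≤ max ‖f a‖ 1 * Real.exp ((K + ε) * (b - a)) := by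
  have h1 : PDeriv a b (fun _ : ℝ => (1 : ℝ)) (fun _ => 0) :=
    .of_hasDerivAt fun t => hasDerivAt_const t 1
  have := (h.prodMk h1).norm_le_mul_exp (K := K + ε) hab fun t ht => by
    have h2 := h0 t ht
    simp only [Prod.norm_mk, norm_zero, norm_one]
    rw [max_eq_left (norm_nonneg _)]
    have h3 := le_max_left ‖f t‖ 1
    have h4 := le_max_right ‖f t‖ 1
    nlinarith
  simp only [Prod.norm_mk, norm_one] at this
  exact (le_max_left _ _).trans this

theorem SolvesFrom.pDeriv {t₀ : ℝ} {F : ℝ → E → E} {x : ℝ → E} (h : SolvesFrom t₀ F x) {a : ℝ}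
    (ha : t₀ ≤ a) (T : ℝ) : PDeriv a T x (fun t => F t (x t)) := by
  obtain ⟨hc, D, hD, hd⟩ := h
  refine ⟨hc.mono fun t ht => ha.trans ht.1, ?_⟩
  refine eventually_cofinite.2 ((hD T).subset fun t ht => ?_)
  simp only [mem_ofPred_eq, Classical.not_imp] at ht
  have h0 : t₀ < t := ha.trans_lt ht.1.1
  refine ⟨by_contra fun hn => ht.2 ?_, h0.le, ht.1.2.le⟩
  exact (hd t h0.le hn).hasDerivAt (Ici_mem_nhds h0)

theorem SolvesFrom.of_pDeriv {t₀ : ℝ} {F : ℝ → E → E} {x : ℝ → E}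
    (h : ∀ T, PDeriv t₀ T x (fun t => F t (x t))) : SolvesFrom t₀ F x := by
  -- The initial time joins the exceptional set because `PDeriv` gives no derivative at the left end
  -- point.
  refine ⟨fun t ht => ?_, {t | t = t₀ ∨ ¬ HasDerivAt x (F t (x t)) t}, fun T => ?_, ?_⟩
  · exact ((h (t + 1)).1 t ⟨ht, by linarith⟩).mono_of_mem_nhdsWithin
      (mem_nhdsWithin_iff_exists_mem_nhds_inter.2 ⟨Iio (t + 1), Iio_mem_nhds (by linarith),
        fun s hs => ⟨hs.2, hs.1.le⟩⟩)
  · refine ((eventually_cofinite.1 (h (T + 1)).2).union (finite_singleton t₀)).subset ?_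
    rintro t ⟨h1 | h1, h2⟩
    · exact Or.inr h1
    · rcases h2.1.eq_or_lt with h3 | h3
      · exact Or.inr h3.symm
      · refine Or.inl fun h4 => h1 (h4 ⟨h3, by linarith [h2.2]⟩)
  · intro t _ hn
    simp only [mem_ofPred_eq, not_or, not_not] at hn
    exact hn.2.hasDerivWithinAt

end Calculus

/-! ### Piecewise continuous functions -/

section Piecewise

variable {E F : Type*} [NormedAddCommGroup E] [NormedAddCommGroup F]

theorem PiecewiseContinuous.of_continuousOn {g : ℝ → E} (h : ContinuousOn g (Ici 0)) :
    PiecewiseContinuous g := by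
  refine ⟨⟨∅, by simp, fun t ht _ => h t ht⟩, fun t ht => ⟨g t, ?_⟩, fun t ht => ⟨g t, ?_⟩⟩
  · exact (h t ht).mono fun s hs => ht.trans (le_of_lt hs)
  · exact ((h t ht.le).continuousAt (Ici_mem_nhds ht)).continuousWithinAt

theorem PiecewiseContinuous.comp {g : ℝ → E} (h : PiecewiseContinuous g) {Φ : E → F}
    (hΦ : Continuous Φ) : PiecewiseContinuous (fun t => Φ (g t)) := by
  obtain ⟨⟨D, hD, hc⟩, hr, hl⟩ := h
  refine ⟨⟨D, hD, fun t ht hn => hΦ.continuousAt.comp_continuousWithinAt (hc t ht hn)⟩,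
    fun t ht => ?_, fun t ht => ?_⟩
  · obtain ⟨a, ha⟩ := hr t ht
    exact ⟨Φ a, (hΦ.tendsto a).comp ha⟩
  · obtain ⟨a, ha⟩ := hl t ht
    exact ⟨Φ a, (hΦ.tendsto a).comp ha⟩

theorem PiecewiseContinuous.prodMk {g : ℝ → E} {g' : ℝ → F} (h : PiecewiseContinuous g)
    (h' : PiecewiseContinuous g') : PiecewiseContinuous (fun t => (g t, g' t)) := by
  obtain ⟨⟨D, hD, hc⟩, hr, hl⟩ := h
  obtain ⟨⟨D', hD', hc'⟩, hr', hl'⟩ := h'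
  refine ⟨⟨D ∪ D', fun T => ?_, fun t ht hn => ?_⟩, fun t ht => ?_, fun t ht => ?_⟩
  · rw [union_inter_distrib_right]; exact (hD T).union (hD' T)
  · simp only [mem_union, not_or] at hn
    exact (hc t ht hn.1).prodMk (hc' t ht hn.2)
  · obtain ⟨a, ha⟩ := hr t ht
    obtain ⟨b, hb⟩ := hr' t ht
    exact ⟨(a, b), ha.prodMk_nhds hb⟩
  · obtain ⟨a, ha⟩ := hl t ht
    obtain ⟨b, hb⟩ := hl' t ht
    exact ⟨(a, b), ha.prodMk_nhds hb⟩

/-- One-sided limits make `g` bounded near every point, and compactness makes this uniform. The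
value at the point itself is unrelated to the limits and enters the local bound separately. -/
theorem PiecewiseContinuous.exists_bound {g : ℝ → E} (h : PiecewiseContinuous g) (T : ℝ) :
    ∃ M, 0 ≤ M ∧ ∀ t ∈ Icc 0 T, ‖g t‖ ≤ M := by
  obtain ⟨_, hr, hl⟩ := h
  have key : ∃ M, ∀ t ∈ Icc 0 T, ‖g t‖ ≤ M := by
    refine isCompact_Icc.induction_on (p := fun s => ∃ M, ∀ t ∈ s, ‖g t‖ ≤ M) ⟨0, by simp⟩
      (fun s t hst ⟨M, hM⟩ => ⟨M, fun x hx => hM x (hst hx)⟩) ?_ ?_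
    · rintro s t ⟨M, hM⟩ ⟨M', hM'⟩
      refine ⟨max M M', ?_⟩
      rintro x (hx | hx)
      · exact (hM x hx).trans (le_max_left _ _)
      · exact (hM' x hx).trans (le_max_right _ _)
    · intro t ht
      obtain ⟨a, ha⟩ := hr t ht.1
      have h1 : ∀ᶠ s in 𝓝[>] t, ‖g s‖ ≤ ‖a‖ + 1 :=
        (ha.norm.eventually (Iic_mem_nhds (by linarith : ‖a‖ < ‖a‖ + 1)))
      have h2 : ∃ M, ∀ᶠ s in 𝓝[<] t, 0 ≤ s → ‖g s‖ ≤ M := by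
        rcases ht.1.eq_or_lt with h0 | h0
        · refine ⟨0, eventually_mem_nhdsWithin.mono fun s hs hs' => ?_⟩
          exact absurd (hs'.trans_lt hs) (by simp [← h0])
        · obtain ⟨b, hb⟩ := hl t h0
          exact ⟨‖b‖ + 1, (hb.norm.eventually (Iic_mem_nhds (by linarith : ‖b‖ < ‖b‖ + 1))).mono
            fun s hs _ => hs⟩
      obtain ⟨M, hM⟩ := h2
      have h3 : ∀ᶠ s in 𝓝 t, 0 ≤ s → ‖g s‖ ≤ max (max (‖a‖ + 1) M) ‖g t‖ := by
        rw [← nhdsNE_sup_pure, ← nhdsLT_sup_nhdsGT, eventually_sup, eventually_sup]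
        refine ⟨⟨hM.mono fun s hs h => ?_, h1.mono fun s hs h => ?_⟩, ?_⟩
        · exact (hs h).trans ((le_max_right _ _).trans (le_max_left _ _))
        · exact hs.trans ((le_max_left _ _).trans (le_max_left _ _))
        · rw [eventually_pure]; exact fun _ => le_max_right _ _
      refine ⟨{s | 0 ≤ s → ‖g s‖ ≤ max (max (‖a‖ + 1) M) ‖g t‖} ∩ Icc 0 T,
        inter_mem (mem_nhdsWithin_of_mem_nhds h3) self_mem_nhdsWithin,
        max (max (‖a‖ + 1) M) ‖g t‖, fun s hs => ?_⟩
      exact hs.1 hs.2.1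
  obtain ⟨M, hM⟩ := key
  exact ⟨max M 0, le_max_right _ _, fun t ht => (hM t ht).trans (le_max_left _ _)⟩

/-- The constant extension of a piecewise continuous function to negative times. -/
theorem PiecewiseContinuous.continuousAt_extend {g : ℝ → E} (h : PiecewiseContinuous g) (T : ℝ) :
    ∀ᶠ t in cofinite, t ∈ Ioo 0 T → ContinuousAt (fun s => g (max s 0)) t := by
  obtain ⟨⟨D, hD, hc⟩, -, -⟩ := h
  refine eventually_cofinite.2 ((hD T).subset fun t ht => ?_)
  simp only [mem_ofPred_eq, Classical.not_imp] at ht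
  refine ⟨by_contra fun hn => ht.2 ?_, ht.1.1.le, ht.1.2.le⟩
  have := (hc t ht.1.1.le hn).continuousAt (Ici_mem_nhds ht.1.1)
  refine this.congr ?_
  filter_upwards [Ioi_mem_nhds ht.1.1] with s hs
  rw [max_eq_left (le_of_lt hs)]

theorem PiecewiseContinuous.intervalIntegrable_extend [NormedSpace ℝ E] {g : ℝ → E}
    (h : PiecewiseContinuous g) (a b : ℝ) :
    IntervalIntegrable (fun s => g (max s 0)) MeasureTheory.volume a b := by
  obtain ⟨T, hT⟩ : ∃ T, T = max (max a b) 0 + 1 := ⟨_, rfl⟩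
  obtain ⟨M, hM, hb⟩ := h.exists_bound T
  have hmT : ∀ s ∈ uIoc a b, max s 0 ∈ Icc 0 T := fun s hs => by
    have h1 := (uIoc_subset_uIcc hs)
    rw [mem_uIcc] at h1
    have h2 : s ≤ max a b := by rcases h1 with h1 | h1 <;> simp [h1.2]
    refine ⟨le_max_right _ _, ?_⟩
    rw [hT]
    have := max_le_max_right 0 h2
    linarith
  have hcont : (Ioo 0 T ∩ {t | ContinuousAt (fun s => g (max s 0)) t}ᶜ).Finite := by
    refine (eventually_cofinite.1 (h.continuousAt_extend T)).subset fun t ht => ?_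
    exact fun h => ht.2 (h ht.1)
  -- The constant extension can jump at `0`, so this point is removed together with the jumps inside
  -- the interval.
  obtain ⟨S, hS⟩ : ∃ S, S = insert 0 (Ioo 0 T ∩ {t | ContinuousAt (fun s => g (max s 0)) t}ᶜ) :=
    ⟨_, rfl⟩
  have hSf : S.Finite := hS ▸ hcont.insert 0
  rw [intervalIntegrable_iff]
  have hmeas : MeasureTheory.AEStronglyMeasurable (fun s => g (max s 0))
      (MeasureTheory.volume.restrict (uIoc a b)) := by
    have hco : ContinuousOn (fun s => g (max s 0)) (uIoc a b \ S) := by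
      intro t ht
      have h1 := hmT t ht.1
      have h2 : t ≠ 0 := fun h => ht.2 (by rw [hS, h]; exact mem_insert _ _)
      rcases lt_or_gt_of_ne h2 with h3 | h3
      · refine ContinuousAt.continuousWithinAt ((continuousAt_const (y := g 0)).congr ?_)
        filter_upwards [Iio_mem_nhds h3] with s hs
        rw [max_eq_right (le_of_lt hs)]
      · refine ContinuousAt.continuousWithinAt (by_contra fun hn => ht.2 ?_)
        rw [hS]
        refine mem_insert_of_mem _ ⟨⟨h3, ?_⟩, hn⟩
        have h4 := (uIoc_subset_uIcc ht.1)
        rw [mem_uIcc] at h4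
        have h5 : t ≤ max (max a b) 0 := by rcases h4 with h1 | h1 <;> simp [h1.2]
        rw [hT]; linarith
    have h1 := hco.aestronglyMeasurable (μ := MeasureTheory.volume)
      (measurableSet_uIoc.diff hSf.measurableSet)
    have h2 : MeasureTheory.volume.restrict (uIoc a b \ S) = MeasureTheory.volume.restrict (uIoc a b) :=
      MeasureTheory.Measure.restrict_congr_set
        (MeasureTheory.sdiff_null_ae_eq_self (hSf.measure_zero _))
    rwa [h2] at h1
  refine MeasureTheory.IntegrableOn.of_bound ?_ hmeas M ?_
  · simp [uIoc]
  · refine (MeasureTheory.ae_restrict_iff' measurableSet_uIoc).2 (Eventually.of_forall fun s hs => ?_)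
    exact hb _ (hmT s hs)

end Piecewise

/-! ### Existence of solutions -/

section Existence

variable {E : Type*} [NormedAddCommGroup E] [NormedSpace ℝ E]

theorem PDeriv.congr {a b : ℝ} {f f' g : ℝ → E} (h : PDeriv a b f f')
    (hg : ∀ t ∈ Icc a b, g t = f t) : PDeriv a b g f' := by
  refine ⟨h.1.congr hg, h.2.mono fun t ht h' => (ht h').congr_of_eventuallyEq ?_⟩
  filter_upwards [Ioo_mem_nhds h'.1 h'.2] with s hs using hg s (Ioo_subset_Icc_self hs)

theorem integral_exp_sub {a t lam : ℝ} (hlam : 0 < lam) :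
    ∫ s in a..t, Real.exp (lam * (s - a)) = (Real.exp (lam * (t - a)) - 1) / lam := by
  have hd : ∀ s ∈ uIcc a t, HasDerivAt (fun s => Real.exp (lam * (s - a)) / lam)
      (Real.exp (lam * (s - a))) s := fun s _ => by
    have h1 : HasDerivAt (fun s => lam * (s - a)) lam s := by
      simpa using ((hasDerivAt_id s).sub_const a).const_mul lam
    have h2 := h1.exp.div_const lam
    rwa [mul_div_assoc, div_self hlam.ne', mul_one] at h2
  rw [intervalIntegral.integral_eq_sub_of_hasDerivAt hd
    (Continuous.intervalIntegrable (by fun_prop) _ _)]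
  simp [sub_div]

/-- Picard iteration in an exponentially weighted supremum norm is a contraction on the whole
interval, whatever its length. The weight is built into the unknown: the solution at `s` is `exp
(lam * (s - a))` times the value of the fixed point. -/
theorem exists_pDeriv_of_lipschitz [CompleteSpace E] {F : ℝ → E → E} {a b K : ℝ} (ha : 0 ≤ a)
    (hab : a ≤ b) (hK : 0 ≤ K)
    (hL : ∀ t ∈ Icc a b, ∀ x y, ‖F t x - F t y‖ ≤ K * ‖x - y‖)
    (hP : ∀ x : ℝ → E, Continuous x → PiecewiseContinuous (fun s => F s (x s))) (x₀ : E) :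
    ∃ x : ℝ → E, PDeriv a b x (fun t => F t (x t)) ∧ x a = x₀ := by
  -- This gives `K / lam ≤ 1 / 2`, the contraction factor; the summand `1` keeps `lam` positive when
  -- `K = 0`.
  obtain ⟨lam, hlam⟩ : ∃ lam, lam = 2 * K + 1 := ⟨_, rfl⟩
  have hlam0 : 0 < lam := by linarith
  have : Nonempty (Icc a b) := ⟨⟨a, left_mem_Icc.2 hab⟩⟩
  let X : C(Icc a b, E) → ℝ → E := fun x s => Real.exp (lam * (s - a)) • x (projIcc a b hab s)
  have hX : ∀ x, Continuous (X x) := fun x => by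
    have := x.continuous.comp (continuous_projIcc (h := hab))
    exact (by fun_prop : Continuous fun s => Real.exp (lam * (s - a))).smul this
  let G : C(Icc a b, E) → ℝ → E := fun x s => F (max s 0) (X x (max s 0))
  have hG : ∀ x a' b', IntervalIntegrable (G x) MeasureTheory.volume a' b' := fun x a' b' =>
    (hP (X x) (hX x)).intervalIntegrable_extend a' b'
  let T : C(Icc a b, E) → C(Icc a b, E) := fun x =>
    ⟨fun t => Real.exp (-(lam * (t - a))) • (x₀ + ∫ s in a..t, G x s), by
      have h1 := intervalIntegral.continuous_primitive (hG x) a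
      have h2 : Continuous fun t : ℝ => Real.exp (-(lam * (t - a))) := by fun_prop
      exact (h2.smul (continuous_const.add h1)).comp continuous_subtype_val⟩
  have hT : ContractingWith (1 / 2) T := by
    refine ⟨by rw [← NNReal.coe_lt_coe]; norm_num, LipschitzWith.of_dist_le_mul fun x y => ?_⟩
    rw [ContinuousMap.dist_le (by positivity)]
    rintro ⟨t, ht⟩
    have hint : ‖∫ s in a..t, (G x s - G y s)‖ ≤
        ∫ s in a..t, K * dist x y * Real.exp (lam * (s - a)) := by
      refine intervalIntegral.norm_integral_le_of_norm_le ht.1 (Eventually.of_forall fun s hs => ?_)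
        (Continuous.intervalIntegrable (by fun_prop) _ _)
      have hs0 : max s 0 = s := max_eq_left (ha.trans hs.1.le)
      have hsI : s ∈ Icc a b := ⟨hs.1.le, hs.2.trans ht.2⟩
      simp only [G, hs0]
      refine (hL s hsI _ _).trans ?_
      simp only [X, ← smul_sub, norm_smul, Real.norm_eq_abs, Real.abs_exp]
      have : ‖x (projIcc a b hab s) - y (projIcc a b hab s)‖ ≤ dist x y := by
        rw [← dist_eq_norm]; exact ContinuousMap.dist_apply_le_dist _
      calc K * (Real.exp (lam * (s - a)) * ‖x (projIcc a b hab s) - y (projIcc a b hab s)‖)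
          ≤ K * (Real.exp (lam * (s - a)) * dist x y) := by gcongr
        _ = _ := by ring
    rw [intervalIntegral.integral_const_mul, integral_exp_sub hlam0] at hint
    have hTd : T x ⟨t, ht⟩ - T y ⟨t, ht⟩ =
        Real.exp (-(lam * (t - a))) • ∫ s in a..t, (G x s - G y s) := by
      rw [intervalIntegral.integral_sub (hG x _ _) (hG y _ _)]
      simp only [T, ContinuousMap.coe_mk, ← smul_sub]
      congr 1; abel
    rw [dist_eq_norm, hTd, norm_smul, Real.norm_eq_abs, Real.abs_exp]
    have e1 : Real.exp (-(lam * (t - a))) * Real.exp (lam * (t - a)) = 1 := by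
      rw [← Real.exp_add]; simp
    have e0 := Real.exp_pos (-(lam * (t - a)))
    have hd : 0 ≤ dist x y := dist_nonneg
    have hKl : K / lam ≤ 1 / 2 := by
      rw [div_le_iff₀ hlam0, hlam]; linarith
    have h1 : 0 ≤ K / lam := by positivity
    push_cast
    calc _ ≤ Real.exp (-(lam * (t - a))) *
          (K * dist x y * ((Real.exp (lam * (t - a)) - 1) / lam)) := by gcongr
      _ = K / lam * dist x y * (Real.exp (-(lam * (t - a))) * Real.exp (lam * (t - a))
            - Real.exp (-(lam * (t - a)))) := by ring
      _ ≤ K / lam * dist x y * 1 := by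
            apply mul_le_mul_of_nonneg_left _ (by positivity)
            rw [e1]; linarith
      _ ≤ _ := by rw [mul_one]; exact mul_le_mul_of_nonneg_right hKl hd
  obtain ⟨x, hx⟩ : ∃ x, T x = x := ⟨_, hT.fixedPoint_isFixedPt⟩
  have hXx : ∀ t ∈ Icc a b, X x t = x₀ + ∫ s in a..t, G x s := fun t ht => by
    have h1 : x ⟨t, ht⟩ = T x ⟨t, ht⟩ := by rw [hx]
    simp only [X, projIcc_of_mem hab ht]
    rw [h1]
    simp only [T, ContinuousMap.coe_mk, smul_smul, ← Real.exp_add]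
    simp
  refine ⟨X x, PDeriv.congr ⟨?_, ?_⟩ hXx, ?_⟩
  · exact (continuous_const.add (intervalIntegral.continuous_primitive (hG x) a)).continuousOn
  · filter_upwards [(hP (X x) (hX x)).continuousAt_extend b] with t ht htab
    have ht0 : 0 < t := ha.trans_lt htab.1
    have hc : ContinuousAt (G x) t := ht ⟨ht0, htab.2⟩
    have hm : StronglyMeasurableAtFilter (G x) (𝓝 t) MeasureTheory.volume := by
      refine ⟨Ioc a b, Ioc_mem_nhds htab.1 htab.2, ?_⟩
      exact (intervalIntegrable_iff_integrableOn_Ioc_of_le hab).1 (hG x a b) |>.aestronglyMeasurable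
    have := (intervalIntegral.integral_hasDerivAt_right (hG x a t) hm hc).const_add x₀
    have h2 : G x t = F t (X x t) := by simp only [G, max_eq_left ht0.le]
    rwa [h2] at this
  · rw [hXx a (left_mem_Icc.2 hab)]; simp

variable {D Z : Type*} [NormedAddCommGroup D] [NormedSpace ℝ D] [FiniteDimensional ℝ D]
  [NormedAddCommGroup Z] [NormedSpace ℝ Z] [FiniteDimensional ℝ Z]

/-- A continuously differentiable vector field coincides on a given ball with one that is globally
Lipschitz in the state, uniformly for bounded data. -/
theorem exists_lipschitz_truncation {Φ : D × Z → Z} (hΦ : ContDiff ℝ 1 Φ) (R M : ℝ) :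
    ∃ (Ψ : D × Z → Z) (K : ℝ), 0 ≤ K ∧ Continuous Ψ ∧ (∀ d z, ‖z‖ ≤ R → Ψ (d, z) = Φ (d, z)) ∧
      ∀ d, ‖d‖ ≤ M → ∀ z w, ‖Ψ (d, z) - Ψ (d, w)‖ ≤ K * ‖z - w‖ := by
  let χ : ContDiffBump (0 : Z) := ⟨max R 1, max R 1 + 1, by positivity, by linarith⟩
  let Ψ : D × Z → Z := fun q => χ q.2 • Φ q
  have hΨ : ContDiff ℝ 1 Ψ := (χ.contDiff.comp contDiff_snd).smul hΦ
  obtain ⟨K, hK⟩ := ((isCompact_closedBall (0 : D) M).prod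
    (isCompact_closedBall (0 : Z) (max R 1 + 1))).exists_bound_of_continuousOn
    (f := fderiv ℝ Ψ) (hΨ.continuous_fderiv one_ne_zero).continuousOn
  have hK' : ∀ d z, ‖d‖ ≤ M → ‖fderiv ℝ Ψ (d, z)‖ ≤ max K 0 := fun d z hd => by
    by_cases hz : ‖z‖ ≤ max R 1 + 1
    · exact (hK (d, z) ⟨by simpa using hd, by simpa using hz⟩).trans (le_max_left _ _)
    -- Outside the support of the bump the field vanishes near the point, so the bound obtained by
    -- compactness covers all states.
    · have : Ψ =ᶠ[𝓝 (d, z)] fun _ => 0 := by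
        have h1 : ∀ᶠ q : D × Z in 𝓝 (d, z), max R 1 + 1 < ‖q.2‖ :=
          (continuous_snd.norm.continuousAt (x := (d, z))).eventually
            (Ioi_mem_nhds (not_le.1 hz))
        filter_upwards [h1] with q hq
        have : χ q.2 = 0 := χ.zero_of_le_dist (by simpa [χ] using hq.le)
        simp [Ψ, this]
      rw [this.fderiv_eq]; simp
  refine ⟨Ψ, max K 0, le_max_right _ _, hΨ.continuous, fun d z hz => ?_, fun d hd z w => ?_⟩
  · have : χ z = 1 := χ.one_of_mem_closedBall (by
      simp only [χ, Metric.mem_closedBall, dist_zero_right]; exact hz.trans (le_max_left _ _))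
    simp [Ψ, this]
  · have hder : ∀ z ∈ (univ : Set Z), HasFDerivWithinAt (fun z => Ψ (d, z))
        ((fderiv ℝ Ψ (d, z)).comp (ContinuousLinearMap.inr ℝ D Z)) univ z := fun z _ => by
      have h1 := (hΨ.differentiable one_ne_zero (d, z)).hasFDerivAt
      exact (h1.comp z (hasFDerivAt_prodMk_right d z)).hasFDerivWithinAt
    refine convex_univ.norm_image_sub_le_of_norm_hasFDerivWithin_le hder (fun z _ => ?_)
      (mem_univ w) (mem_univ z)
    refine (ContinuousLinearMap.opNorm_comp_le _ _).trans ?_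
    calc _ ≤ max K 0 * 1 := by
          gcongr
          · exact hK' d z hd
          · exact ContinuousLinearMap.norm_inr_le_one ℝ D Z
      _ = _ := mul_one _

/-- Both solutions are bounded on the compact interval, so they solve the same truncated, globally
Lipschitz equation, and Grönwall's inequality applies to their difference. -/
theorem PDeriv.unique {Φ : D × Z → Z} (hΦ : ContDiff ℝ 1 Φ) {d : ℝ → D}
    (hd : PiecewiseContinuous d) {a b : ℝ} (ha : 0 ≤ a) {z w : ℝ → Z}
    (hz : PDeriv a b z (fun t => Φ (d t, z t))) (hw : PDeriv a b w (fun t => Φ (d t, w t)))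
    (h0 : z a = w a) : ∀ t ∈ Icc a b, z t = w t := by
  obtain ⟨M, -, hM⟩ := hd.exists_bound b
  obtain ⟨R₁, h₁⟩ := isCompact_Icc.exists_bound_of_continuousOn hz.1
  obtain ⟨R₂, h₂⟩ := isCompact_Icc.exists_bound_of_continuousOn hw.1
  obtain ⟨Ψ, K, -, -, hΨ, hL⟩ := exists_lipschitz_truncation hΦ (max R₁ R₂) M
  have := (hz.sub hw).eq_zero (K := K) (fun t ht => by
    have htI := Ioo_subset_Icc_self ht
    have e1 := hΨ (d t) (z t) ((h₁ t htI).trans (le_max_left _ _))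
    have e2 := hΨ (d t) (w t) ((h₂ t htI).trans (le_max_right _ _))
    rw [← e1, ← e2]
    exact hL _ (hM t ⟨ha.trans htI.1, htI.2⟩) _ _) (by simp [h0])
  exact fun t ht => sub_eq_zero.1 (this t ht)

/-- First exit argument: the field is truncated beyond radius `R + 1`. Up to the first time the
truncated solution reaches that radius it solves the original equation, and there the a priori bound
`R` is contradicted. -/
theorem exists_pDeriv_of_bound {Φ : D × Z → Z} (hΦ : ContDiff ℝ 1 Φ) {d : ℝ → D}
    (hd : PiecewiseContinuous d) {a T R : ℝ} (ha : 0 ≤ a) (haT : a ≤ T) (z₀ : Z)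
    (hb : ∀ b ∈ Icc a T, ∀ z : ℝ → Z, PDeriv a b z (fun t => Φ (d t, z t)) → z a = z₀ → ‖z b‖ ≤ R) :
    ∃ z : ℝ → Z, PDeriv a T z (fun t => Φ (d t, z t)) ∧ z a = z₀ := by
  have := FiniteDimensional.complete ℝ Z
  obtain ⟨M, -, hM⟩ := hd.exists_bound T
  obtain ⟨Ψ, K, hK, hΨc, hΨ, hL⟩ := exists_lipschitz_truncation hΦ (R + 1) M
  obtain ⟨z, hz, hz0⟩ := exists_pDeriv_of_lipschitz (F := fun t w => Ψ (d t, w)) ha haT hK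
    (fun t ht => hL _ (hM t ⟨ha.trans ht.1, ht.2⟩))
    (fun x hx => (hd.prodMk (.of_continuousOn hx.continuousOn)).comp hΨc) z₀
  have hsol : ∀ b ≤ T, (∀ t ∈ Ioo a b, ‖z t‖ ≤ R + 1) → PDeriv a b z (fun t => Φ (d t, z t)) :=
    fun b hbT hbd => (hz.restrict le_rfl hbT).congr_deriv fun t ht => hΨ _ _ (hbd t ht)
  refine ⟨z, hsol T le_rfl fun t ht => ?_, hz0⟩
  by_contra hn
  let S : Set ℝ := Icc a T ∩ (fun t => ‖z t‖) ⁻¹' Ici (R + 1)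
  have hS : IsCompact S := isCompact_Icc.of_isClosed_subset
    (hz.1.norm.preimage_isClosed_of_isClosed isClosed_Icc isClosed_Ici) inter_subset_left
  have hSn : S.Nonempty := ⟨t, Ioo_subset_Icc_self ht, (not_le.1 hn).le⟩
  obtain ⟨⟨h1, h2⟩, h3⟩ := hS.isLeast_sInf hSn
  have := hb _ h1 z (hsol _ h1.2 fun s hs => by
    by_contra hs'
    exact hs.2.not_ge (h3 ⟨⟨hs.1.le, hs.2.le.trans h1.2⟩, (not_le.1 hs').le⟩)) hz0
  have h4 : R + 1 ≤ ‖z (sInf S)‖ := h2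
  linarith

/-- Global existence from an a priori bound. -/
theorem exists_solvesFrom {Φ : D × Z → Z} (hΦ : ContDiff ℝ 1 Φ) {d : ℝ → D}
    (hd : PiecewiseContinuous d) {a : ℝ} (ha : 0 ≤ a) (z₀ : Z)
    (hb : ∀ T, a ≤ T → ∃ R : ℝ, ∀ b ∈ Icc a T, ∀ z : ℝ → Z,
      PDeriv a b z (fun t => Φ (d t, z t)) → z a = z₀ → ‖z b‖ ≤ R) :
    ∃ z : ℝ → Z, SolvesFrom a (fun t w => Φ (d t, w)) z ∧ z a = z₀ := by
  have hex : ∀ N : ℕ, ∃ z : ℝ → Z, PDeriv a (a + N) z (fun t => Φ (d t, z t)) ∧ z a = z₀ :=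
    fun N => by
      have haN : a ≤ a + N := by simp
      obtain ⟨R, hR⟩ := hb _ haN
      exact exists_pDeriv_of_bound hΦ hd ha haN z₀ hR
  choose z hz hz0 using hex
  have hagree : ∀ (N N' : ℕ) (t : ℝ), a ≤ t → t ≤ a + N → t ≤ a + N' → z N t = z N' t :=
    fun N N' t h1 h2 h3 => PDeriv.unique hΦ hd ha ((hz N).restrict le_rfl h2)
      ((hz N').restrict le_rfl h3) ((hz0 N).trans (hz0 N').symm) t (right_mem_Icc.2 h1)
  have hceil : ∀ t : ℝ, t ≤ a + ⌈t - a⌉₊ := fun t => by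
    have := Nat.le_ceil (t - a); linarith
  let y : ℝ → Z := fun t => z ⌈t - a⌉₊ t
  refine ⟨y, SolvesFrom.of_pDeriv fun T => ?_, hz0 _⟩
  have hy : ∀ t ∈ Icc a T, y t = z ⌈T - a⌉₊ t := fun t ht =>
    hagree _ _ _ ht.1 (hceil t) (ht.2.trans (hceil T))
  exact (((hz ⌈T - a⌉₊).restrict le_rfl (hceil T)).congr hy).congr_deriv fun t ht => by
    rw [hy t (Ioo_subset_Icc_self ht)]

end Existence

/-! ### Matrix calculus -/

section MatrixCalculus

variable {l m n : Type*} [Fintype l] [DecidableEq l] [Fintype m] [DecidableEq m] [Fintype n]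
  [DecidableEq n]

theorem isBoundedBilinearMap_matrix_mul :
    IsBoundedBilinearMap ℝ (fun p : Matrix l m ℝ × Matrix m n ℝ => p.1 * p.2) where
  add_left _ _ _ := Matrix.add_mul _ _ _
  smul_left _ _ _ := Matrix.smul_mul _ _ _
  add_right _ _ _ := Matrix.mul_add _ _ _
  smul_right _ _ _ := Matrix.mul_smul _ _ _
  bound := ⟨1, one_pos, fun A B => by simpa using Matrix.l2_opNorm_mul A B⟩

theorem PDeriv.matMul {a b : ℝ} {A A' : ℝ → Matrix l m ℝ} {B B' : ℝ → Matrix m n ℝ}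
    (hA : PDeriv a b A A') (hB : PDeriv a b B B') :
    PDeriv a b (fun t => A t * B t) (fun t => A t * B' t + A' t * B t) :=
  PDeriv.bilin isBoundedBilinearMap_matrix_mul hA hB

theorem norm_transpose (A : Matrix m n ℝ) : ‖Aᵀ‖ = ‖A‖ := by
  rw [← Matrix.l2_opNorm_conjTranspose A, Matrix.conjTranspose_eq_transpose_of_trivial]

/-- Transposition as a continuous linear map. -/
def transposeL : Matrix m n ℝ →L[ℝ] Matrix n m ℝ :=
  LinearMap.mkContinuous
    { toFun := Matrix.transpose
      map_add' := fun _ _ => Matrix.transpose_add _ _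
      map_smul' := fun _ _ => Matrix.transpose_smul _ _ } 1
    fun A => by simpa using (norm_transpose A).le

theorem PDeriv.transpose {a b : ℝ} {A A' : ℝ → Matrix m n ℝ} (hA : PDeriv a b A A') :
    PDeriv a b (fun t => (A t)ᵀ) (fun t => (A' t)ᵀ) := hA.clm transposeL

theorem PDeriv.const {E : Type*} [NormedAddCommGroup E] [NormedSpace ℝ E] {a b : ℝ} (x : E) :
    PDeriv a b (fun _ => x) (fun _ => 0) := .of_hasDerivAt fun t => hasDerivAt_const t x

theorem PDeriv.matInv {a b : ℝ} {M M' : ℝ → Matrix n n ℝ} (hM : PDeriv a b M M')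
    (hu : ∀ t ∈ Icc a b, IsUnit (M t)) :
    PDeriv a b (fun t => (M t)⁻¹) (fun t => -((M t)⁻¹ * M' t * (M t)⁻¹)) := by
  have hder : ∀ t ∈ Icc a b, HasFDerivAt (fun X : Matrix n n ℝ => X⁻¹)
      (-(ContinuousLinearMap.mulLeftRight ℝ (Matrix n n ℝ)) (M t)⁻¹ (M t)⁻¹) (M t) := by
    intro t ht
    obtain ⟨u, hu⟩ := hu t ht
    have h := hasFDerivAt_ringInverse (𝕜 := ℝ) u
    have e : (fun X : Matrix n n ℝ => X⁻¹) = Ring.inverse := by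
      funext X; exact Matrix.nonsing_inv_eq_ringInverse X
    rw [e, ← hu, Matrix.nonsing_inv_eq_ringInverse, Ring.inverse_unit]
    exact h
  refine ⟨fun t ht => ((hder t ht).continuousAt.comp_continuousWithinAt (hM.1 t ht)), ?_⟩
  filter_upwards [hM.2] with t ht htab
  have := (hder t (Ioo_subset_Icc_self htab)).comp_hasDerivAt t (ht htab)
  simpa [Function.comp_def] using this

theorem norm_toLp_sq (x : n → ℝ) : ‖WithLp.toLp 2 x‖ ^ 2 = x ⬝ᵥ x := by
  rw [EuclideanSpace.real_norm_sq_eq]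
  simp [dotProduct, sq]

theorem norm_toLp_eq_one {x : n → ℝ} (hx : x ⬝ᵥ x = 1) : ‖WithLp.toLp 2 x‖ = 1 :=
  (pow_eq_one_iff_of_nonneg (norm_nonneg _) two_ne_zero).1 ((norm_toLp_sq x).trans hx)

theorem abs_dotProduct_le (x y : n → ℝ) :
    |x ⬝ᵥ y| ≤ ‖WithLp.toLp 2 x‖ * ‖WithLp.toLp 2 y‖ := by
  have := abs_real_inner_le_norm (WithLp.toLp 2 y) (WithLp.toLp 2 x)
  rw [EuclideanSpace.inner_eq_star_dotProduct] at this
  simpa [mul_comm] using this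

theorem norm_toLp_mulVec_le (M : Matrix m n ℝ) (x : n → ℝ) :
    ‖WithLp.toLp 2 (M *ᵥ x)‖ ≤ ‖M‖ * ‖WithLp.toLp 2 x‖ :=
  Matrix.l2_opNorm_mulVec M (WithLp.toLp 2 x)

theorem abs_dotProduct_mulVec_le (M : Matrix m n ℝ) (x : m → ℝ) (y : n → ℝ) :
    |x ⬝ᵥ M *ᵥ y| ≤ ‖M‖ * ‖WithLp.toLp 2 x‖ * ‖WithLp.toLp 2 y‖ := by
  refine (abs_dotProduct_le _ _).trans ?_
  calc _ ≤ ‖WithLp.toLp 2 x‖ * (‖M‖ * ‖WithLp.toLp 2 y‖) := by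
        gcongr; exact norm_toLp_mulVec_le M y
    _ = _ := by ring

theorem abs_quad_le (M : Matrix n n ℝ) (x : n → ℝ) : |x ⬝ᵥ M *ᵥ x| ≤ ‖M‖ * (x ⬝ᵥ x) := by
  refine (abs_dotProduct_mulVec_le M x x).trans_eq ?_
  rw [← norm_toLp_sq]; ring

theorem dotProduct_transpose_mulVec (M : Matrix m n ℝ) (x : n → ℝ) (y : m → ℝ) :
    x ⬝ᵥ Mᵀ *ᵥ y = (M *ᵥ x) ⬝ᵥ y := by
  rw [Matrix.dotProduct_mulVec, Matrix.vecMul_transpose]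

theorem norm_le_of_entries_le : ∃ κ : ℝ, 0 ≤ κ ∧ ∀ (M : Matrix m n ℝ) (c : ℝ),
    (∀ i j, |M i j| ≤ c) → ‖M‖ ≤ κ * c := by
  refine ⟨∑ i : m, ∑ j : n, ‖Matrix.single i j (1 : ℝ)‖,
    Finset.sum_nonneg fun i _ => Finset.sum_nonneg fun j _ => norm_nonneg _, fun M c h => ?_⟩
  conv_lhs => rw [Matrix.matrix_eq_sum_single M]
  rw [Finset.sum_mul]
  refine (norm_sum_le _ _).trans (Finset.sum_le_sum fun i _ => ?_)
  rw [Finset.sum_mul]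
  refine (norm_sum_le _ _).trans (Finset.sum_le_sum fun j _ => ?_)
  have : Matrix.single i j (M i j) = M i j • Matrix.single i j (1 : ℝ) := by
    rw [Matrix.smul_single, smul_eq_mul, mul_one]
  rw [this, norm_smul, mul_comm, Real.norm_eq_abs]
  exact mul_le_mul_of_nonneg_left (h i j) (norm_nonneg _)

theorem continuous_quad : Continuous fun q : Matrix n n ℝ × (n → ℝ) => q.2 ⬝ᵥ q.1 *ᵥ q.2 :=
  continuous_snd.dotProduct (continuous_fst.matrix_mulVec continuous_snd)

/-- The quadratic form of a matrix at a vector, as a continuous linear function of the matrix. -/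
def quadL (x : m → ℝ) (y : n → ℝ) : Matrix m n ℝ →L[ℝ] ℝ :=
  LinearMap.mkContinuous
    { toFun := fun M => x ⬝ᵥ M *ᵥ y
      map_add' := fun A B => by rw [Matrix.add_mulVec, dotProduct_add]
      map_smul' := fun c A => by rw [Matrix.smul_mulVec, dotProduct_smul]; rfl }
    (‖WithLp.toLp 2 x‖ * ‖WithLp.toLp 2 y‖)
    fun M => (abs_dotProduct_mulVec_le M x y).trans_eq (by ring)

theorem quadL_apply (x : m → ℝ) (y : n → ℝ) (M : Matrix m n ℝ) : quadL x y M = x ⬝ᵥ M *ᵥ y := rfl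

theorem nonneg_of_nonneg_of_unit {q : (n → ℝ) → ℝ} (hq : ∀ (c : ℝ) x, q (c • x) = c ^ 2 * q x)
    (h : ∀ x, x ⬝ᵥ x = 1 → 0 ≤ q x) (x : n → ℝ) : 0 ≤ q x := by
  rcases eq_or_ne x 0 with rfl | hx
  · have := hq 0 0; simp at this; exact this.ge
  · have hpos : 0 < x ⬝ᵥ x :=
      lt_of_le_of_ne (by rw [← norm_toLp_sq]; positivity) fun h0 =>
        hx (dotProduct_self_eq_zero.1 h0.symm)
    have h1 := h ((√(x ⬝ᵥ x))⁻¹ • x) (by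
      rw [smul_dotProduct, dotProduct_smul, smul_eq_mul, smul_eq_mul, ← mul_assoc, ← mul_inv,
        Real.mul_self_sqrt hpos.le, inv_mul_cancel₀ hpos.ne'])
    rw [hq] at h1
    have h2 : 0 < (√(x ⬝ᵥ x))⁻¹ ^ 2 := by positivity
    exact nonneg_of_mul_nonneg_right h1 h2

/-- A symmetric solution of a differential Lyapunov inequality stays positive semidefinite. -/
theorem lyapunov_nonneg {R F N : ℝ → Matrix n n ℝ} {T c : ℝ} (hc : 0 ≤ c)
    (hR : PDeriv 0 T R (fun t => F t * R t + R t * (F t)ᵀ + N t))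
    (hsym : ∀ t ∈ Icc 0 T, (R t)ᵀ = R t) (hF : ∀ t ∈ Ioo 0 T, ‖F t‖ ≤ c)
    (hN : ∀ t ∈ Ioo 0 T, ∀ x, 0 ≤ x ⬝ᵥ N t *ᵥ x) (h0 : ∀ x, 0 ≤ x ⬝ᵥ R 0 *ᵥ x) :
    ∀ t ∈ Icc 0 T, ∀ x, 0 ≤ x ⬝ᵥ R t *ᵥ x := by
  -- The perturbation makes the form strictly positive at time zero, and its growth rate `2 * c + 1`
  -- exceeds the loss `2 * c` caused by `F`. Letting `δ` tend to zero recovers `R`.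
  let Rd : ℝ → ℝ → Matrix n n ℝ := fun δ t => R t + (δ * Real.exp ((2 * c + 1) * t)) • 1
  have hquad : ∀ δ t x, x ⬝ᵥ Rd δ t *ᵥ x =
      x ⬝ᵥ R t *ᵥ x + δ * Real.exp ((2 * c + 1) * t) * (x ⬝ᵥ x) := fun δ t x => by
    simp [Rd, Matrix.add_mulVec, dotProduct_add, Matrix.smul_mulVec, dotProduct_smul]
  suffices h : ∀ δ > 0, ∀ t ∈ Icc 0 T, ∀ x, x ⬝ᵥ x = 1 → 0 < x ⬝ᵥ Rd δ t *ᵥ x by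
    intro t ht
    refine nonneg_of_nonneg_of_unit (fun c x => ?_) fun x hx => ?_
    · rw [Matrix.mulVec_smul, smul_dotProduct, dotProduct_smul, smul_eq_mul, smul_eq_mul]; ring
    · by_contra hn
      have he := Real.exp_pos ((2 * c + 1) * t)
      have := h (-(x ⬝ᵥ R t *ᵥ x) / Real.exp ((2 * c + 1) * t)) (div_pos (by linarith) he) t ht x hx
      rw [hquad, hx, div_mul_cancel₀ _ he.ne'] at this
      linarith
  intro δ hδ
  have hRdc : ContinuousOn (Rd δ) (Icc 0 T) :=
    hR.1.add (Continuous.continuousOn (by fun_prop))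
  let K : Set (ℝ × (n → ℝ)) := (Icc 0 T ×ˢ {x | x ⬝ᵥ x = 1}) ∩
    (fun q => q.2 ⬝ᵥ Rd δ q.1 *ᵥ q.2) ⁻¹' Iic 0
  have hsph : IsCompact {x : n → ℝ | x ⬝ᵥ x = 1} := by
    have : {x : n → ℝ | x ⬝ᵥ x = 1} =
        WithLp.ofLp '' Metric.sphere (0 : EuclideanSpace ℝ n) 1 := by
      ext x
      simp only [mem_ofPred_eq, mem_image, mem_sphere_iff_norm, sub_zero]
      constructor
      · intro hx
        exact ⟨WithLp.toLp 2 x, norm_toLp_eq_one hx, rfl⟩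
      · rintro ⟨y, hy, rfl⟩
        rw [← norm_toLp_sq]
        simp [hy]
    rw [this]
    exact (isCompact_sphere _ _).image (PiLp.continuous_ofLp 2 _)
  have hKc : IsCompact K := by
    refine (isCompact_Icc.prod hsph).of_isClosed_subset ?_ inter_subset_left
    refine ContinuousOn.preimage_isClosed_of_isClosed ?_ (isCompact_Icc.prod hsph).isClosed
      isClosed_Iic
    exact continuous_quad.comp_continuousOn
      ((hRdc.comp continuousOn_fst fun q hq => hq.1).prodMk continuousOn_snd)
  by_contra hcon
  push Not at hcon
  obtain ⟨t₁, ht₁, x₁, hx₁, hle₁⟩ := hcon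
  -- The pair consists of the first time `s` at which positivity fails and a unit vector `x` that
  -- witnesses it.
  obtain ⟨⟨⟨s, x⟩, ⟨⟨hs, hx⟩, hsx⟩, hse⟩, hmin⟩ :=
    (hKc.image continuous_fst).isLeast_sInf ⟨t₁, ⟨(t₁, x₁), ⟨⟨ht₁, hx₁⟩, hle₁⟩, rfl⟩⟩
  rw [← hse] at hmin
  simp only [mem_preimage, mem_Iic] at hsx hs hx
  have hpos : ∀ t, 0 ≤ t → t < s → ∀ y, y ⬝ᵥ y = 1 → 0 < y ⬝ᵥ Rd δ t *ᵥ y := by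
    intro t h0t hts y hy
    by_contra hn
    exact hts.not_ge (hmin ⟨(t, y), ⟨⟨⟨h0t, hts.le.trans hs.2⟩, hy⟩, not_lt.1 hn⟩, rfl⟩)
  have hs0 : 0 < s := by
    refine lt_of_le_of_ne hs.1 fun h => ?_
    have h2 := h0 x
    rw [← h, hquad, hx] at hsx
    simp at hsx
    linarith
  have hcs : Tendsto (Rd δ) (𝓝[<] s) (𝓝 (Rd δ s)) := by
    have h1 : Ico 0 s ∈ 𝓝[<] s := Ico_mem_nhdsLT hs0
    refine Tendsto.mono_left (hRdc s hs) ?_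
    rw [← nhdsWithin_Ico_eq_nhdsLT hs0]
    exact nhdsWithin_mono _ fun t ht => ⟨ht.1, ht.2.le.trans hs.2⟩
  have hev : ∀ᶠ t in 𝓝[<] s, t ∈ Ico 0 s := Ico_mem_nhdsLT hs0
  have hsymd : ∀ t ∈ Icc 0 T, (Rd δ t)ᵀ = Rd δ t := fun t ht => by
    simp [Rd, hsym t ht]
  have hpsd : (Rd δ s).PosSemidef := by
    refine .of_dotProduct_mulVec_nonneg ?_ fun y => ?_
    · rw [Matrix.IsHermitian, Matrix.conjTranspose_eq_transpose_of_trivial, hsymd s hs]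
    · rw [star_trivial]
      refine nonneg_of_nonneg_of_unit (q := fun y => y ⬝ᵥ Rd δ s *ᵥ y) (fun c x => ?_) (fun y hy => ?_) y
      · rw [Matrix.mulVec_smul, smul_dotProduct, dotProduct_smul, smul_eq_mul, smul_eq_mul]; ring
      · exact ge_of_tendsto (((quadL y y).continuous.tendsto _).comp hcs)
          (hev.mono fun t ht => (hpos t ht.1 ht.2 y hy).le)
  -- At time `s` the matrix is still positive semidefinite, so a vector with nonpositive form lies
  -- in its kernel. The terms with `F` acting on `Rd δ t *ᵥ x` are therefore small just before `s`.
  have hker : Rd δ s *ᵥ x = 0 := by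
    rw [← hpsd.dotProduct_mulVec_zero_iff, star_trivial]
    refine le_antisymm hsx ?_
    have := (Matrix.posSemidef_iff_dotProduct_mulVec.1 hpsd).2 x
    rwa [star_trivial] at this
  have hsmall : ∀ᶠ t in 𝓝[<] s, 2 * c * ‖WithLp.toLp 2 (Rd δ t *ᵥ x)‖ ≤ δ := by
    have h1 : Continuous fun M : Matrix n n ℝ => 2 * c * ‖WithLp.toLp 2 (M *ᵥ x)‖ := by
      have : Continuous fun M : Matrix n n ℝ => M *ᵥ x :=
        continuous_id.matrix_mulVec continuous_const
      exact continuous_const.mul ((PiLp.continuous_toLp 2 _).comp this).norm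
    have h2 := (h1.tendsto (Rd δ s)).comp hcs
    refine h2.eventually (Iic_mem_nhds ?_)
    rw [hker]; simpa using hδ
  obtain ⟨a, ha, hsub⟩ := (mem_nhdsLT_iff_exists_Ioo_subset' hs0).1 (hev.and hsmall)
  obtain ⟨b, hb⟩ := exists_between (show max a 0 < s from max_lt ha hs0)
  have hab : ∀ t ∈ Ioo b s, 0 < t ∧ 2 * c * ‖WithLp.toLp 2 (Rd δ t *ᵥ x)‖ ≤ δ := fun t ht =>
    ⟨((le_max_right _ _).trans_lt hb.1).trans ht.1,
      (hsub ⟨((le_max_left _ _).trans_lt hb.1).trans ht.1, ht.2⟩).2⟩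
  have hb0 : 0 ≤ b := (le_max_right _ _).trans hb.1.le
  have hexp : PDeriv b s (fun t => δ * Real.exp ((2 * c + 1) * t))
      (fun t => δ * ((2 * c + 1) * Real.exp ((2 * c + 1) * t))) := .of_hasDerivAt fun t => by
    have := (((hasDerivAt_id t).const_mul (2 * c + 1)).exp).const_mul δ
    simpa [mul_comm, mul_left_comm] using this
  have hg := ((hR.restrict hb0 hs.2).clm (quadL x x)).add hexp
  -- The form at the fixed vector `x` is nondecreasing just before `s`, which contradicts its
  -- passage from a positive to a nonpositive value. Monotonicity is used instead of a derivative at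
  -- `s`, because `s` may be an exceptional time.
  have hge := hg.le_of_nonneg hb.2.le fun t ht => by
    obtain ⟨ht0, hts⟩ := hab t ht
    have htT : t ∈ Ioo 0 T := ⟨ht0, ht.2.trans_le hs.2⟩
    have hN' := hN t htT x
    have he : 1 ≤ Real.exp ((2 * c + 1) * t) := Real.one_le_exp (by positivity)
    have hRx : R t *ᵥ x = Rd δ t *ᵥ x - (δ * Real.exp ((2 * c + 1) * t)) • x := by
      simp [Rd, Matrix.add_mulVec, Matrix.smul_mulVec]
    have e1 : x ⬝ᵥ (F t * R t) *ᵥ x = x ⬝ᵥ F t *ᵥ (R t *ᵥ x) := by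
      rw [Matrix.mulVec_mulVec]
    have e2 : x ⬝ᵥ (R t * (F t)ᵀ) *ᵥ x = x ⬝ᵥ F t *ᵥ (R t *ᵥ x) := by
      conv_lhs => rw [← hsym t (Ioo_subset_Icc_self htT)]
      rw [← Matrix.transpose_mul, dotProduct_transpose_mulVec, dotProduct_comm,
        Matrix.mulVec_mulVec]
    have e3 : quadL x x (F t * R t + R t * (F t)ᵀ + N t) =
        2 * (x ⬝ᵥ F t *ᵥ (Rd δ t *ᵥ x)) - 2 * (δ * Real.exp ((2 * c + 1) * t)) * (x ⬝ᵥ F t *ᵥ x)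
          + x ⬝ᵥ N t *ᵥ x := by
      simp only [map_add, quadL_apply]
      rw [e1, e2, hRx, Matrix.mulVec_sub, Matrix.mulVec_smul, dotProduct_sub, dotProduct_smul,
        smul_eq_mul]
      ring
    have hnx : ‖WithLp.toLp 2 x‖ = 1 := norm_toLp_eq_one hx
    have b1 := abs_dotProduct_mulVec_le (F t) x (Rd δ t *ᵥ x)
    have b2 := abs_quad_le (F t) x
    rw [hx] at b2
    rw [hnx, mul_one] at b1
    have hFt := hF t htT
    have b3 : ‖F t‖ * ‖WithLp.toLp 2 (Rd δ t *ᵥ x)‖ ≤ c * ‖WithLp.toLp 2 (Rd δ t *ᵥ x)‖ :=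
      mul_le_mul_of_nonneg_right hFt (norm_nonneg _)
    rw [e3]
    have b4 := (abs_le.1 b1).1
    have b5 := (abs_le.1 b2).2
    have hde : 0 < δ * Real.exp ((2 * c + 1) * t) := by positivity
    have b6 : δ * Real.exp ((2 * c + 1) * t) * (x ⬝ᵥ F t *ᵥ x) ≤
        δ * Real.exp ((2 * c + 1) * t) * c :=
      mul_le_mul_of_nonneg_left (by linarith) hde.le
    have b7 : δ ≤ δ * Real.exp ((2 * c + 1) * t) := le_mul_of_one_le_right hδ.le he
    linarith
  have hbpos := hpos b hb0 hb.2 x hx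
  rw [hquad, hx, mul_one] at hbpos hsx
  simp only [quadL_apply] at hge
  linarith

end MatrixCalculus

/-! ### Uniform observability of the canonical form -/

section HighGain

/-- A quadratic form on sequences supported in `[0, N)` that decreases along the shift, up to the
contribution of the first entry. -/
theorem exists_shift_form (N : ℕ) : ∃ (B : LinearMap.BilinForm ℝ (ℕ → ℝ)) (b c : ℝ), 0 < b ∧ 0 ≤ c ∧
    (∀ z w, B z w = B w z) ∧ ∀ z : ℕ → ℝ, (∀ i, N ≤ i → z i = 0) →
      b * ∑ i ∈ Finset.range N, z i ^ 2 ≤ B z z ∧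
      2 * B z (fun i => z (i + 1)) ≤ c * z 0 ^ 2 - ∑ i ∈ Finset.range N, z i ^ 2 := by
  induction N with
  | zero =>
    exact ⟨0, 1, 0, one_pos, le_rfl, by simp, fun z hz => by simp⟩
  | succ N ih =>
    obtain ⟨B, b, c, hb, hc, hsymm, h⟩ := ih
    -- The first summand compensates the cross term `c * z 0 * z 1` by completing the square, and
    -- the second leaves `b / 2` times the square of the new entry.
    obtain ⟨D, hD⟩ : ∃ D, D = c ^ 2 / (2 * b) + b / 2 := ⟨_, rfl⟩
    let sh : (ℕ → ℝ) →ₗ[ℝ] (ℕ → ℝ) := LinearMap.funLeft ℝ ℝ Nat.succ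
    let p : ℕ → (ℕ → ℝ) →ₗ[ℝ] ℝ := fun i => LinearMap.proj i
    -- The form of the shifted sequence produces the bad term `c * z 1 ^ 2`. Along the shift, the
    -- cross term `-c * z 0 * z 1` contributes `-c * z 1 ^ 2` and cancels it. The factor `2` leaves
    -- room to absorb the remaining products.
    let Q : LinearMap.BilinForm ℝ (ℕ → ℝ) := LinearMap.mk₂ ℝ
      (fun z w => 2 * (B (sh z) (sh w) + D * (z 0 * w 0) - c / 2 * (z 0 * w 1 + z 1 * w 0)))
      (fun z z' w => by simp; ring) (fun a z w => by simp; ring)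
      (fun z w w' => by simp; ring) (fun a z w => by simp; ring)
    have hQ : ∀ z w, Q z w =
      2 * (B (sh z) (sh w) + D * (z 0 * w 0) - c / 2 * (z 0 * w 1 + z 1 * w 0)) := fun z w => rfl
    -- The constants `4 * D ^ 2` and `c ^ 2` come from the products with `z 1` and `z 2`; the final
    -- `1` pays for `z 0 ^ 2` in the sum.
    refine ⟨Q, b, 2 * (4 * D ^ 2 + c ^ 2) + 1, hb, by positivity, fun z w => ?_, fun z hz => ?_⟩
    · rw [hQ, hQ, hsymm]; ring
    · obtain ⟨h1, h2⟩ := h (sh z) fun i hi => hz _ (Nat.succ_le_succ hi)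
      have hsh : ∀ i, sh z i = z (i + 1) := fun i => rfl
      have hsh' : sh (fun i => z (i + 1)) = fun i => sh z (i + 1) := rfl
      simp only [hQ, hsh']
      simp only [hsh] at h1 h2 ⊢
      rw [Finset.sum_range_succ']
      obtain ⟨W, hW⟩ : ∃ W, W = ∑ i ∈ Finset.range N, z (i + 1) ^ 2 := ⟨_, rfl⟩
      rw [← hW] at h1 h2 ⊢
      have hWn : ∀ i, z (i + 1) ^ 2 ≤ W := fun i => by
        rcases lt_or_ge i N with hi | hi
        · rw [hW]
          exact Finset.single_le_sum (f := fun i => z (i + 1) ^ 2) (fun i _ => sq_nonneg _)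
            (Finset.mem_range.2 hi)
        · rw [hz _ (Nat.succ_le_succ hi), hW]
          simpa using Finset.sum_nonneg fun i _ => sq_nonneg (z (i + 1))
      have w1 := hWn 0
      have w2 := hWn 1
      simp only [zero_add] at w1 h2 ⊢
      constructor
      · have e : c * (z 0 * z 1) ≤ b / 2 * z 1 ^ 2 + c ^ 2 / (2 * b) * z 0 ^ 2 := by
          have : b / 2 * z 1 ^ 2 + c ^ 2 / (2 * b) * z 0 ^ 2 - c * (z 0 * z 1) =
            (b * z 1 - c * z 0) ^ 2 / (2 * b) := by field_simp; ring
          have h3 : 0 ≤ (b * z 1 - c * z 0) ^ 2 / (2 * b) := by positivity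
          linarith
        have e2 : D * (z 0 * z 0) = c ^ 2 / (2 * b) * z 0 ^ 2 + b / 2 * z 0 ^ 2 := by rw [hD]; ring
        have e3 : b / 2 * z 1 ^ 2 ≤ b / 2 * W := mul_le_mul_of_nonneg_left w1 (by positivity)
        linarith
      · have e1 : 2 * (D * (z 0 * z 1)) ≤ z 1 ^ 2 / 4 + 4 * D ^ 2 * z 0 ^ 2 := by
          nlinarith [sq_nonneg (z 1 / 2 - 2 * D * z 0)]
        have e2 : -(c * (z 0 * z 2)) ≤ z 2 ^ 2 / 4 + c ^ 2 * z 0 ^ 2 := by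
          nlinarith [sq_nonneg (z 2 / 2 + c * z 0)]
        norm_num at h2 w2 ⊢
        linarith

variable {p : ℕ} (l : Fin p → ℕ)

/-- The coordinates of the `a`-th block, extended by zero to a sequence. -/
def blockSeq (a : Fin p) : (StateIndex l → ℝ) →ₗ[ℝ] (ℕ → ℝ) where
  toFun z i := if h : i < l a then z ⟨a, ⟨i, h⟩⟩ else 0
  map_add' z w := by ext i; by_cases h : i < l a <;> simp [h]
  map_smul' c z := by ext i; by_cases h : i < l a <;> simp [h]

theorem blockSeq_apply (a : Fin p) (z : StateIndex l → ℝ) (i : ℕ) :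
    blockSeq l a z i = if h : i < l a then z ⟨a, ⟨i, h⟩⟩ else 0 := rfl

theorem blockSeq_fin (z : StateIndex l → ℝ) (r : StateIndex l) :
    blockSeq l r.1 z (r.2 : ℕ) = z r := by
  simp [blockSeq_apply]

theorem sum_ite_block (z : StateIndex l → ℝ) (a : Fin p) (i : ℕ) :
    ∑ s : StateIndex l, (if a = s.1 ∧ (s.2 : ℕ) = i then 1 else 0) * z s = blockSeq l a z i := by
  rw [Fintype.sum_sigma, Finset.sum_eq_single a]
  · rw [blockSeq_apply]
    split_ifs with h
    · rw [Finset.sum_eq_single ⟨i, h⟩]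
      · simp
      · intro j _ hj
        have : (j : ℕ) ≠ i := fun h' => hj (Fin.ext h')
        simp [this]
      · simp
    · refine Finset.sum_eq_zero fun j _ => ?_
      have : (j : ℕ) ≠ i := fun h' => h (h' ▸ j.2)
      simp [this]
  · intro a' _ ha'
    exact Finset.sum_eq_zero fun j _ => by simp [ha'.symm]
  · simp

theorem blockSeq_Abar (z : StateIndex l → ℝ) (a : Fin p) :
    blockSeq l a (Abar l *ᵥ z) = fun i => blockSeq l a z (i + 1) := by
  ext i
  rw [blockSeq_apply]
  split_ifs with h
  · rw [Matrix.mulVec, dotProduct, ← sum_ite_block]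
    rfl
  · rw [blockSeq_apply, dif_neg (by omega)]

theorem Cbar_mulVec (z : StateIndex l → ℝ) (a : Fin p) :
    (Cbar l *ᵥ z) a = blockSeq l a z 0 := by
  rw [Matrix.mulVec, dotProduct, ← sum_ite_block]
  rfl

theorem blockSeq_eq_zero (z : StateIndex l → ℝ) (a : Fin p) (i : ℕ) (hi : ∑ a, l a ≤ i) :
    blockSeq l a z i = 0 := by
  have := Finset.single_le_sum (f := l) (fun i _ => Nat.zero_le _) (Finset.mem_univ a)
  rw [blockSeq_apply, dif_neg (by omega)]

theorem sum_blockSeq_sq (z : StateIndex l → ℝ) :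
    ∑ a, ∑ i ∈ Finset.range (∑ a, l a), blockSeq l a z i ^ 2 = z ⬝ᵥ z := by
  rw [dotProduct, Fintype.sum_sigma]
  refine Finset.sum_congr rfl fun a _ => ?_
  have hle := Finset.single_le_sum (f := l) (fun i _ => Nat.zero_le _) (Finset.mem_univ a)
  rw [← Finset.sum_subset (Finset.range_mono hle), Finset.sum_range]
  · refine Finset.sum_congr rfl fun i _ => ?_
    rw [blockSeq_apply, dif_pos i.2, sq]
  · intro i _ hi
    rw [blockSeq_apply, dif_neg (by simpa using hi)]; simp

/-- `Ā` acts on every block as the shift. Padding the blocks by zeros to the common length `∑ a, l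
a` lets one shift form serve all of them, and the forms are added. -/
theorem exists_form_Abar : ∃ (S : Matrix (StateIndex l) (StateIndex l) ℝ) (b c : ℝ), 0 < b ∧ 0 ≤ c ∧
    Sᵀ = S ∧ (∀ z, b * (z ⬝ᵥ z) ≤ z ⬝ᵥ S *ᵥ z) ∧
    ∀ z, 2 * (z ⬝ᵥ S *ᵥ (Abar l *ᵥ z)) ≤ c * ((Cbar l *ᵥ z) ⬝ᵥ (Cbar l *ᵥ z)) - z ⬝ᵥ z := by
  obtain ⟨B, b, c, hb, hc, hsymm, h⟩ := exists_shift_form (∑ a, l a)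
  let T : LinearMap.BilinForm ℝ (StateIndex l → ℝ) :=
    ∑ a, B.compl₁₂ (blockSeq l a) (blockSeq l a)
  have hT : ∀ z w, T z w = ∑ a, B (blockSeq l a z) (blockSeq l a w) := fun z w => by
    simp [T]
  have hS : ∀ z w, z ⬝ᵥ (LinearMap.toMatrix₂' ℝ T) *ᵥ w = T z w := fun z w => by
    rw [← Matrix.toLinearMap₂'_apply', Matrix.toLinearMap₂'_toMatrix']
  refine ⟨LinearMap.toMatrix₂' ℝ T, b, c, hb, hc, ?_, fun z => ?_, fun z => ?_⟩
  · ext i j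
    rw [Matrix.transpose_apply, LinearMap.toMatrix₂'_apply, LinearMap.toMatrix₂'_apply, hT, hT]
    exact Finset.sum_congr rfl fun a _ => hsymm _ _
  · rw [hS, hT, ← sum_blockSeq_sq, Finset.mul_sum]
    exact Finset.sum_le_sum fun a _ => (h _ (blockSeq_eq_zero l z a)).1
  · rw [hS, hT, ← sum_blockSeq_sq, Finset.mul_sum, dotProduct, Finset.mul_sum,
      ← Finset.sum_sub_distrib]
    refine Finset.sum_le_sum fun a _ => ?_
    rw [blockSeq_Abar, Cbar_mulVec, ← sq]
    exact (h _ (blockSeq_eq_zero l z a)).2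

/-- A quadratic form that decreases, up to the contribution of the output, along every system
`ż = (Ā + F) z` with `F` bounded and lower triangular with respect to the depth of the coordinates. -/
theorem exists_observability_form (Lam : ℝ) :
    ∃ (S : Matrix (StateIndex l) (StateIndex l) ℝ) (b c γ : ℝ), 0 < b ∧ 0 ≤ c ∧ 0 < γ ∧
    Sᵀ = S ∧ (∀ z, b * (z ⬝ᵥ z) ≤ z ⬝ᵥ S *ᵥ z) ∧
    ∀ F : Matrix (StateIndex l) (StateIndex l) ℝ, (∀ r s, |F r s| ≤ Lam) →
      (∀ r s, (r.2 : ℕ) < (s.2 : ℕ) → F r s = 0) → ∀ z,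
      2 * (z ⬝ᵥ S *ᵥ ((Abar l + F) *ᵥ z)) ≤
        c * ((Cbar l *ᵥ z) ⬝ᵥ (Cbar l *ᵥ z)) - γ * (z ⬝ᵥ z) := by
  obtain ⟨S₀, b, c, hb, hc, hsymm, hpos, hder⟩ := exists_form_Abar l
  obtain ⟨κ, hκ, hnorm⟩ := norm_le_of_entries_le (m := StateIndex l) (n := StateIndex l)
  -- The scaled shift dissipates `θ` times the squared norm, and the perturbation costs at most `2 *
  -- ‖S₀‖ * κ * |Lam|` of it, so exactly one unit remains.
  obtain ⟨θ, hθ⟩ : ∃ θ, θ = 2 * (‖S₀‖ * (κ * |Lam|)) + 1 := ⟨_, rfl⟩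
  have hθ1 : 1 ≤ θ := by
    have : 0 ≤ 2 * (‖S₀‖ * (κ * |Lam|)) := by positivity
    linarith
  have hθ0 : 0 < θ := by linarith
  -- High-gain scaling by depth. It fixes the measured coordinates, multiplies `Ā` by `θ`, and does
  -- not enlarge the entries of `F`, because `d r ≤ d s` wherever `F r s` may be nonzero.
  let d : StateIndex l → ℝ := fun r => θ⁻¹ ^ (r.2 : ℕ)
  have hd0 : ∀ r, 0 < d r := fun r => by positivity
  have hti : θ⁻¹ ≤ 1 := inv_le_one_of_one_le₀ hθ1
  obtain ⟨ν, hν⟩ : ∃ ν, ν = (θ⁻¹ ^ (∑ a, l a)) ^ 2 := ⟨_, rfl⟩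
  have hν0 : 0 < ν := by rw [hν]; positivity
  have hdν : ∀ r, ν ≤ d r ^ 2 := fun r => by
    have hle := Finset.single_le_sum (f := l) (fun i _ => Nat.zero_le _) (Finset.mem_univ r.1)
    rw [hν]
    exact pow_le_pow_left₀ (by positivity)
      (pow_le_pow_of_le_one (by positivity) hti (r.2.2.le.trans hle)) 2
  let z' : (StateIndex l → ℝ) → StateIndex l → ℝ := fun z => Matrix.diagonal d *ᵥ z
  have hz' : ∀ z r, z' z r = d r * z r := fun z r => Matrix.mulVec_diagonal _ _ _
  have hzz : ∀ z, ν * (z ⬝ᵥ z) ≤ z' z ⬝ᵥ z' z := fun z => by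
    rw [dotProduct, dotProduct, Finset.mul_sum]
    refine Finset.sum_le_sum fun r _ => ?_
    rw [hz']
    nlinarith [mul_le_mul_of_nonneg_right (hdν r) (sq_nonneg (z r))]
  have hquad : ∀ z w, z ⬝ᵥ (Matrix.diagonal d * S₀ * Matrix.diagonal d) *ᵥ w =
      z' z ⬝ᵥ S₀ *ᵥ (z' w) := fun z w => by
    rw [← Matrix.mulVec_mulVec, ← Matrix.mulVec_mulVec]
    conv_lhs => rw [← Matrix.diagonal_transpose d]
    rw [dotProduct_transpose_mulVec, Matrix.diagonal_transpose]
  refine ⟨Matrix.diagonal d * S₀ * Matrix.diagonal d, b * ν, θ * c, ν, by positivity,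
    by positivity, hν0, ?_, fun z => ?_, fun F hF htri z => ?_⟩
  · rw [Matrix.transpose_mul, Matrix.transpose_mul, hsymm, Matrix.diagonal_transpose,
      Matrix.mul_assoc]
  · rw [hquad]
    calc b * ν * (z ⬝ᵥ z) = b * (ν * (z ⬝ᵥ z)) := by ring
      _ ≤ b * (z' z ⬝ᵥ z' z) := mul_le_mul_of_nonneg_left (hzz z) hb.le
      _ ≤ _ := hpos _
  · let F' : Matrix (StateIndex l) (StateIndex l) ℝ :=
      Matrix.of fun r s => d r * F r s * (d s)⁻¹
    have hF' : ∀ r s, |F' r s| ≤ |Lam| := fun r s => by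
      simp only [F', Matrix.of_apply]
      rcases lt_or_ge (r.2 : ℕ) (s.2 : ℕ) with h | h
      · rw [htri r s h]; simp
      · have h1 : d r ≤ d s := pow_le_pow_of_le_one (by positivity) hti h
        rw [abs_mul, abs_mul, abs_of_pos (hd0 r), abs_of_pos (inv_pos.2 (hd0 s))]
        have h2 : d r * (d s)⁻¹ ≤ 1 := by
          rw [← div_eq_mul_inv]; exact (div_le_one (hd0 s)).2 h1
        calc d r * |F r s| * (d s)⁻¹ = (d r * (d s)⁻¹) * |F r s| := by ring
          _ ≤ 1 * |Lam| := mul_le_mul h2 ((hF r s).trans (le_abs_self _)) (abs_nonneg _) zero_le_one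
          _ = _ := one_mul _
    have e1 : z' (Abar l *ᵥ z) = θ • (Abar l *ᵥ z' z) := by
      ext r
      have hA : ∀ w, (Abar l *ᵥ w) r = blockSeq l r.1 w ((r.2 : ℕ) + 1) := fun w => by
        rw [← blockSeq_fin l (Abar l *ᵥ w) r, blockSeq_Abar]
      rw [hz', Pi.smul_apply, smul_eq_mul, hA, hA, blockSeq_apply, blockSeq_apply]
      split_ifs with h
      · rw [hz']
        simp only [d, pow_succ]
        field_simp
      · simp
    have e2 : z' (F *ᵥ z) = F' *ᵥ z' z := by
      ext r
      rw [hz', Matrix.mulVec, Matrix.mulVec, dotProduct, dotProduct, Finset.mul_sum]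
      refine Finset.sum_congr rfl fun s _ => ?_
      rw [hz']
      simp only [F', Matrix.of_apply]
      have := (hd0 s).ne'
      field_simp
    have e3 : Cbar l *ᵥ z' z = Cbar l *ᵥ z := by
      ext a
      rw [Cbar_mulVec, Cbar_mulVec, blockSeq_apply, blockSeq_apply]
      split_ifs with h
      · rw [hz']; simp [d]
      · rfl
    have hb1 := abs_dotProduct_mulVec_le (S₀ * F') (z' z) (z' z)
    have hb2 : ‖S₀ * F'‖ ≤ ‖S₀‖ * (κ * |Lam|) :=
      (Matrix.l2_opNorm_mul _ _).trans
        (mul_le_mul_of_nonneg_left (hnorm F' _ hF') (norm_nonneg _))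
    have hb3 : z' z ⬝ᵥ S₀ *ᵥ (F' *ᵥ z' z) ≤ ‖S₀‖ * (κ * |Lam|) * (z' z ⬝ᵥ z' z) := by
      rw [Matrix.mulVec_mulVec, ← norm_toLp_sq]
      refine (le_abs_self _).trans (hb1.trans ?_)
      rw [mul_assoc, ← sq]
      exact mul_le_mul_of_nonneg_right hb2 (sq_nonneg _)
    have hd := mul_le_mul_of_nonneg_left (hder (z' z)) hθ0.le
    rw [e3] at hd
    rw [hquad, Matrix.add_mulVec]
    have e4 : z' (Abar l *ᵥ z + F *ᵥ z) = θ • (Abar l *ᵥ z' z) + F' *ᵥ z' z := by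
      rw [← e1, ← e2]; exact Matrix.mulVec_add _ _ _
    rw [e4, Matrix.mulVec_add, dotProduct_add, Matrix.mulVec_smul, dotProduct_smul, smul_eq_mul]
    have h5 := hzz z
    have h6 : θ * (z' z ⬝ᵥ z' z) =
        2 * (‖S₀‖ * (κ * |Lam|) * (z' z ⬝ᵥ z' z)) + z' z ⬝ᵥ z' z := by rw [hθ]; ring
    linarith

end HighGain

/-! ### Bounds along the observer trajectory -/

section Bounds

variable {ι κ : Type*} [Fintype ι] [DecidableEq ι] [Fintype κ] [DecidableEq κ] {k : ℕ}

theorem skewPart_transpose (A : Matrix ι ι ℝ) (Q : Matrix ι (Fin k) ℝ) :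
    (skewPart A Q)ᵀ = -skewPart A Q := by
  ext i j
  simp only [skewPart, Matrix.transpose_apply, Matrix.of_apply, Matrix.neg_apply]
  rcases lt_trichotomy i j with h | rfl | h
  · rw [if_pos h, if_neg h.not_gt, if_pos h, neg_neg]
  · simp
  · rw [if_neg h.not_gt, if_pos h, if_pos h]

theorem abs_entry_le_norm {m n : Type*} [Fintype m] [DecidableEq m] [Fintype n] [DecidableEq n]
    (M : Matrix m n ℝ) (i : m) (j : n) : |M i j| ≤ ‖M‖ := by
  have := abs_dotProduct_mulVec_le M (Pi.single i 1) (Pi.single j 1)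
  rw [norm_toLp_eq_one (by simp), norm_toLp_eq_one (by simp)] at this
  simpa using this

theorem norm_one_le {n : Type*} [Fintype n] [DecidableEq n] : ‖(1 : Matrix n n ℝ)‖ ≤ 1 := by
  -- The case `k = 0` is allowed, and then the identity matrix has norm `0`.
  rcases isEmpty_or_nonempty n with h | h
  · rw [Subsingleton.elim (1 : Matrix n n ℝ) 0, norm_zero]; exact zero_le_one
  · exact norm_one.le

theorem norm_le_one_of_orthonormal {m n : Type*} [Fintype m] [DecidableEq m] [Fintype n]
    [DecidableEq n] {Q : Matrix m n ℝ} (h : Qᵀ * Q = 1) : ‖Q‖ ≤ 1 := by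
  have h1 := Matrix.l2_opNorm_conjTranspose_mul_self Q
  rw [Matrix.conjTranspose_eq_transpose_of_trivial, h] at h1
  nlinarith [norm_one_le (n := n), norm_nonneg Q]

theorem exists_norm_skewPart_le (k : ℕ) : ∃ c : ℝ, 0 ≤ c ∧ ∀ (A : Matrix ι ι ℝ)
    (Q : Matrix ι (Fin k) ℝ), ‖skewPart A Q‖ ≤ c * ‖Qᵀ * A * Q‖ := by
  obtain ⟨c, hc, h⟩ := norm_le_of_entries_le (m := Fin k) (n := Fin k)
  refine ⟨c, hc, fun A Q => h _ _ fun i j => ?_⟩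
  simp only [skewPart, Matrix.of_apply]
  split_ifs
  · exact abs_entry_le_norm _ _ _
  · rw [abs_neg]; exact abs_entry_le_norm _ _ _
  · simp

theorem norm_sandwich_le (A : Matrix ι ι ℝ) (Q : Matrix ι (Fin k) ℝ) :
    ‖Qᵀ * A * Q‖ ≤ ‖Q‖ * ‖A‖ * ‖Q‖ := by
  refine (Matrix.l2_opNorm_mul _ _).trans ?_
  have := Matrix.l2_opNorm_mul Qᵀ A
  rw [norm_transpose] at this
  gcongr

theorem exists_norm_reducedB_le (k : ℕ) : ∃ c : ℝ, 0 ≤ c ∧ ∀ (A : Matrix ι ι ℝ)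
    (Q : Matrix ι (Fin k) ℝ), Qᵀ * Q = 1 → ‖reducedB A Q‖ ≤ c * ‖A‖ := by
  obtain ⟨c, hc, h⟩ := exists_norm_skewPart_le (ι := ι) k
  refine ⟨1 + c, by positivity, fun A Q hQ => ?_⟩
  have hQ1 := norm_le_one_of_orthonormal hQ
  have h1 : ‖Qᵀ * A * Q‖ ≤ ‖A‖ := (norm_sandwich_le A Q).trans (by
    calc ‖Q‖ * ‖A‖ * ‖Q‖ ≤ 1 * ‖A‖ * 1 := by gcongr
      _ = _ := by ring)
  refine (norm_sub_le _ _).trans ?_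
  have h2 := h A Q
  have h3 := mul_le_mul_of_nonneg_left h1 hc
  linarith

/-- Orthonormality of the columns is preserved. -/
theorem orthonormal_of_pDeriv {m n : Type*} [Fintype m] [DecidableEq m] [Fintype n] [DecidableEq n]
    {T K : ℝ} {Q Q' : ℝ → Matrix m n ℝ} {X : ℝ → Matrix n n ℝ} (hQ : PDeriv 0 T Q Q')
    (hX : ∀ t ∈ Ioo 0 T, ‖X t‖ ≤ K)
    (h : ∀ t ∈ Ioo 0 T, (Q t)ᵀ * Q' t + (Q' t)ᵀ * Q t =
      ((Q t)ᵀ * Q t - 1) * X t + (X t)ᵀ * ((Q t)ᵀ * Q t - 1))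
    (h0 : (Q 0)ᵀ * Q 0 = 1) : ∀ t ∈ Icc 0 T, (Q t)ᵀ * Q t = 1 := by
  have hE := ((hQ.transpose.matMul hQ).sub (PDeriv.const 1)).eq_zero (K := 2 * K) (fun t ht => by
    rw [sub_zero, h t ht]
    refine (norm_add_le _ _).trans ?_
    have h1 := Matrix.l2_opNorm_mul ((Q t)ᵀ * Q t - 1) (X t)
    have h2 := Matrix.l2_opNorm_mul (X t)ᵀ ((Q t)ᵀ * Q t - 1)
    rw [norm_transpose] at h2
    have h3 := mul_le_mul_of_nonneg_right (hX t ht) (norm_nonneg ((Q t)ᵀ * Q t - 1))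
    linarith) (by rw [h0, sub_self])
  exact fun t ht => sub_eq_zero.1 (hE t ht)

/-- The data of the observer on `[0, T]`, apart from the state estimate. -/
structure ReducedTrajectory (T α g₁ g₂ : ℝ) (A : ℝ → Matrix ι ι ℝ) (C : Matrix κ ι ℝ)
    (G P : ℝ → Matrix (Fin k) (Fin k) ℝ) (Q : ℝ → Matrix ι (Fin k) ℝ) : Prop where
  norm_le : ∀ t ∈ Ioo 0 T, ‖A t‖ ≤ α
  weight_symm : ∀ t ∈ Ioo 0 T, (G t)ᵀ = G t
  weight_ge : ∀ t ∈ Ioo 0 T, ∀ x, g₁ * (x ⬝ᵥ x) ≤ x ⬝ᵥ G t *ᵥ x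
  weight_le : ∀ t ∈ Ioo 0 T, ∀ x, x ⬝ᵥ G t *ᵥ x ≤ g₂ * (x ⬝ᵥ x)
  orth_zero : (Q 0)ᵀ * Q 0 = 1
  symm_zero : (P 0)ᵀ = P 0
  riccati : PDeriv 0 T P (fun t => reducedB (A t) (Q t) * P t + P t * (reducedB (A t) (Q t))ᵀ
      - P t * (C * Q t)ᵀ * (C * Q t) * P t + G t)
  qr : PDeriv 0 T Q (fun t => (1 - Q t * (Q t)ᵀ) * A t * Q t + Q t * skewPart (A t) (Q t))

variable {T α g₁ g₂ : ℝ} {A : ℝ → Matrix ι ι ℝ} {C : Matrix κ ι ℝ}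
  {G P : ℝ → Matrix (Fin k) (Fin k) ℝ} {Q : ℝ → Matrix ι (Fin k) ℝ}

/-- In this form the equation reads `Q̇ = A Q - Q B₁`: the subspace is transported by `A`, and `B₁`
is the generator of the motion in the moving frame. -/
theorem qr_field_eq (A : Matrix ι ι ℝ) (Q : Matrix ι (Fin k) ℝ) :
    (1 - Q * Qᵀ) * A * Q + Q * skewPart A Q = A * Q - Q * reducedB A Q := by
  simp only [reducedB, Matrix.sub_mul, Matrix.mul_sub, Matrix.one_mul, Matrix.mul_assoc]
  abel

/-- The defect `E = QᵀQ - 1` satisfies `Ė = E X + Xᵀ E` with `X = S₁ - QᵀAQ`, thanks to the skew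
symmetry of `S₁`. Continuity of `Q` on the compact interval bounds `X`. -/
theorem ReducedTrajectory.orthonormal (h : ReducedTrajectory T α g₁ g₂ A C G P Q) :
    ∀ t ∈ Icc 0 T, (Q t)ᵀ * Q t = 1 := by
  obtain ⟨c, hc, hS⟩ := exists_norm_skewPart_le (ι := ι) k
  obtain ⟨M, hM⟩ := isCompact_Icc.exists_bound_of_continuousOn h.qr.1
  refine orthonormal_of_pDeriv (K := (1 + c) * (M * α * M))
    (X := fun t => skewPart (A t) (Q t) - (Q t)ᵀ * A t * Q t) h.qr (fun t ht => ?_)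
    (fun t _ => ?_) h.orth_zero
  · have hMt := hM t (Ioo_subset_Icc_self ht)
    have hM0 := (norm_nonneg _).trans hMt
    have h1 : ‖(Q t)ᵀ * A t * Q t‖ ≤ M * α * M := (norm_sandwich_le _ _).trans (by
      have := h.norm_le t ht
      have := (norm_nonneg _).trans this
      gcongr)
    refine (norm_sub_le _ _).trans ?_
    have h2 := hS (A t) (Q t)
    have h3 := mul_le_mul_of_nonneg_left h1 hc
    linarith
  · have hs := skewPart_transpose (A t) (Q t)
    simp only [Matrix.transpose_add, Matrix.transpose_mul, Matrix.transpose_sub,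
      Matrix.transpose_transpose, hs, Matrix.sub_mul, Matrix.mul_sub,
      Matrix.mul_add, Matrix.add_mul, Matrix.one_mul, Matrix.mul_one, Matrix.mul_assoc,
      Matrix.neg_mul]
    abel

theorem ReducedTrajectory.exists_norm_reducedB_le (h : ReducedTrajectory T α g₁ g₂ A C G P Q) :
    ∃ c, 0 ≤ c ∧ ∀ t ∈ Ioo 0 T, ‖reducedB (A t) (Q t)‖ ≤ c := by
  obtain ⟨c, hc, hB⟩ := SubspaceObserver.exists_norm_reducedB_le (ι := ι) k
  refine ⟨c * |α|, by positivity, fun t ht => ?_⟩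
  refine (hB _ _ (h.orthonormal t (Ioo_subset_Icc_self ht))).trans ?_
  exact mul_le_mul_of_nonneg_left ((h.norm_le t ht).trans (le_abs_self _)) hc

theorem norm_output_le {C : Matrix κ ι ℝ} {Q : Matrix ι (Fin k) ℝ} (hQ : Qᵀ * Q = 1) :
    ‖C * Q‖ ≤ ‖C‖ :=
  (Matrix.l2_opNorm_mul _ _).trans
    (mul_le_of_le_one_right (norm_nonneg _) (norm_le_one_of_orthonormal hQ))

theorem norm_gram_le {C : Matrix κ ι ℝ} {Q : Matrix ι (Fin k) ℝ} (hQ : Qᵀ * Q = 1) :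
    ‖(C * Q)ᵀ * (C * Q)‖ ≤ ‖C‖ ^ 2 := by
  refine (Matrix.l2_opNorm_mul _ _).trans ?_
  rw [norm_transpose, ← sq]
  exact pow_le_pow_left₀ (norm_nonneg _) (norm_output_le hQ) 2

/-- The difference `Pᵀ - P` solves a linear homogeneous equation with bounded coefficients, since
the difference of the quadratic terms factors through it. -/
theorem ReducedTrajectory.symm (h : ReducedTrajectory T α g₁ g₂ A C G P Q) :
    ∀ t ∈ Icc 0 T, (P t)ᵀ = P t := by
  obtain ⟨c, hc, hB⟩ := h.exists_norm_reducedB_le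
  obtain ⟨M, hM⟩ := isCompact_Icc.exists_bound_of_continuousOn h.riccati.1
  have hE := (h.riccati.transpose.sub h.riccati).eq_zero (K := 2 * (c + M * ‖C‖ ^ 2))
    (fun t ht => by
    have htI := Ioo_subset_Icc_self ht
    have hQ := h.orthonormal t htI
    have hH := norm_gram_le (C := C) hQ
    have hG := h.weight_symm t ht
    obtain ⟨H, hHd⟩ : ∃ H, H = (C * Q t)ᵀ * (C * Q t) := ⟨_, rfl⟩
    have hHs : Hᵀ = H := by rw [hHd, Matrix.transpose_mul, Matrix.transpose_transpose]
    rw [← hHd] at hH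
    obtain ⟨B, hBd⟩ : ∃ B, B = reducedB (A t) (Q t) := ⟨_, rfl⟩
    have hBn := hB t ht
    rw [← hBd] at hBn
    have e : (reducedB (A t) (Q t) * P t + P t * (reducedB (A t) (Q t))ᵀ
        - P t * (C * Q t)ᵀ * (C * Q t) * P t + G t)ᵀ - (reducedB (A t) (Q t) * P t +
        P t * (reducedB (A t) (Q t))ᵀ - P t * (C * Q t)ᵀ * (C * Q t) * P t + G t) =
        (B - (P t)ᵀ * H) * ((P t)ᵀ - P t) + ((P t)ᵀ - P t) * (Bᵀ - H * P t) := by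
      rw [Matrix.mul_assoc (P t), ← hHd, ← hBd]
      simp only [Matrix.transpose_add, Matrix.transpose_mul, Matrix.transpose_sub, hHs, hG,
        Matrix.transpose_transpose]
      noncomm_ring
    rw [e]
    refine (norm_add_le _ _).trans ?_
    have hPn := hM t htI
    have hPn' : ‖(P t)ᵀ‖ ≤ M := (norm_transpose _).trans_le hPn
    have hM0 := (norm_nonneg _).trans hPn
    have n1 : ‖B - (P t)ᵀ * H‖ ≤ c + M * ‖C‖ ^ 2 := (norm_sub_le _ _).trans
      (add_le_add hBn ((norm_mul_le _ _).trans (mul_le_mul hPn' hH (norm_nonneg _) hM0)))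
    have n2 : ‖Bᵀ - H * P t‖ ≤ c + M * ‖C‖ ^ 2 := (norm_sub_le _ _).trans
      (add_le_add ((norm_transpose B).trans_le hBn) ((norm_mul_le _ _).trans
        ((mul_le_mul hH hPn (norm_nonneg _) (by positivity)).trans_eq (mul_comm _ _))))
    have n3 := norm_mul_le (B - (P t)ᵀ * H) ((P t)ᵀ - P t)
    have n4 := norm_mul_le ((P t)ᵀ - P t) (Bᵀ - H * P t)
    have n5 := mul_le_mul_of_nonneg_right n1 (norm_nonneg ((P t)ᵀ - P t))
    have n6 := mul_le_mul_of_nonneg_left n2 (norm_nonneg ((P t)ᵀ - P t))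
    linarith) (by rw [h.symm_zero, sub_self])
  exact fun t ht => sub_eq_zero.1 (hE t ht)

theorem quad_gram {m n : Type*} [Fintype m] [Fintype n]
    (W : Matrix m n ℝ) (x : n → ℝ) : x ⬝ᵥ (Wᵀ * W) *ᵥ x = (W *ᵥ x) ⬝ᵥ (W *ᵥ x) := by
  classical
  rw [← Matrix.mulVec_mulVec, dotProduct_transpose_mulVec]

theorem dotProduct_self_nonneg' {n : Type*} [Fintype n] (x : n → ℝ) : 0 ≤ x ⬝ᵥ x :=
  Finset.sum_nonneg fun _ _ => mul_self_nonneg _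

theorem quad_smul_one {n : Type*} [Fintype n] [DecidableEq n] (c : ℝ) (x : n → ℝ) :
    x ⬝ᵥ (c • (1 : Matrix n n ℝ)) *ᵥ x = c * (x ⬝ᵥ x) := by
  rw [Matrix.smul_mulVec, Matrix.one_mulVec, dotProduct_smul, smul_eq_mul]

/-- With `y = M⁻¹ x`, the bound follows by expanding `|x - b y|² ≥ 0`; no symmetry is needed. -/
theorem quad_inv_le {n : Type*} [Fintype n] [DecidableEq n] {M : Matrix n n ℝ} {b : ℝ}
    (hM : IsUnit M) (hb : 0 ≤ b) (h : ∀ x, b * (x ⬝ᵥ x) ≤ x ⬝ᵥ M *ᵥ x) (x : n → ℝ) :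
    b * (x ⬝ᵥ M⁻¹ *ᵥ x) ≤ x ⬝ᵥ x := by
  obtain ⟨y, hy⟩ : ∃ y, y = M⁻¹ *ᵥ x := ⟨_, rfl⟩
  have hx : x = M *ᵥ y := by
    rw [hy, Matrix.mulVec_mulVec, Matrix.mul_nonsing_inv _ ((Matrix.isUnit_iff_isUnit_det _).1 hM),
      Matrix.one_mulVec]
  have n1 := h y
  rw [← hx] at n1
  rw [← hy]
  have n2 := dotProduct_self_nonneg' (x - b • y)
  rw [dotProduct_sub, sub_dotProduct, sub_dotProduct, smul_dotProduct, dotProduct_smul,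
    smul_dotProduct, dotProduct_smul, dotProduct_comm y x] at n2
  simp only [smul_eq_mul] at n2
  rw [dotProduct_comm y x] at n1
  have n3 := mul_le_mul_of_nonneg_left n1 hb
  linarith

/-- This is `M² ≤ s M` for `0 ≤ M ≤ s`. It follows by evaluating the nonnegative form at `s y - M
y`, without a square root or the spectral theorem. -/
theorem mulVec_self_le {n : Type*} [Fintype n] [DecidableEq n] {M : Matrix n n ℝ} {s : ℝ}
    (hs : Mᵀ = M) (hs0 : 0 < s) (h0 : ∀ x, 0 ≤ x ⬝ᵥ M *ᵥ x)
    (h : ∀ x, x ⬝ᵥ M *ᵥ x ≤ s * (x ⬝ᵥ x)) (y : n → ℝ) :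
    (M *ᵥ y) ⬝ᵥ (M *ᵥ y) ≤ s * (y ⬝ᵥ M *ᵥ y) := by
  obtain ⟨x, hx⟩ : ∃ x, M *ᵥ y = x := ⟨_, rfl⟩
  rw [hx]
  have hsw : y ⬝ᵥ M *ᵥ x = x ⬝ᵥ x := by
    conv_lhs => rw [← hs]
    rw [dotProduct_transpose_mulVec, hx]
  have n3 := h0 (s • y - x)
  rw [Matrix.mulVec_sub, Matrix.mulVec_smul, hx, dotProduct_sub, sub_dotProduct, sub_dotProduct,
    smul_dotProduct, dotProduct_smul, smul_dotProduct, dotProduct_smul, hsw] at n3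
  simp only [smul_eq_mul] at n3
  have n4 := h x
  have n5 : 0 ≤ s * (s * (y ⬝ᵥ x) - x ⬝ᵥ x) := by linarith
  linarith [nonneg_of_mul_nonneg_right n5 hs0]

theorem quad_inv_ge {n : Type*} [Fintype n] [DecidableEq n] {M : Matrix n n ℝ} {s : ℝ}
    (hs : Mᵀ = M) (hM : IsUnit M) (hs0 : 0 < s) (h0 : ∀ x, 0 ≤ x ⬝ᵥ M *ᵥ x)
    (h : ∀ x, x ⬝ᵥ M *ᵥ x ≤ s * (x ⬝ᵥ x)) (x : n → ℝ) :
    x ⬝ᵥ x ≤ s * (x ⬝ᵥ M⁻¹ *ᵥ x) := by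
  have := mulVec_self_le hs hs0 h0 h (M⁻¹ *ᵥ x)
  rw [Matrix.mulVec_mulVec, Matrix.mul_nonsing_inv _ ((Matrix.isUnit_iff_isUnit_det _).1 hM),
    Matrix.one_mulVec] at this
  rwa [dotProduct_comm x (M⁻¹ *ᵥ x)]

theorem norm_le_of_quad_le {n : Type*} [Fintype n] [DecidableEq n] {M : Matrix n n ℝ} {s : ℝ}
    (hs : Mᵀ = M) (hs0 : 0 < s) (h0 : ∀ x, 0 ≤ x ⬝ᵥ M *ᵥ x)
    (h : ∀ x, x ⬝ᵥ M *ᵥ x ≤ s * (x ⬝ᵥ x)) : ‖M‖ ≤ s := by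
  rw [Matrix.l2_opNorm_def]
  refine ContinuousLinearMap.opNorm_le_bound _ hs0.le fun x => ?_
  change ‖WithLp.toLp 2 (M *ᵥ x.ofLp)‖ ≤ s * ‖WithLp.toLp 2 x.ofLp‖
  refine (sq_le_sq₀ (norm_nonneg _) (by positivity)).1 ?_
  rw [mul_pow, norm_toLp_sq, norm_toLp_sq]
  have h1 := mulVec_self_le hs hs0 h0 h x.ofLp
  have h2 := mul_le_mul_of_nonneg_left (h x.ofLp) hs0.le
  linarith

theorem isUnit_of_quad_ge {n : Type*} [Fintype n] [DecidableEq n]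
    {M : Matrix n n ℝ} {b : ℝ} (hs : Mᵀ = M) (hb : 0 < b)
    (h : ∀ x, b * (x ⬝ᵥ x) ≤ x ⬝ᵥ M *ᵥ x) : IsUnit M := by
  refine (Matrix.PosDef.of_dotProduct_mulVec_pos ?_ fun x hx => ?_).isUnit
  · rw [Matrix.IsHermitian, Matrix.conjTranspose_eq_transpose_of_trivial, hs]
  · rw [star_trivial]
    refine lt_of_lt_of_le (mul_pos hb ?_) (h x)
    exact lt_of_le_of_ne (dotProduct_self_nonneg' x) fun h0 =>
      hx (dotProduct_self_eq_zero.1 h0.symm)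

theorem exists_quad_ge_of_posDef {n : Type*} [Fintype n] [DecidableEq n] {M : Matrix n n ℝ}
    (hM : M.PosDef) : ∃ b, 0 < b ∧ ∀ x, b * (x ⬝ᵥ x) ≤ x ⬝ᵥ M *ᵥ x := by
  have hi := hM.inv
  have hs : (M⁻¹)ᵀ = M⁻¹ := by
    rw [← Matrix.conjTranspose_eq_transpose_of_trivial]; exact hi.isHermitian
  have hp := (Matrix.posSemidef_iff_dotProduct_mulVec.1 hi.posSemidef).2
  simp only [star_trivial] at hp
  refine ⟨(‖M⁻¹‖ + 1)⁻¹, by positivity, fun x => ?_⟩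
  have h1 := quad_inv_ge (s := ‖M⁻¹‖ + 1) hs hi.isUnit (by positivity) hp (fun z =>
    (le_abs_self _).trans ((abs_quad_le _ _).trans (mul_le_mul_of_nonneg_right
      (by linarith) (dotProduct_self_nonneg' z)))) x
  rw [Matrix.nonsing_inv_nonsing_inv _ ((Matrix.isUnit_iff_isUnit_det _).1 hM.isUnit)] at h1
  rwa [inv_mul_le_iff₀ (by positivity)]

/-- A lower bound on the solution of the Riccati equation. -/
theorem ReducedTrajectory.lower_bound (h : ReducedTrajectory T α g₁ g₂ A C G P Q) {c p : ℝ}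
    (hp : 0 ≤ p) (hB : ∀ t ∈ Ioo 0 T, ‖reducedB (A t) (Q t)‖ ≤ c)
    (hpg : 2 * p * c + p ^ 2 * ‖C‖ ^ 2 ≤ g₁) (hP0 : ∀ x, p * (x ⬝ᵥ x) ≤ x ⬝ᵥ P 0 *ᵥ x) :
    ∀ t ∈ Icc 0 T, ∀ x, p * (x ⬝ᵥ x) ≤ x ⬝ᵥ P t *ᵥ x := by
  obtain ⟨M, hM⟩ := isCompact_Icc.exists_bound_of_continuousOn h.riccati.1
  have hquad : ∀ (X : Matrix (Fin k) (Fin k) ℝ) x,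
      x ⬝ᵥ (X - p • 1) *ᵥ x = x ⬝ᵥ X *ᵥ x - p * (x ⬝ᵥ x) := fun X x => by
    rw [Matrix.sub_mulVec, dotProduct_sub, quad_smul_one]
  let H : ℝ → Matrix (Fin k) (Fin k) ℝ := fun t => (C * Q t)ᵀ * (C * Q t)
  let B : ℝ → Matrix (Fin k) (Fin k) ℝ := fun t => reducedB (A t) (Q t)
  have hHs : ∀ t, (H t)ᵀ = H t := fun t => by
    simp only [H, Matrix.transpose_mul, Matrix.transpose_transpose]
  let R : ℝ → Matrix (Fin k) (Fin k) ℝ := fun t => P t - p • 1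
  have hRs : ∀ t ∈ Icc 0 T, (R t)ᵀ = R t := fun t ht => by simp [R, h.symm t ht]
  have hR := h.riccati.sub (PDeriv.const (p • (1 : Matrix (Fin k) (Fin k) ℝ)))
  -- With the closed-loop matrix `B - P H`, completing the square in the quadratic term leaves `R H
  -- R ≥ 0` and a term that the lower bound on `G` makes nonnegative for small `p`.
  have hmain := lyapunov_nonneg (R := R) (F := fun t => B t - P t * H t)
    (N := fun t => R t * H t * R t + (p • (B t + (B t)ᵀ) - p ^ 2 • H t + G t))
    (c := |c| + |M| * ‖C‖ ^ 2) (by positivity)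
    (hR.congr_deriv fun t ht => by
      have hs := h.symm t (Ioo_subset_Icc_self ht)
      have e : P t * (C * Q t)ᵀ * (C * Q t) * P t = P t * H t * P t := by
        simp only [H, Matrix.mul_assoc]
      rw [e]
      change B t * P t + P t * (B t)ᵀ - P t * H t * P t + G t - 0 = _
      simp only [R, Matrix.transpose_sub, Matrix.transpose_mul, hs, hHs, Matrix.mul_sub,
        Matrix.sub_mul, Matrix.mul_smul, Matrix.smul_mul, Matrix.mul_one, Matrix.one_mul,
        Matrix.mul_assoc, smul_sub, smul_add, smul_smul, sq]
      abel)
    hRs (fun t ht => by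
      have htI := Ioo_subset_Icc_self ht
      refine (norm_sub_le _ _).trans (add_le_add ((hB t ht).trans (le_abs_self c))
        ((norm_mul_le _ _).trans (mul_le_mul ((hM t htI).trans (le_abs_self M))
          (norm_gram_le (h.orthonormal t htI)) (norm_nonneg _) (abs_nonneg _))))) (fun t ht x => by
      have htI := Ioo_subset_Icc_self ht
      have e1 : R t * H t * R t = (C * Q t * R t)ᵀ * (C * Q t * R t) := by
        simp only [H, Matrix.transpose_mul, hRs t htI, Matrix.mul_assoc]
      have n1 := dotProduct_self_nonneg' ((C * Q t * R t) *ᵥ x)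
      have n2 := abs_quad_le (B t) x
      have n3 := abs_quad_le (H t) x
      have n4 := h.weight_ge t ht x
      have n5 := dotProduct_self_nonneg' x
      have n6 : x ⬝ᵥ (B t)ᵀ *ᵥ x = x ⬝ᵥ B t *ᵥ x := by
        rw [dotProduct_transpose_mulVec, dotProduct_comm]
      rw [Matrix.add_mulVec, dotProduct_add, e1, quad_gram, Matrix.add_mulVec, dotProduct_add,
        Matrix.sub_mulVec, dotProduct_sub, Matrix.smul_mulVec, Matrix.smul_mulVec, dotProduct_smul,
        dotProduct_smul, Matrix.add_mulVec, dotProduct_add, n6, smul_eq_mul, smul_eq_mul]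
      have m1 : ‖B t‖ * (x ⬝ᵥ x) ≤ c * (x ⬝ᵥ x) := mul_le_mul_of_nonneg_right (hB t ht) n5
      have m2 : ‖H t‖ * (x ⬝ᵥ x) ≤ ‖C‖ ^ 2 * (x ⬝ᵥ x) :=
        mul_le_mul_of_nonneg_right (norm_gram_le (h.orthonormal t htI)) n5
      have m3 : p * -(x ⬝ᵥ B t *ᵥ x) ≤ p * (c * (x ⬝ᵥ x)) :=
        mul_le_mul_of_nonneg_left (by linarith [(abs_le.1 n2).1]) hp
      have m4 : p ^ 2 * (x ⬝ᵥ H t *ᵥ x) ≤ p ^ 2 * (‖C‖ ^ 2 * (x ⬝ᵥ x)) :=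
        mul_le_mul_of_nonneg_left (by linarith [(abs_le.1 n3).2]) (sq_nonneg p)
      have m5 := mul_le_mul_of_nonneg_right hpg n5
      linarith)
    (fun x => by
      rw [hquad]; linarith [hP0 x])
  intro t ht x
  have := hmain t ht x
  rw [hquad] at this
  linarith

/-- An upper bound on the solution of the Riccati equation, from a quadratic form that certifies
observability. -/
theorem ReducedTrajectory.upper_bound (h : ReducedTrajectory T α g₁ g₂ A C G P Q)
    {S : Matrix ι ι ℝ} {b c γ β : ℝ} (hb : 0 < b) (hS : Sᵀ = S)
    (hSb : ∀ z, b * (z ⬝ᵥ z) ≤ z ⬝ᵥ S *ᵥ z)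
    (hobs : ∀ t ∈ Ioo 0 T, ∀ z, 2 * (z ⬝ᵥ S *ᵥ (A t *ᵥ z)) ≤
        c * ((C *ᵥ z) ⬝ᵥ (C *ᵥ z)) - γ * (z ⬝ᵥ z))
    (hβ : 0 < β) (hβc : c ≤ β) (hg₂ : 0 ≤ g₂) (hβg : g₂ * ‖S‖ ^ 2 ≤ γ * β)
    (hP0 : ‖P 0‖ * (‖S‖ + 1) ≤ β) (hT : 0 ≤ T) :
    ∀ t ∈ Icc 0 T, ∀ x, x ⬝ᵥ P t *ᵥ x ≤ β / b * (x ⬝ᵥ x) := by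
  let M : ℝ → Matrix (Fin k) (Fin k) ℝ := fun t => (Q t)ᵀ * S * Q t
  let H : ℝ → Matrix (Fin k) (Fin k) ℝ := fun t => (C * Q t)ᵀ * (C * Q t)
  let B : ℝ → Matrix (Fin k) (Fin k) ℝ := fun t => reducedB (A t) (Q t)
  let Kt : ℝ → Matrix (Fin k) (Fin k) ℝ := fun t => (Q t)ᵀ * (S * A t + (A t)ᵀ * S) * Q t
  have hHs : ∀ t, (H t)ᵀ = H t := fun t => by
    simp only [H, Matrix.transpose_mul, Matrix.transpose_transpose]
  have hMs : ∀ t, (M t)ᵀ = M t := fun t => by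
    simp only [M, Matrix.transpose_mul, Matrix.transpose_transpose, hS, Matrix.mul_assoc]
  have hMquad : ∀ t x, x ⬝ᵥ M t *ᵥ x = (Q t *ᵥ x) ⬝ᵥ S *ᵥ (Q t *ᵥ x) := fun t x => by
    simp only [M]
    rw [← Matrix.mulVec_mulVec, ← Matrix.mulVec_mulVec, dotProduct_transpose_mulVec]
  have hQx : ∀ t ∈ Icc 0 T, ∀ x, (Q t *ᵥ x) ⬝ᵥ (Q t *ᵥ x) = x ⬝ᵥ x := fun t ht x => by
    rw [← quad_gram, h.orthonormal t ht, Matrix.one_mulVec]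
  have hMb : ∀ t ∈ Icc 0 T, ∀ x, b * (x ⬝ᵥ x) ≤ x ⬝ᵥ M t *ᵥ x := fun t ht x => by
    rw [hMquad, ← hQx t ht]; exact hSb _
  have hMu : ∀ t ∈ Icc 0 T, IsUnit (M t) := fun t ht =>
    isUnit_of_quad_ge (hMs t) hb (hMb t ht)
  have hMl : ∀ t ∈ Icc 0 T, (M t)⁻¹ * M t = 1 := fun t ht =>
    Matrix.nonsing_inv_mul _ ((Matrix.isUnit_iff_isUnit_det _).1 (hMu t ht))
  have hMr : ∀ t ∈ Icc 0 T, M t * (M t)⁻¹ = 1 := fun t ht =>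
    Matrix.mul_nonsing_inv _ ((Matrix.isUnit_iff_isUnit_det _).1 (hMu t ht))
  have hMis : ∀ t, ((M t)⁻¹)ᵀ = (M t)⁻¹ := fun t => by
    rw [Matrix.transpose_nonsing_inv, hMs]
  have hMn : ∀ t ∈ Icc 0 T, ‖M t‖ ≤ ‖S‖ := fun t ht => by
    have h1 := norm_le_one_of_orthonormal (h.orthonormal t ht)
    refine (norm_sandwich_le S (Q t)).trans ?_
    calc ‖Q t‖ * ‖S‖ * ‖Q t‖ ≤ 1 * ‖S‖ * 1 := by gcongr
      _ = _ := by ring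
  have hQ' : PDeriv 0 T Q (fun t => A t * Q t - Q t * B t) :=
    h.qr.congr_deriv fun t _ => qr_field_eq _ _
  have hM' : PDeriv 0 T M (fun t => Kt t - M t * B t - (B t)ᵀ * M t) :=
    ((hQ'.transpose.matMul (PDeriv.const S)).matMul hQ').congr_deriv fun t _ => by
      simp only [M, Kt, Matrix.transpose_sub, Matrix.transpose_mul, Matrix.mul_sub, Matrix.sub_mul,
        Matrix.mul_add, Matrix.add_mul, Matrix.mul_assoc, Matrix.mul_zero, zero_add]
      abel
  -- In the frame `Q` the restricted form `M = QᵀSQ` evolves with `-M B - Bᵀ M`. Inversion turns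
  -- this into `B M⁻¹ + M⁻¹ Bᵀ`, the linear part of the Riccati equation, so a multiple of `M⁻¹` is
  -- a candidate supersolution.
  have hW : PDeriv 0 T (fun t => β • (M t)⁻¹) (fun t =>
      -(β • ((M t)⁻¹ * Kt t * (M t)⁻¹)) + B t * (β • (M t)⁻¹) + (β • (M t)⁻¹) * (B t)ᵀ) :=
    ((hM'.matInv hMu).clm (β • ContinuousLinearMap.id ℝ _)).congr_deriv fun t ht => by
      have htI := Ioo_subset_Icc_self ht
      have e : (M t)⁻¹ * (Kt t - M t * B t - (B t)ᵀ * M t) * (M t)⁻¹ =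
          (M t)⁻¹ * Kt t * (M t)⁻¹ - B t * (M t)⁻¹ - (M t)⁻¹ * (B t)ᵀ := by
        rw [Matrix.mul_sub, Matrix.mul_sub, Matrix.sub_mul, Matrix.sub_mul,
          ← Matrix.mul_assoc (M t)⁻¹ (M t), hMl t htI, Matrix.one_mul,
          Matrix.mul_assoc (M t)⁻¹ ((B t)ᵀ * M t), Matrix.mul_assoc (B t)ᵀ, hMr t htI,
          Matrix.mul_one]
      simp only [e, _root_.smul_apply, ContinuousLinearMap.id_apply, Matrix.mul_smul,
        Matrix.smul_mul, smul_neg, smul_sub]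
      abel
  let R : ℝ → Matrix (Fin k) (Fin k) ℝ := fun t => β • (M t)⁻¹ - P t
  have hRs : ∀ t ∈ Icc 0 T, (R t)ᵀ = R t := fun t ht => by simp [R, h.symm t ht, hMis]
  have hR := hW.sub h.riccati
  obtain ⟨cB, -, hB⟩ := h.exists_norm_reducedB_le
  obtain ⟨cW, hcW⟩ := isCompact_Icc.exists_bound_of_continuousOn hW.1
  have hxy : ∀ t ∈ Icc 0 T, ∀ x, x ⬝ᵥ x ≤ ‖S‖ ^ 2 * (((M t)⁻¹ *ᵥ x) ⬝ᵥ ((M t)⁻¹ *ᵥ x)) := by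
    intro t ht x
    have e : x = M t *ᵥ ((M t)⁻¹ *ᵥ x) := by
      rw [Matrix.mulVec_mulVec, hMr t ht, Matrix.one_mulVec]
    have n1 := norm_toLp_mulVec_le (M t) ((M t)⁻¹ *ᵥ x)
    rw [← e] at n1
    rw [← norm_toLp_sq, ← norm_toLp_sq, ← mul_pow]
    refine pow_le_pow_left₀ (norm_nonneg _) (n1.trans ?_) 2
    exact mul_le_mul_of_nonneg_right (hMn t ht) (norm_nonneg _)
  have hinv : ∀ t ∈ Icc 0 T, ∀ x, x ⬝ᵥ (M t)⁻¹ *ᵥ x =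
      ((M t)⁻¹ *ᵥ x) ⬝ᵥ M t *ᵥ ((M t)⁻¹ *ᵥ x) := fun t ht x => by
    rw [Matrix.mulVec_mulVec, hMr t ht, Matrix.one_mulVec, dotProduct_comm]
  -- At `y = M⁻¹ x`, the inequality for `S` bounds the forcing below by `β (β - c) |C Q y|² + β γ
  -- |y|² - g₂ |x|²`. It is nonnegative by the two conditions on `β`, since `|x| ≤ ‖S‖ |y|`.
  have hmain := lyapunov_nonneg (R := R) (F := fun t => B t - (β • (M t)⁻¹) * H t)
    (N := fun t => R t * H t * R t + ((β • (M t)⁻¹) * H t * (β • (M t)⁻¹)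
      - β • ((M t)⁻¹ * Kt t * (M t)⁻¹) - G t))
    (c := |cB| + |cW| * ‖C‖ ^ 2) (by positivity)
    (hR.congr_deriv fun t ht => by
      have hs := h.symm t (Ioo_subset_Icc_self ht)
      have e : P t * (C * Q t)ᵀ * (C * Q t) * P t = P t * H t * P t := by
        simp only [H, Matrix.mul_assoc]
      rw [e]
      change -(β • ((M t)⁻¹ * Kt t * (M t)⁻¹)) + B t * (β • (M t)⁻¹) + (β • (M t)⁻¹) * (B t)ᵀ -
        (B t * P t + P t * (B t)ᵀ - P t * H t * P t + G t) = _
      simp only [R]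
      have hWs : (β • (M t)⁻¹)ᵀ = β • (M t)⁻¹ := by rw [Matrix.transpose_smul, hMis]
      generalize β • (M t)⁻¹ = W at hWs ⊢
      generalize β • ((M t)⁻¹ * Kt t * (M t)⁻¹) = Y
      simp only [Matrix.transpose_sub, Matrix.transpose_mul, hWs, hHs, Matrix.mul_sub,
        Matrix.sub_mul, Matrix.mul_assoc]
      abel)
    hRs (fun t ht => by
      have htI := Ioo_subset_Icc_self ht
      refine (norm_sub_le _ _).trans (add_le_add ((hB t ht).trans (le_abs_self cB))
        ((norm_mul_le _ _).trans (mul_le_mul ((hcW t htI).trans (le_abs_self cW))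
          (norm_gram_le (h.orthonormal t htI)) (norm_nonneg _) (abs_nonneg _))))) (fun t ht x => by
      have htI := Ioo_subset_Icc_self ht
      have e1 : R t * H t * R t = (C * Q t * R t)ᵀ * (C * Q t * R t) := by
        simp only [H, Matrix.transpose_mul, hRs t htI, Matrix.mul_assoc]
      have n1 := dotProduct_self_nonneg' ((C * Q t * R t) *ᵥ x)
      obtain ⟨y, hy⟩ : ∃ y, y = (M t)⁻¹ *ᵥ x := ⟨_, rfl⟩
      have e2 : x ⬝ᵥ ((β • (M t)⁻¹) * H t * (β • (M t)⁻¹)) *ᵥ x =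
          β ^ 2 * ((C *ᵥ (Q t *ᵥ y)) ⬝ᵥ (C *ᵥ (Q t *ᵥ y))) := by
        have : (β • (M t)⁻¹) * H t * (β • (M t)⁻¹) =
            β ^ 2 • ((C * Q t * (M t)⁻¹)ᵀ * (C * Q t * (M t)⁻¹)) := by
          simp only [H, Matrix.transpose_mul, hMis, Matrix.mul_assoc, Matrix.smul_mul,
            Matrix.mul_smul, smul_smul, sq]
        rw [this, Matrix.smul_mulVec, dotProduct_smul, quad_gram, smul_eq_mul, hy]
        simp only [Matrix.mulVec_mulVec, Matrix.mul_assoc]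
      have e3 : x ⬝ᵥ ((M t)⁻¹ * Kt t * (M t)⁻¹) *ᵥ x =
          2 * ((Q t *ᵥ y) ⬝ᵥ S *ᵥ (A t *ᵥ (Q t *ᵥ y))) := by
        have : (M t)⁻¹ * Kt t * (M t)⁻¹ =
            (Q t * (M t)⁻¹)ᵀ * ((S * A t + (A t)ᵀ * S) * (Q t * (M t)⁻¹)) := by
          simp only [Kt, Matrix.transpose_mul, hMis, Matrix.mul_assoc]
        rw [this, ← Matrix.mulVec_mulVec, dotProduct_transpose_mulVec]
        have e4 : (Q t * (M t)⁻¹) *ᵥ x = Q t *ᵥ y := by rw [hy, Matrix.mulVec_mulVec]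
        rw [← Matrix.mulVec_mulVec (v := x) (M := S * A t + (A t)ᵀ * S)]
        rw [e4, Matrix.add_mulVec, dotProduct_add, ← Matrix.mulVec_mulVec]
        have e5 : (A t)ᵀ * S = (S * A t)ᵀ := by rw [Matrix.transpose_mul, hS]
        rw [e5, dotProduct_transpose_mulVec, ← Matrix.mulVec_mulVec,
          dotProduct_comm (S *ᵥ (A t *ᵥ (Q t *ᵥ y)))]
        ring
      have o := hobs t ht (Q t *ᵥ y)
      rw [hQx t htI] at o
      have n4 := h.weight_le t ht x
      have n5 := hxy t htI x
      rw [← hy] at n5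
      have n6 := dotProduct_self_nonneg' y
      have n7 := dotProduct_self_nonneg' (C *ᵥ (Q t *ᵥ y))
      rw [Matrix.add_mulVec, dotProduct_add, e1, quad_gram, Matrix.sub_mulVec, dotProduct_sub,
        Matrix.sub_mulVec, dotProduct_sub, e2, Matrix.smul_mulVec, dotProduct_smul, e3, smul_eq_mul]
      have m1 := mul_le_mul_of_nonneg_left o hβ.le
      have m2 := mul_le_mul_of_nonneg_left n5 hg₂
      have m3 := mul_le_mul_of_nonneg_right hβg n6
      have m4 := mul_le_mul_of_nonneg_right hβc (mul_nonneg hβ.le n7)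
      nlinarith)
    (fun x => by
      have h0 : (0 : ℝ) ∈ Icc 0 T := left_mem_Icc.2 hT
      simp only [R]
      rw [Matrix.sub_mulVec, dotProduct_sub, Matrix.smul_mulVec, dotProduct_smul, smul_eq_mul]
      have n1 := (abs_le.1 (abs_quad_le (P 0) x)).2
      have n2 : x ⬝ᵥ x ≤ (‖S‖ + 1) * (x ⬝ᵥ (M 0)⁻¹ *ᵥ x) :=
        quad_inv_ge (hMs 0) (hMu 0 h0) (by positivity)
          (fun z => (mul_nonneg hb.le (dotProduct_self_nonneg' z)).trans (hMb 0 h0 z))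
          (fun z => (le_abs_self _).trans ((abs_quad_le _ _).trans (mul_le_mul_of_nonneg_right
            ((hMn 0 h0).trans (by linarith)) (dotProduct_self_nonneg' z)))) x
      have n3 := mul_le_mul_of_nonneg_left n2 (norm_nonneg (P 0))
      have n4 : 0 ≤ x ⬝ᵥ (M 0)⁻¹ *ᵥ x := by
        rw [hinv 0 h0]
        exact (mul_nonneg hb.le (dotProduct_self_nonneg' _)).trans (hMb 0 h0 _)
      have n5 := mul_le_mul_of_nonneg_right hP0 n4
      linarith)
  intro t ht x
  have h1 := hmain t ht x
  simp only [R] at h1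
  rw [Matrix.sub_mulVec, dotProduct_sub, Matrix.smul_mulVec, dotProduct_smul, smul_eq_mul] at h1
  have h2 : b * (x ⬝ᵥ (M t)⁻¹ *ᵥ x) ≤ x ⬝ᵥ x := quad_inv_le (hMu t ht) hb.le (hMb t ht) x
  rw [div_mul_eq_mul_div, le_div_iff₀ hb]
  have h3 := mul_le_mul_of_nonneg_left h2 hβ.le
  have h4 := mul_le_mul_of_nonneg_right (sub_nonneg.1 h1) hb.le
  linarith

end Bounds

/-! ### The vector field of the observer -/

section Field

variable {ι κ U : Type*} [Fintype ι] [DecidableEq ι] [Fintype κ] [DecidableEq κ]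

theorem toEuclideanLin_jacobian (f : EuclideanSpace ℝ ι → U → EuclideanSpace ℝ ι)
    (x : EuclideanSpace ℝ ι) (u : U) (e : EuclideanSpace ℝ ι) :
    Matrix.toEuclideanLin (jacobian f x u) e = fderiv ℝ (fun z => f z u) x e := by
  have he : e = ∑ j, e j • EuclideanSpace.single j (1 : ℝ) := by
    ext i
    simp [Finset.sum_apply, Pi.single_apply]
  ext i
  conv_rhs => rw [he]
  rw [map_sum]
  simp only [map_smul, WithLp.ofLp_sum, WithLp.ofLp_smul, Finset.sum_apply, Pi.smul_apply,
    smul_eq_mul]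
  change (jacobian f x u *ᵥ e.ofLp) i = _
  simp only [Matrix.mulVec, dotProduct, jacobian, Matrix.of_apply]
  exact Finset.sum_congr rfl fun j _ => mul_comm _ _

theorem norm_toEuclideanLin_le (M : Matrix κ ι ℝ) (v : EuclideanSpace ℝ ι) :
    ‖Matrix.toEuclideanLin M v‖ ≤ ‖M‖ * ‖v‖ := norm_toLp_mulVec_le M v.ofLp

theorem norm_jacobian_le (f : EuclideanSpace ℝ ι → U → EuclideanSpace ℝ ι)
    (x : EuclideanSpace ℝ ι) (u : U) :
    ‖jacobian f x u‖ ≤ ‖fderiv ℝ (fun z => f z u) x‖ := by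
  rw [Matrix.l2_opNorm_def]
  refine ContinuousLinearMap.opNorm_le_bound _ (norm_nonneg _) fun e => ?_
  change ‖Matrix.toEuclideanLin (jacobian f x u) e‖ ≤ _
  rw [toEuclideanLin_jacobian]
  exact ContinuousLinearMap.le_opNorm _ _

theorem isBoundedBilinearMap_toEuclideanLin : IsBoundedBilinearMap ℝ
    (fun p : Matrix κ ι ℝ × EuclideanSpace ℝ ι => Matrix.toEuclideanLin p.1 p.2) where
  add_left _ _ _ := by simp
  smul_left _ _ _ := by simp
  add_right _ _ _ := by simp
  smul_right _ _ _ := by simp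
  bound := ⟨1, one_pos, fun A v => by simpa using norm_toEuclideanLin_le A v⟩

/-! ### Differentiability of the observer's right-hand side. -/

section Smooth

variable {X : Type*} [NormedAddCommGroup X] [NormedSpace ℝ X] {N : WithTop ℕ∞}

theorem contDiff_matMul {l m n : Type*} [Fintype l] [DecidableEq l] [Fintype m] [DecidableEq m]
    [Fintype n] [DecidableEq n] {A : X → Matrix l m ℝ} {B : X → Matrix m n ℝ}
    (hA : ContDiff ℝ N A) (hB : ContDiff ℝ N B) : ContDiff ℝ N (fun x => A x * B x) :=
  isBoundedBilinearMap_matrix_mul.contDiff.comp (hA.prodMk hB)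

theorem contDiff_transpose {A : X → Matrix κ ι ℝ}
    (hA : ContDiff ℝ N A) : ContDiff ℝ N (fun x => (A x)ᵀ) := by
  have h : ContDiff ℝ N (transposeL : Matrix κ ι ℝ →L[ℝ] Matrix ι κ ℝ) :=
    ContinuousLinearMap.contDiff _
  exact h.comp hA

theorem contDiff_toEuclideanLin {A : X → Matrix κ ι ℝ} {v : X → EuclideanSpace ℝ ι}
    (hA : ContDiff ℝ N A) (hv : ContDiff ℝ N v) :
    ContDiff ℝ N (fun x => Matrix.toEuclideanLin (A x) (v x)) := by
  have h := (isBoundedBilinearMap_toEuclideanLin (ι := ι) (κ := κ)).contDiff (n := N)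
  exact h.comp (hA.prodMk hv)

/-- The linear map whose value at `Qᵀ A Q` is the skew-symmetric matrix of the QR decomposition. -/
def skewLin (k : ℕ) : Matrix (Fin k) (Fin k) ℝ →ₗ[ℝ] Matrix (Fin k) (Fin k) ℝ where
  toFun M := Matrix.of fun i j => if j < i then M i j else if i < j then -M j i else 0
  map_add' M M' := by
    ext i j
    simp only [Matrix.of_apply, Matrix.add_apply]
    split_ifs <;> ring
  map_smul' c M := by
    ext i j
    simp only [Matrix.of_apply, Matrix.smul_apply, smul_eq_mul, RingHom.id_apply]
    split_ifs <;> ring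

theorem contDiff_skewPart {k : ℕ} {A : X → Matrix ι ι ℝ} {Q : X → Matrix ι (Fin k) ℝ}
    (hA : ContDiff ℝ N A) (hQ : ContDiff ℝ N Q) : ContDiff ℝ N (fun x => skewPart (A x) (Q x)) := by
  have h : ∀ x, skewPart (A x) (Q x) = (skewLin k).toContinuousLinearMap ((Q x)ᵀ * A x * Q x) :=
    fun x => rfl
  simp only [h]
  exact (ContinuousLinearMap.contDiff _).comp
    (contDiff_matMul (contDiff_matMul (contDiff_transpose hQ) hA) hQ)

/-- The matrix of an endomorphism of Euclidean space. -/
def matrixLin : (EuclideanSpace ℝ ι →L[ℝ] EuclideanSpace ℝ ι) →ₗ[ℝ] Matrix ι ι ℝ where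
  toFun φ := Matrix.of fun i j => φ (EuclideanSpace.single j 1) i
  map_add' _ _ := rfl
  map_smul' _ _ := rfl

/-- The Jacobian costs one derivative: `C²` data make the observer field `C¹`, which the existence
argument requires. -/
theorem contDiff_jacobian {V : Type*} [NormedAddCommGroup V] [NormedSpace ℝ V]
    {f : EuclideanSpace ℝ ι → V → EuclideanSpace ℝ ι}
    (hf : ContDiff ℝ 2 (fun q : EuclideanSpace ℝ ι × V => f q.1 q.2))
    {x : X → EuclideanSpace ℝ ι} {u : X → V} (hx : ContDiff ℝ 1 x) (hu : ContDiff ℝ 1 u) :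
    ContDiff ℝ 1 (fun q => jacobian f (x q) (u q)) := by
  have h1 : ContDiff ℝ 1 (fun q : EuclideanSpace ℝ ι × V => fderiv ℝ (fun z => f z q.2) q.1) := by
    have h0 : ContDiff ℝ 2 (Function.uncurry
        fun (q : EuclideanSpace ℝ ι × V) (z : EuclideanSpace ℝ ι) => f z q.2) :=
      hf.comp (contDiff_snd.prodMk (contDiff_snd.comp contDiff_fst))
    exact h0.fderiv contDiff_fst (by norm_num)
  have h2 : ∀ q, jacobian f (x q) (u q) = (matrixLin (ι := ι)).toContinuousLinearMap
      (fderiv ℝ (fun z => f z (u q)) (x q)) := fun q => rfl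
  simp only [h2]
  exact (ContinuousLinearMap.contDiff _).comp (h1.comp (hx.prodMk hu))

/-- The right-hand side of the observer, as a function of the data `(u, y, G)` and of the state
`(x̂, P, Q)`. -/
def observerField {V : Type*} {k : ℕ} (f : EuclideanSpace ℝ ι → V → EuclideanSpace ℝ ι)
    (C : Matrix κ ι ℝ)
    (q : (V × EuclideanSpace ℝ κ × Matrix (Fin k) (Fin k) ℝ) ×
      (EuclideanSpace ℝ ι × Matrix (Fin k) (Fin k) ℝ × Matrix ι (Fin k) ℝ)) :
    EuclideanSpace ℝ ι × Matrix (Fin k) (Fin k) ℝ × Matrix ι (Fin k) ℝ :=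
  (f q.2.1 q.1.1 + Matrix.toEuclideanLin (gain C q.2.2.1 q.2.2.2)
      (q.1.2.1 - Matrix.toEuclideanLin C q.2.1),
    reducedB (jacobian f q.2.1 q.1.1) q.2.2.2 * q.2.2.1
      + q.2.2.1 * (reducedB (jacobian f q.2.1 q.1.1) q.2.2.2)ᵀ
      - q.2.2.1 * (C * q.2.2.2)ᵀ * (C * q.2.2.2) * q.2.2.1 + q.1.2.2,
    (1 - q.2.2.2 * (q.2.2.2)ᵀ) * jacobian f q.2.1 q.1.1 * q.2.2.2
      + q.2.2.2 * skewPart (jacobian f q.2.1 q.1.1) q.2.2.2)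

theorem contDiff_observerField {V : Type*} [NormedAddCommGroup V] [NormedSpace ℝ V] {k : ℕ}
    {f : EuclideanSpace ℝ ι → V → EuclideanSpace ℝ ι} (C : Matrix κ ι ℝ)
    (hf : ContDiff ℝ 2 (fun q : EuclideanSpace ℝ ι × V => f q.1 q.2)) :
    ContDiff ℝ 1 (observerField (k := k) f C) := by
  let Y := (V × EuclideanSpace ℝ κ × Matrix (Fin k) (Fin k) ℝ) ×
      (EuclideanSpace ℝ ι × Matrix (Fin k) (Fin k) ℝ × Matrix ι (Fin k) ℝ)
  have hu : ContDiff ℝ 1 (fun q : Y => q.1.1) := contDiff_fst.comp contDiff_fst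
  have hy : ContDiff ℝ 1 (fun q : Y => q.1.2.1) :=
    contDiff_fst.comp (contDiff_snd.comp contDiff_fst)
  have hG : ContDiff ℝ 1 (fun q : Y => q.1.2.2) :=
    contDiff_snd.comp (contDiff_snd.comp contDiff_fst)
  have hx : ContDiff ℝ 1 (fun q : Y => q.2.1) := contDiff_fst.comp contDiff_snd
  have hP : ContDiff ℝ 1 (fun q : Y => q.2.2.1) :=
    contDiff_fst.comp (contDiff_snd.comp contDiff_snd)
  have hQ : ContDiff ℝ 1 (fun q : Y => q.2.2.2) :=
    contDiff_snd.comp (contDiff_snd.comp contDiff_snd)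
  have hJ := contDiff_jacobian hf hx hu
  have hS := contDiff_skewPart hJ hQ
  have hB : ContDiff ℝ 1 (fun q : Y => reducedB (jacobian f q.2.1 q.1.1) q.2.2.2) :=
    (contDiff_matMul (contDiff_matMul (contDiff_transpose hQ) hJ) hQ).sub hS
  have hCQ : ContDiff ℝ 1 (fun q : Y => C * q.2.2.2) := contDiff_matMul contDiff_const hQ
  refine ContDiff.prodMk ?_ (ContDiff.prodMk ?_ ?_)
  · refine ((hf.of_le (by norm_num)).comp (hx.prodMk hu)).add (contDiff_toEuclideanLin ?_ ?_)
    · exact contDiff_matMul (contDiff_matMul hQ hP) (contDiff_transpose hCQ)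
    · exact hy.sub (contDiff_toEuclideanLin contDiff_const hx)
  · exact (((contDiff_matMul hB hP).add (contDiff_matMul hP (contDiff_transpose hB))).sub
      (contDiff_matMul (contDiff_matMul (contDiff_matMul hP (contDiff_transpose hCQ)) hCQ) hP)).add
      hG
  · exact (contDiff_matMul (contDiff_matMul (contDiff_const.sub
      (contDiff_matMul hQ (contDiff_transpose hQ))) hJ) hQ).add (contDiff_matMul hQ hS)

end Smooth

theorem norm_gain_le {k : ℕ} {C : Matrix κ ι ℝ} {P : Matrix (Fin k) (Fin k) ℝ}
    {Q : Matrix ι (Fin k) ℝ} {p : ℝ} (hQ : Qᵀ * Q = 1) (hP : ‖P‖ ≤ p) :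
    ‖gain C P Q‖ ≤ p * ‖C‖ := by
  have h1 := norm_le_one_of_orthonormal hQ
  refine (Matrix.l2_opNorm_mul _ _).trans ?_
  rw [norm_transpose]
  have hp := (norm_nonneg _).trans hP
  refine mul_le_mul ((Matrix.l2_opNorm_mul _ _).trans ?_) (norm_output_le hQ) (norm_nonneg _) hp
  calc ‖Q‖ * ‖P‖ ≤ 1 * p := by gcongr
    _ = p := one_mul p

/-- The second order bound on the Taylor remainder. -/
theorem norm_taylorRemainder_le {f : EuclideanSpace ℝ ι → U → EuclideanSpace ℝ ι}
    (hf : ∀ u, ContDiff ℝ 2 (fun z => f z u)) {H : ℝ}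
    (hH : ∀ r x u, ‖fderiv ℝ (fun z => fderiv ℝ (fun w => (f w u) r) z) x‖ ≤ H) :
    ∃ κ : ℝ, 0 < κ ∧ ∀ e x u, ‖taylorRemainder f e x u‖ ≤ κ * ‖e‖ ^ 2 := by
  refine ⟨Fintype.card ι * |H| + 1, by positivity, fun e x u => ?_⟩
  have hcomp : ∀ r, |taylorRemainder f e x u r| ≤ |H| * ‖e‖ ^ 2 := by
    intro r
    have hr : ContDiff ℝ 2 (fun z => (f z u) r) :=
      (EuclideanSpace.proj r : EuclideanSpace ℝ ι →L[ℝ] ℝ).contDiff.comp (hf u)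
    have hd : Differentiable ℝ (fun z => (f z u) r) := hr.differentiable (by norm_num)
    have hd2 : Differentiable ℝ (fderiv ℝ (fun z => (f z u) r)) :=
      (hr.fderiv_right (m := 1) (by norm_num)).differentiable (by norm_num)
    have h1 : ∀ z, ‖fderiv ℝ (fun w => (f w u) r) z - fderiv ℝ (fun w => (f w u) r) x‖ ≤
        |H| * ‖z - x‖ := fun z =>
      convex_univ.norm_image_sub_le_of_norm_fderiv_le (fun w _ => hd2 w)
        (fun w _ => (hH r w u).trans (le_abs_self H)) (mem_univ x) (mem_univ z)
    -- Second use of the mean value inequality, on the ball of radius `‖e‖`, where the derivative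
    -- differs from its value at `x` by at most `|H| * ‖e‖`.
    have h2 := (convex_closedBall x ‖e‖).norm_image_sub_le_of_norm_hasFDerivWithin_le'
      (f := fun w => (f w u) r) (φ := fderiv ℝ (fun w => (f w u) r) x) (C := |H| * ‖e‖)
      (fun z _ => (hd z).hasFDerivAt.hasFDerivWithinAt)
      (fun z hz => (h1 z).trans (mul_le_mul_of_nonneg_left (by simpa [dist_eq_norm] using hz)
        (abs_nonneg H)))
      (Metric.mem_closedBall_self (norm_nonneg e))
      (show x + e ∈ Metric.closedBall x ‖e‖ by simp)
    have h3 : fderiv ℝ (fun w => (f w u) r) x e =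
        (fderiv ℝ (fun z => f z u) x e) r := by
      have := ((EuclideanSpace.proj r : EuclideanSpace ℝ ι →L[ℝ] ℝ).hasFDerivAt.comp x
        ((hf u).differentiable (by norm_num) x).hasFDerivAt).fderiv
      exact congrArg (fun L : EuclideanSpace ℝ ι →L[ℝ] ℝ => L e) this
    simp only [add_sub_cancel_left] at h2
    rw [Real.norm_eq_abs, h3] at h2
    have h4 : taylorRemainder f e x u r =
        f (x + e) u r - f x u r - (fderiv ℝ (fun z => f z u) x e) r := by
      rw [taylorRemainder, toEuclideanLin_jacobian]; rfl
    rw [h4]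
    exact h2.trans_eq (by ring)
  have hsum : ‖taylorRemainder f e x u‖ ≤ ∑ r, |taylorRemainder f e x u r| := by
    have : taylorRemainder f e x u =
        ∑ r, taylorRemainder f e x u r • EuclideanSpace.single r (1 : ℝ) := by
      ext i
      simp [Finset.sum_apply, Pi.single_apply]
    conv_lhs => rw [this]
    refine (norm_sum_le _ _).trans (Finset.sum_le_sum fun r _ => ?_)
    rw [norm_smul]; simp
  refine hsum.trans ((Finset.sum_le_sum fun r _ => hcomp r).trans ?_)
  rw [Finset.sum_const, Finset.card_univ, nsmul_eq_mul]
  nlinarith [sq_nonneg ‖e‖]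

end Field

/-! ### The canonical form -/

section Canonical

variable {p m : ℕ} {l : Fin p → ℕ}
  {fbar : EuclideanSpace ℝ (StateIndex l) → EuclideanSpace ℝ (Fin m) →
      EuclideanSpace ℝ (StateIndex l)}

theorem contDiff_canonicalField (hsmooth : ContDiff ℝ 2
      (fun q : EuclideanSpace ℝ (StateIndex l) × EuclideanSpace ℝ (Fin m) => fbar q.1 q.2)) :
    ContDiff ℝ 2 (fun q : EuclideanSpace ℝ (StateIndex l) × EuclideanSpace ℝ (Fin m) =>
      canonicalField l fbar q.1 q.2) :=
  (contDiff_toEuclideanLin contDiff_const contDiff_fst).add hsmooth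

theorem contDiff_slice (hsmooth : ContDiff ℝ 2
      (fun q : EuclideanSpace ℝ (StateIndex l) × EuclideanSpace ℝ (Fin m) => fbar q.1 q.2)) (u) :
    ContDiff ℝ 2 (fun z => fbar z u) :=
  hsmooth.comp (contDiff_id.prodMk contDiff_const)

theorem fderiv_canonicalField (hsmooth : ContDiff ℝ 2
      (fun q : EuclideanSpace ℝ (StateIndex l) × EuclideanSpace ℝ (Fin m) => fbar q.1 q.2)) (x u e) :
    fderiv ℝ (fun z => canonicalField l fbar z u) x e =
      Matrix.toEuclideanLin (Abar l) e + fderiv ℝ (fun z => fbar z u) x e := by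
  have h1 := ((Matrix.toEuclideanLin (Abar l)).toContinuousLinearMap).hasFDerivAt (x := x)
  have h2 := ((contDiff_slice hsmooth u).differentiable (by norm_num) x).hasFDerivAt
  have h3 := (h1.add h2).fderiv
  exact congrArg (fun L : EuclideanSpace ℝ (StateIndex l) →L[ℝ] _ => L e) h3

theorem jacobian_canonicalField (hsmooth : ContDiff ℝ 2
      (fun q : EuclideanSpace ℝ (StateIndex l) × EuclideanSpace ℝ (Fin m) => fbar q.1 q.2)) (x u) :
    jacobian (canonicalField l fbar) x u = Abar l + jacobian fbar x u := by
  ext r s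
  rw [Matrix.add_apply, jacobian, Matrix.of_apply, fderiv_canonicalField hsmooth]
  simp [jacobian, Matrix.toLpLin_apply]

theorem taylorRemainder_canonicalField (hsmooth : ContDiff ℝ 2
      (fun q : EuclideanSpace ℝ (StateIndex l) × EuclideanSpace ℝ (Fin m) => fbar q.1 q.2))
    (e x u) : taylorRemainder (canonicalField l fbar) e x u = taylorRemainder fbar e x u := by
  simp only [taylorRemainder, toEuclideanLin_jacobian, fderiv_canonicalField hsmooth]
  simp only [canonicalField, map_add]
  abel

theorem norm_jacobian_fbar_le {Lam : NNReal}
    (hlip : ∀ u : EuclideanSpace ℝ (Fin m), LipschitzWith Lam (fun x => fbar x u)) (x u) :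
    ‖jacobian fbar x u‖ ≤ Lam :=
  (norm_jacobian_le _ _ _).trans (norm_fderiv_le_of_lipschitz ℝ (hlip u))

theorem norm_canonicalField_sub_le {Lam : NNReal}
    (hlip : ∀ u : EuclideanSpace ℝ (Fin m), LipschitzWith Lam (fun x => fbar x u)) (x z u) :
    ‖canonicalField l fbar x u - canonicalField l fbar z u‖ ≤ (‖Abar l‖ + Lam) * ‖x - z‖ := by
  have h1 := norm_toEuclideanLin_le (Abar l) (x - z)
  have h2 := (hlip u).norm_sub_le x z
  have e : canonicalField l fbar x u - canonicalField l fbar z u =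
      Matrix.toEuclideanLin (Abar l) (x - z) + (fbar x u - fbar z u) := by
    simp only [canonicalField, map_sub]; abel
  rw [e]
  refine (norm_add_le _ _).trans ?_
  linarith

/-- Uniform two-sided bounds on the solution of the Riccati equation of the observer. -/
theorem exists_riccati_bounds (l : Fin p → ℕ) {k : ℕ} (α Lam g₁ g₂ : ℝ)
    {P₀ : Matrix (Fin k) (Fin k) ℝ} (hP₀ : P₀.PosDef) (hg₁ : 0 < g₁) (hg : g₁ ≤ g₂) :
    ∃ p₁ p₂ : ℝ, 0 < p₁ ∧ 0 < p₂ ∧ ∀ (T : ℝ) (A : ℝ → Matrix (StateIndex l) (StateIndex l) ℝ)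
      (G P : ℝ → Matrix (Fin k) (Fin k) ℝ) (Q : ℝ → Matrix (StateIndex l) (Fin k) ℝ), 0 ≤ T →
      ReducedTrajectory T α g₁ g₂ A (Cbar l) G P Q → P 0 = P₀ →
      (∀ t ∈ Ioo 0 T, ∃ F : Matrix (StateIndex l) (StateIndex l) ℝ, A t = Abar l + F ∧
        (∀ r s, |F r s| ≤ Lam) ∧ ∀ r s, (r.2 : ℕ) < (s.2 : ℕ) → F r s = 0) →
      ∀ t ∈ Icc 0 T, (P t)ᵀ = P t ∧ ∀ x, p₁ * (x ⬝ᵥ x) ≤ x ⬝ᵥ P t *ᵥ x ∧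
        x ⬝ᵥ P t *ᵥ x ≤ p₂ * (x ⬝ᵥ x) := by
  obtain ⟨p₀, hp₀, hp₀'⟩ := exists_quad_ge_of_posDef hP₀
  obtain ⟨cB, hcB, hB⟩ := exists_norm_reducedB_le (ι := StateIndex l) k
  obtain ⟨S, b, c, γ, hb, hc, hγ, hS, hSb, hobs⟩ := exists_observability_form l Lam
  obtain ⟨D, hD⟩ : ∃ D, D = 2 * (cB * |α|) + ‖Cbar l‖ ^ 2 + 1 := ⟨_, rfl⟩
  have hD0 : 0 < D := by rw [hD]; positivity
  -- Since `q ≤ 1` gives `q ^ 2 ≤ q`, the quadratic condition of `lower_bound` reduces to the linear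
  -- one `q * D ≤ g₁`.
  obtain ⟨q, hq⟩ : ∃ q, q = min p₀ (min 1 (g₁ / D)) := ⟨_, rfl⟩
  have hq0 : 0 < q := by rw [hq]; positivity
  have hq1 : q ≤ 1 := hq ▸ (min_le_right _ _).trans (min_le_left _ _)
  have hqp : q ≤ p₀ := hq ▸ min_le_left _ _
  have hqD : q * D ≤ g₁ := by
    rw [← le_div_iff₀ hD0]; exact hq ▸ (min_le_right _ _).trans (min_le_right _ _)
  have hg₂ : 0 ≤ g₂ := hg₁.le.trans hg
  -- The first three summands each meet one condition of `upper_bound`; the last makes `β` positive.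
  obtain ⟨β, hβ⟩ : ∃ β, β = c + g₂ * ‖S‖ ^ 2 / γ + ‖P₀‖ * (‖S‖ + 1) + 1 := ⟨_, rfl⟩
  have e1 : 0 ≤ g₂ * ‖S‖ ^ 2 / γ := by positivity
  have e2 : 0 ≤ ‖P₀‖ * (‖S‖ + 1) := by positivity
  have hβ0 : 0 < β := by linarith
  refine ⟨q, β / b, hq0, by positivity, fun T A G P Q hT h hP hF t ht => ⟨h.symm t ht, fun x => ?_⟩⟩
  constructor
  · refine h.lower_bound (c := cB * |α|) hq0.le (fun t ht => ?_) ?_ (fun x => ?_) t ht x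
    · refine (hB _ _ (h.orthonormal t (Ioo_subset_Icc_self ht))).trans ?_
      exact mul_le_mul_of_nonneg_left ((h.norm_le t ht).trans (le_abs_self α)) hcB
    · have h1 : q ^ 2 * ‖Cbar l‖ ^ 2 ≤ q * ‖Cbar l‖ ^ 2 :=
        mul_le_mul_of_nonneg_right (by nlinarith) (sq_nonneg _)
      rw [hD] at hqD
      nlinarith
    · rw [hP]
      exact (mul_le_mul_of_nonneg_right hqp (dotProduct_self_nonneg' x)).trans (hp₀' x)
  · refine h.upper_bound hb hS hSb (c := c) (γ := γ) (fun t ht z => ?_) hβ0 (by linarith) hg₂ ?_ ?_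
      hT t ht x
    · obtain ⟨F, hA, h1, h2⟩ := hF t ht
      rw [hA]
      exact hobs F h1 h2 z
    · have : g₂ * ‖S‖ ^ 2 = γ * (g₂ * ‖S‖ ^ 2 / γ) := by field_simp
      rw [this]
      exact mul_le_mul_of_nonneg_left (by linarith) hγ.le
    · rw [hP]; linarith

end Canonical

/-! ### Trajectories of the observer -/

section Trajectory

theorem posSemidef_sub_smul_one_iff {n : Type*} [Fintype n] [DecidableEq n] {M : Matrix n n ℝ}
    {g : ℝ} : (M - g • (1 : Matrix n n ℝ)).PosSemidef ↔
      Mᵀ = M ∧ ∀ x, g * (x ⬝ᵥ x) ≤ x ⬝ᵥ M *ᵥ x := by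
  rw [Matrix.posSemidef_iff_dotProduct_mulVec, Matrix.IsHermitian,
    Matrix.conjTranspose_eq_transpose_of_trivial]
  simp only [Matrix.transpose_sub, Matrix.transpose_smul, Matrix.transpose_one, sub_left_inj,
    star_trivial, Matrix.sub_mulVec, dotProduct_sub, quad_smul_one, sub_nonneg]

theorem posSemidef_smul_one_sub_iff {n : Type*} [Fintype n] [DecidableEq n] {M : Matrix n n ℝ}
    {g : ℝ} : (g • (1 : Matrix n n ℝ) - M).PosSemidef ↔
      Mᵀ = M ∧ ∀ x, x ⬝ᵥ M *ᵥ x ≤ g * (x ⬝ᵥ x) := by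
  rw [Matrix.posSemidef_iff_dotProduct_mulVec, Matrix.IsHermitian,
    Matrix.conjTranspose_eq_transpose_of_trivial]
  simp only [Matrix.transpose_sub, Matrix.transpose_smul, Matrix.transpose_one, sub_right_inj,
    star_trivial, Matrix.sub_mulVec, dotProduct_sub, quad_smul_one, sub_nonneg]

theorem PDeriv.fst {E F : Type*} [NormedAddCommGroup E] [NormedSpace ℝ E] [NormedAddCommGroup F]
    [NormedSpace ℝ F] {a b : ℝ} {f f' : ℝ → E × F} (h : PDeriv a b f f') :
    PDeriv a b (fun t => (f t).1) (fun t => (f' t).1) := h.clm (ContinuousLinearMap.fst ℝ E F)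

theorem PDeriv.snd {E F : Type*} [NormedAddCommGroup E] [NormedSpace ℝ E] [NormedAddCommGroup F]
    [NormedSpace ℝ F] {a b : ℝ} {f f' : ℝ → E × F} (h : PDeriv a b f f') :
    PDeriv a b (fun t => (f t).2) (fun t => (f' t).2) := h.clm (ContinuousLinearMap.snd ℝ E F)

theorem pDeriv_observerField {ι κ V : Type*} [Fintype ι] [DecidableEq ι] [Fintype κ]
    [DecidableEq κ] {k : ℕ} {f : EuclideanSpace ℝ ι → V → EuclideanSpace ℝ ι} {C : Matrix κ ι ℝ}
    {u : ℝ → V} {y : ℝ → EuclideanSpace ℝ κ} {G : ℝ → Matrix (Fin k) (Fin k) ℝ} {a b : ℝ}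
    {z : ℝ → EuclideanSpace ℝ ι × Matrix (Fin k) (Fin k) ℝ × Matrix ι (Fin k) ℝ}
    (hz : PDeriv a b z (fun t => observerField f C ((u t, y t, G t), z t))) :
    PDeriv a b (fun t => (z t).1) (fun t => f (z t).1 (u t) + Matrix.toEuclideanLin
      (gain C (z t).2.1 (z t).2.2) (y t - Matrix.toEuclideanLin C (z t).1)) ∧
    PDeriv a b (fun t => (z t).2.1) (fun t =>
      reducedB (jacobian f (z t).1 (u t)) (z t).2.2 * (z t).2.1
        + (z t).2.1 * (reducedB (jacobian f (z t).1 (u t)) (z t).2.2)ᵀ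
        - (z t).2.1 * (C * (z t).2.2)ᵀ * (C * (z t).2.2) * (z t).2.1 + G t) ∧
    PDeriv a b (fun t => (z t).2.2) (fun t =>
      (1 - (z t).2.2 * ((z t).2.2)ᵀ) * jacobian f (z t).1 (u t) * (z t).2.2
        + (z t).2.2 * skewPart (jacobian f (z t).1 (u t)) (z t).2.2) := by
  have h1 := hz.fst
  have h2 := hz.snd.fst
  have h3 := hz.snd.snd
  simp only [observerField] at h1 h2 h3
  exact ⟨h1, h2, h3⟩

variable {p m : ℕ} {l : Fin p → ℕ}
  {fbar : EuclideanSpace ℝ (StateIndex l) → EuclideanSpace ℝ (Fin m) →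
      EuclideanSpace ℝ (StateIndex l)}

theorem norm_jacobian_canonicalField_le (hsmooth : ContDiff ℝ 2
      (fun q : EuclideanSpace ℝ (StateIndex l) × EuclideanSpace ℝ (Fin m) => fbar q.1 q.2))
    {Lam : NNReal} (hlip : ∀ u : EuclideanSpace ℝ (Fin m), LipschitzWith Lam (fun x => fbar x u))
    (x u) : ‖jacobian (canonicalField l fbar) x u‖ ≤ ‖Abar l‖ + Lam := by
  rw [jacobian_canonicalField hsmooth]
  exact (norm_add_le _ _).trans (add_le_add le_rfl (norm_jacobian_fbar_le hlip x u))

theorem exists_jacobian_canonicalField_eq (hsmooth : ContDiff ℝ 2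
      (fun q : EuclideanSpace ℝ (StateIndex l) × EuclideanSpace ℝ (Fin m) => fbar q.1 q.2))
    {Lam : NNReal} (hlip : ∀ u : EuclideanSpace ℝ (Fin m), LipschitzWith Lam (fun x => fbar x u))
    (htri : ∀ (x : EuclideanSpace ℝ (StateIndex l)) (u : EuclideanSpace ℝ (Fin m))
      (r s : StateIndex l), (r.2 : ℕ) < (s.2 : ℕ) → jacobian fbar x u r s = 0) (x u) :
    ∃ F : Matrix (StateIndex l) (StateIndex l) ℝ,
      jacobian (canonicalField l fbar) x u = Abar l + F ∧
        (∀ r s, |F r s| ≤ Lam) ∧ ∀ r s, (r.2 : ℕ) < (s.2 : ℕ) → F r s = 0 :=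
  ⟨jacobian fbar x u, jacobian_canonicalField hsmooth x u,
    fun _ _ => (abs_entry_le_norm _ _ _).trans (norm_jacobian_fbar_le hlip x u), htri x u⟩

/-- With the gain bounded by `p₂ * ‖C̄‖`, the observer field grows at most affinely in `x̂`, and
linear growth excludes blow-up. -/
theorem norm_stateEstimate_le {Lam : NNReal}
    (hlip : ∀ u : EuclideanSpace ℝ (Fin m), LipschitzWith Lam (fun x => fbar x u))
    {k : ℕ} {p₂ b My Mf : ℝ} (hp₂ : 0 < p₂) (hb : 0 ≤ b) (hMy0 : 0 ≤ My) (hMf0 : 0 ≤ Mf)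
    {u : ℝ → EuclideanSpace ℝ (Fin m)} {y : ℝ → EuclideanSpace ℝ (Fin p)}
    {xh : ℝ → EuclideanSpace ℝ (StateIndex l)} {P : ℝ → Matrix (Fin k) (Fin k) ℝ}
    {Q : ℝ → Matrix (StateIndex l) (Fin k) ℝ} (hMy : ∀ t ∈ Icc 0 b, ‖y t‖ ≤ My)
    (hMf : ∀ t ∈ Icc 0 b, ‖canonicalField l fbar 0 (u t)‖ ≤ Mf)
    (hQ : ∀ t ∈ Icc 0 b, (Q t)ᵀ * Q t = 1) (hP : ∀ t ∈ Icc 0 b, ‖P t‖ ≤ p₂)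
    (hx : PDeriv 0 b xh (fun t => canonicalField l fbar (xh t) (u t) + Matrix.toEuclideanLin
      (gain (Cbar l) (P t) (Q t)) (y t - Matrix.toEuclideanLin (Cbar l) (xh t)))) :
    ‖xh b‖ ≤ max ‖xh 0‖ 1 * Real.exp
      ((‖Abar l‖ + Lam + p₂ * ‖Cbar l‖ * ‖Cbar l‖ + (Mf + p₂ * ‖Cbar l‖ * My)) * b) := by
  have hg := hx.norm_le_of_linear_growth (K := ‖Abar l‖ + Lam + p₂ * ‖Cbar l‖ * ‖Cbar l‖)
    (ε := Mf + p₂ * ‖Cbar l‖ * My) hb (by positivity) (by positivity) (fun t ht => by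
      have htI := Ioo_subset_Icc_self ht
      have n1 := norm_canonicalField_sub_le (l := l) hlip (xh t) 0 (u t)
      rw [sub_zero] at n1
      have n2 := hMf t htI
      have n3 : ‖canonicalField l fbar (xh t) (u t)‖ ≤ (‖Abar l‖ + Lam) * ‖xh t‖ + Mf := by
        have := norm_sub_norm_le (canonicalField l fbar (xh t) (u t)) (canonicalField l fbar 0 (u t))
        linarith
      have n4 := norm_gain_le (C := Cbar l) (hQ t htI) (hP t htI)
      have n5 := norm_toEuclideanLin_le (gain (Cbar l) (P t) (Q t))
        (y t - Matrix.toEuclideanLin (Cbar l) (xh t))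
      have n6 := norm_toEuclideanLin_le (Cbar l) (xh t)
      have n7 : ‖y t - Matrix.toEuclideanLin (Cbar l) (xh t)‖ ≤ My + ‖Cbar l‖ * ‖xh t‖ :=
        (norm_sub_le _ _).trans (add_le_add (hMy t htI) n6)
      have n8 : ‖gain (Cbar l) (P t) (Q t)‖ *
          ‖y t - Matrix.toEuclideanLin (Cbar l) (xh t)‖ ≤
          p₂ * ‖Cbar l‖ * (My + ‖Cbar l‖ * ‖xh t‖) :=
        mul_le_mul n4 n7 (norm_nonneg _) (by positivity)
      refine (norm_add_le _ _).trans ?_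
      linarith)
  rwa [sub_zero] at hg

/-- Global existence of a trajectory of the observer. -/
theorem exists_isObserverTrajectory (hsmooth : ContDiff ℝ 2
      (fun q : EuclideanSpace ℝ (StateIndex l) × EuclideanSpace ℝ (Fin m) => fbar q.1 q.2))
    {Lam : NNReal} (hlip : ∀ u : EuclideanSpace ℝ (Fin m), LipschitzWith Lam (fun x => fbar x u))
    {k : ℕ} {P₀ : Matrix (Fin k) (Fin k) ℝ} {g₁ g₂ p₂ : ℝ} (hp₂ : 0 < p₂)
    {G : ℝ → Matrix (Fin k) (Fin k) ℝ} {u : ℝ → EuclideanSpace ℝ (Fin m)}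
    {y : ℝ → EuclideanSpace ℝ (Fin p)} (hGc : PiecewiseContinuous G) (hu : PiecewiseContinuous u)
    (hy : PiecewiseContinuous y)
    (hred : ∀ (T : ℝ) (xh : ℝ → EuclideanSpace ℝ (StateIndex l)) (P : ℝ → Matrix (Fin k) (Fin k) ℝ)
      (Q : ℝ → Matrix (StateIndex l) (Fin k) ℝ), 0 ≤ T → P 0 = P₀ →
      PDeriv 0 T P (fun t => reducedB (jacobian (canonicalField l fbar) (xh t) (u t)) (Q t) * P t
        + P t * (reducedB (jacobian (canonicalField l fbar) (xh t) (u t)) (Q t))ᵀ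
        - P t * (Cbar l * Q t)ᵀ * (Cbar l * Q t) * P t + G t) →
      PDeriv 0 T Q (fun t => (1 - Q t * (Q t)ᵀ) * jacobian (canonicalField l fbar) (xh t) (u t)
        * Q t + Q t * skewPart (jacobian (canonicalField l fbar) (xh t) (u t)) (Q t)) →
      (Q 0)ᵀ * Q 0 = 1 →
      ReducedTrajectory T (‖Abar l‖ + Lam) g₁ g₂
        (fun t => jacobian (canonicalField l fbar) (xh t) (u t)) (Cbar l) G P Q ∧
      ∀ t ∈ Icc 0 T, ‖P t‖ ≤ p₂)
    (xh₀ : EuclideanSpace ℝ (StateIndex l)) {Q₀ : Matrix (StateIndex l) (Fin k) ℝ}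
    (hQ₀ : Q₀ᵀ * Q₀ = 1) :
    ∃ (xh : ℝ → EuclideanSpace ℝ (StateIndex l)) (P : ℝ → Matrix (Fin k) (Fin k) ℝ)
      (Q : ℝ → Matrix (StateIndex l) (Fin k) ℝ),
      IsObserverTrajectory (canonicalField l fbar) (Cbar l) u y G xh P Q ∧
        xh 0 = xh₀ ∧ P 0 = P₀ ∧ Q 0 = Q₀ := by
  have hf := contDiff_canonicalField hsmooth
  obtain ⟨z, hz, hz0⟩ := exists_solvesFrom (Φ := observerField (k := k) (canonicalField l fbar)
    (Cbar l)) (contDiff_observerField _ hf) (hu.prodMk (hy.prodMk hGc)) le_rfl (xh₀, P₀, Q₀) (by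
    intro T hT
    obtain ⟨My, hMy0, hMy⟩ := hy.exists_bound T
    have hc : Continuous fun v : EuclideanSpace ℝ (Fin m) =>
        ((0 : EuclideanSpace ℝ (StateIndex l)), v) := by fun_prop
    have hf0 := hu.comp (hf.continuous.comp hc)
    simp only [Function.comp_apply] at hf0
    obtain ⟨Mf, hMf0, hMf⟩ := hf0.exists_bound T
    -- The bounds on `P` and `Q` do not involve the size of `x̂`, because the Jacobian is bounded
    -- globally. They come first and then control `x̂`.
    refine ⟨max (max ‖xh₀‖ 1 * Real.exp
      ((‖Abar l‖ + Lam + p₂ * ‖Cbar l‖ * ‖Cbar l‖ + (Mf + p₂ * ‖Cbar l‖ * My)) * T))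
      (max p₂ 1), fun b hb z hz hz0 => ?_⟩
    obtain ⟨hx, hP, hQ⟩ := pDeriv_observerField hz
    obtain ⟨hr, hPn⟩ := hred b (fun t => (z t).1) (fun t => (z t).2.1) (fun t => (z t).2.2) hb.1
      (by rw [hz0]) hP hQ (by rw [hz0]; exact hQ₀)
    have hbI := right_mem_Icc.2 hb.1
    have hg := norm_stateEstimate_le hlip hp₂ hb.1 hMy0 hMf0
      (fun t ht => hMy t ⟨ht.1, ht.2.trans hb.2⟩) (fun t ht => hMf t ⟨ht.1, ht.2.trans hb.2⟩)
      hr.orthonormal hPn hx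
    simp only [hz0] at hg
    have hexp : Real.exp ((‖Abar l‖ + Lam + p₂ * ‖Cbar l‖ * ‖Cbar l‖ + (Mf + p₂ * ‖Cbar l‖ * My)) * b)
        ≤ Real.exp ((‖Abar l‖ + Lam + p₂ * ‖Cbar l‖ * ‖Cbar l‖ + (Mf + p₂ * ‖Cbar l‖ * My)) * T) :=
      Real.exp_le_exp.2 (mul_le_mul_of_nonneg_left hb.2 (by positivity))
    refine norm_prod_le_iff.2 ⟨(hg.trans (mul_le_mul_of_nonneg_left hexp (by positivity))).trans
      (le_max_left _ _), norm_prod_le_iff.2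
      ⟨((hPn b hbI).trans (le_max_left _ _)).trans (le_max_right _ _),
        ((norm_le_one_of_orthonormal (hr.orthonormal b hbI)).trans
        (le_max_right _ _)).trans (le_max_right _ _)⟩⟩)
  refine ⟨fun t => (z t).1, fun t => (z t).2.1, fun t => (z t).2.2, ⟨?_, ?_, ?_⟩, ?_, ?_, ?_⟩
  · exact SolvesFrom.of_pDeriv fun T => (pDeriv_observerField (hz.pDeriv le_rfl T)).1
  · exact SolvesFrom.of_pDeriv fun T => (pDeriv_observerField (hz.pDeriv le_rfl T)).2.1
  · exact SolvesFrom.of_pDeriv fun T => (pDeriv_observerField (hz.pDeriv le_rfl T)).2.2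
  · simp only [hz0]
  · simp only [hz0]
  · simp only [hz0]

end Trajectory

/-! ### Bohl exponents and Lyapunov functions -/

section Bohl

/-- The limit superior is negative, so one fixed window length `H` has uniformly negative averages
for all late starting times. -/
theorem exists_of_upperBohl_neg {b : ℝ → ℝ} (h : upperBohl b < 0) :
    ∃ δ H s₀ : ℝ, 0 < δ ∧ 0 < H ∧ 0 ≤ s₀ ∧ ∀ s, s₀ ≤ s → H⁻¹ * ∫ τ in s..(s + H), b τ ≤ -δ := by
  obtain ⟨c, hc, hc0⟩ := EReal.lt_iff_exists_real_btwn.1 h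
  have hev := eventually_lt_of_limsup_lt hc
  rw [prod_atTop_atTop_eq] at hev
  obtain ⟨⟨H₀, s₀⟩, hHs⟩ := eventually_atTop.1 hev
  have hc1 : c < 0 := by exact_mod_cast hc0
  refine ⟨-c, max H₀ 1, max s₀ 0, by linarith, by positivity, le_max_right _ _, fun s hs => ?_⟩
  have := hHs (max H₀ 1, s) ⟨le_max_left _ _, (le_max_left _ _).trans hs⟩
  rw [neg_neg]
  exact le_of_lt (by exact_mod_cast this)

/-- A scalar equation with a negative upper Bohl exponent has a bounded logarithmic Lyapunov
weight. -/
theorem exists_bohl_weight {b : ℝ → ℝ} (hb : PiecewiseContinuous b) {β : ℝ}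
    (hβ : ∀ t, 0 ≤ t → |b t| ≤ β) (h : upperBohl b < 0) :
    ∃ (φ φ' : ℝ → ℝ) (δ M : ℝ), 0 < δ ∧ 0 ≤ M ∧ (∀ t, 0 ≤ t → |φ t| ≤ M) ∧
      (∀ T, PDeriv 0 T φ φ') ∧ ∀ t, 0 ≤ t → φ' t + b t ≤ -δ := by
  obtain ⟨δ, H, s₀, hδ, hH, hs₀, hm⟩ := exists_of_upperBohl_neg h
  have hβ0 : 0 ≤ β := (abs_nonneg _).trans (hβ 0 le_rfl)
  let B : ℝ → ℝ := fun s => b (max s 0)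
  have hB : ∀ a c, IntervalIntegrable B MeasureTheory.volume a c := hb.intervalIntegrable_extend
  let I : ℝ → ℝ := fun t => ∫ s in (0 : ℝ)..t, B s
  have hIc : Continuous I := intervalIntegral.continuous_primitive hB 0
  let J : ℝ → ℝ := fun t => ∫ s in (0 : ℝ)..t, I s
  have hJ : ∀ t, HasDerivAt J (I t) t := fun t => hIc.integral_hasStrictDerivAt 0 t |>.hasDerivAt
  have hIsub : ∀ s t, I t - I s = ∫ τ in s..t, B τ := fun s t =>
    intervalIntegral.integral_interval_sub_left (hB _ _) (hB _ _)
  have hIb : ∀ s t, |I t - I s| ≤ β * |t - s| := fun s t => by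
    rw [hIsub, ← Real.norm_eq_abs]
    exact intervalIntegral.norm_integral_le_of_norm_le_const fun τ _ => hβ _ (le_max_right _ _)
  have hmean : ∀ t, 0 ≤ t → H⁻¹ * (I (t + H) - I t) = H⁻¹ * ∫ τ in t..(t + H), b τ := by
    intro t ht
    rw [hIsub]
    congr 1
    refine intervalIntegral.integral_congr fun τ hτ => ?_
    rw [uIcc_of_le (by linarith)] at hτ
    simp only [B, max_eq_left (ht.trans hτ.1)]
  -- The first part is the average of `I s - I t` over `s` in `[t, t + H]`, hence bounded by `β *
  -- H`. Its derivative replaces `-b` by `-b` plus the window average of `b`. The last term is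
  -- bounded too and compensates averages as large as `β` before time `s₀`.
  let φ : ℝ → ℝ := fun t => H⁻¹ * (J (t + H) - J t) - I t - (β + δ) * min t s₀
  let φ' : ℝ → ℝ := fun t => H⁻¹ * (I (t + H) - I t) - b t - (β + δ) * (if t < s₀ then 1 else 0)
  refine ⟨φ, φ', δ, β * H + (β + δ) * s₀, hδ, by positivity, fun t ht => ?_, fun T => ⟨?_, ?_⟩,
    fun t ht => ?_⟩
  · have h1 : J (t + H) - J t - H * I t = ∫ s in t..(t + H), (I s - I t) := by
      rw [intervalIntegral.integral_sub (hIc.intervalIntegrable _ _) (by simp),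
        intervalIntegral.integral_const]
      simp only [J]
      rw [intervalIntegral.integral_interval_sub_left (hIc.intervalIntegrable _ _)
        (hIc.intervalIntegrable _ _)]
      simp
    have h2 : |J (t + H) - J t - H * I t| ≤ β * H * |t + H - t| := by
      rw [h1, ← Real.norm_eq_abs]
      refine intervalIntegral.norm_integral_le_of_norm_le_const fun s hs => ?_
      rw [uIoc_of_le (by linarith)] at hs
      refine (hIb t s).trans (mul_le_mul_of_nonneg_left ?_ hβ0)
      rw [abs_of_pos (by linarith [hs.1])]
      linarith [hs.2]
    rw [add_sub_cancel_left, abs_of_pos hH] at h2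
    have h3 : H⁻¹ * (J (t + H) - J t) - I t = H⁻¹ * (J (t + H) - J t - H * I t) := by
      field_simp
    have h4 : |H⁻¹ * (J (t + H) - J t) - I t| ≤ β * H := by
      rw [h3, abs_mul, abs_of_pos (inv_pos.2 hH), inv_mul_le_iff₀ hH]
      linarith
    have h5 : |(β + δ) * min t s₀| ≤ (β + δ) * s₀ := by
      rw [abs_of_nonneg (mul_nonneg (by positivity) (le_min ht hs₀))]
      exact mul_le_mul_of_nonneg_left (min_le_right _ _) (by positivity)
    exact (abs_sub _ _).trans (add_le_add h4 h5)
  · have hJc : Continuous J := continuous_iff_continuousAt.2 fun t => (hJ t).continuousAt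
    exact Continuous.continuousOn (by fun_prop)
  · filter_upwards [hb.continuousAt_extend T, (finite_singleton s₀).compl_mem_cofinite]
      with t ht hts hm
    have ht0 := hm.1
    have hc := ht hm
    have hI : HasDerivAt I (b t) t := by
      have hmeas : StronglyMeasurableAtFilter B (𝓝 t) MeasureTheory.volume := by
        refine ⟨Ioc 0 T, Ioc_mem_nhds hm.1 hm.2, ?_⟩
        exact ((intervalIntegrable_iff_integrableOn_Ioc_of_le (hm.1.trans hm.2).le).1
          (hB 0 T)).aestronglyMeasurable
      have := intervalIntegral.integral_hasDerivAt_right (hB 0 t) hmeas hc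
      simpa only [B, max_eq_left ht0.le] using this
    have hJ2 : HasDerivAt (fun t => J (t + H)) (I (t + H)) t := (hJ (t + H)).comp_add_const t H
    have hmin : HasDerivAt (fun t => min t s₀) (if t < s₀ then 1 else 0) t := by
      rcases lt_or_gt_of_ne (show t ≠ s₀ from hts) with hlt | hgt
      · rw [if_pos hlt]
        refine (hasDerivAt_id t).congr_of_eventuallyEq ?_
        filter_upwards [Iio_mem_nhds hlt] with s hs using min_eq_left (le_of_lt hs)
      · rw [if_neg hgt.not_gt]
        refine (hasDerivAt_const t s₀).congr_of_eventuallyEq ?_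
        filter_upwards [Ioi_mem_nhds hgt] with s hs using min_eq_right (le_of_lt hs)
    exact (((hJ2.sub (hJ t)).const_mul H⁻¹).sub hI).sub (hmin.const_mul (β + δ))
  · simp only [φ']
    rw [hmean t ht]
    split_ifs with hlt
    · have h1 : H⁻¹ * ∫ τ in t..(t + H), b τ ≤ β := by
        rw [← hmean t ht, inv_mul_le_iff₀ hH]
        have := (abs_le.1 (hIb t (t + H))).2
        rw [add_sub_cancel_left, abs_of_pos hH] at this
        linarith
      linarith
    · have := hm t (not_lt.1 hlt)
      linarith

/-- Local exponential decay from a quadratic Lyapunov function. -/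
theorem exp_decay_of_lyapunov {E : Type*} [NormedAddCommGroup E] {c₀ c₁ c₂ c₃ a : ℝ}
    (hc₀ : 0 < c₀) (hc₁ : 0 < c₁) (hc₂ : 0 < c₂) (hc₃ : c₂ ≤ c₃) {e : ℝ → E}
    {V V' : ℝ → ℝ} (he : ∀ T, ContinuousOn e (Icc a T)) (hV : ∀ T, PDeriv a T V V')
    (hl : ∀ t, a ≤ t → c₂ * ‖e t‖ ^ 2 ≤ V t) (hu : ∀ t, a ≤ t → V t ≤ c₃ * ‖e t‖ ^ 2)
    (hV' : ∀ t, a < t → V' t ≤ -c₀ * ‖e t‖ ^ 2 + c₁ * ‖e t‖ ^ 3)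
    (h0 : ‖e a‖ ≤ c₀ / (4 * c₁ * √(c₃ / c₂))) :
    ∀ t, a ≤ t → ‖e t‖ ≤ √(c₃ / c₂) * Real.exp (-(c₀ / (4 * c₃)) * (t - a)) * ‖e a‖ := by
  have hc₃0 : 0 < c₃ := hc₂.trans_le hc₃
  obtain ⟨K, hK⟩ : ∃ K, K = √(c₃ / c₂) := ⟨_, rfl⟩
  have hK0 : 0 < K := by rw [hK]; positivity
  have hK2 : K ^ 2 = c₃ / c₂ := by rw [hK, Real.sq_sqrt (by positivity)]
  rw [← hK] at h0 ⊢
  -- Below this threshold the cubic term uses at most half of the dissipation, so `V` decays at rate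
  -- `c₀ / (2 * c₃)` and the norm at half that rate.
  have step : ∀ t, a ≤ t → (∀ s ∈ Ioo a t, ‖e s‖ ≤ c₀ / (2 * c₁)) →
      ‖e t‖ ≤ K * Real.exp (-(c₀ / (4 * c₃)) * (t - a)) * ‖e a‖ := by
    intro t ht hs
    have h1 := (hV t).le_mul_exp (c := -(c₀ / (2 * c₃))) ht (fun s hsI => by
      have h2 := hV' s hsI.1
      have h3 := hs s hsI
      rw [le_div_iff₀ (by positivity)] at h3
      have h4 := hu s hsI.1.le
      have h5 : c₁ * ‖e s‖ ^ 3 ≤ c₀ / 2 * ‖e s‖ ^ 2 := by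
        have := mul_le_mul_of_nonneg_right h3 (sq_nonneg ‖e s‖)
        nlinarith
      have h6 : c₀ / (2 * c₃) * V s ≤ c₀ / 2 * ‖e s‖ ^ 2 := by
        calc c₀ / (2 * c₃) * V s ≤ c₀ / (2 * c₃) * (c₃ * ‖e s‖ ^ 2) := by gcongr
          _ = c₀ / 2 * ‖e s‖ ^ 2 := by field_simp
      linarith)
    have h2 := hl t ht
    have h3 := hu a le_rfl
    have hex : Real.exp (-(c₀ / (2 * c₃)) * (t - a)) =
        Real.exp (-(c₀ / (4 * c₃)) * (t - a)) ^ 2 := by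
      rw [← Real.exp_nat_mul]
      congr 1
      push_cast
      field_simp
      ring
    refine (sq_le_sq₀ (norm_nonneg _) (by positivity)).1 ?_
    rw [mul_pow, mul_pow, hK2, ← hex]
    have h4 := mul_le_mul_of_nonneg_right h3 (Real.exp_pos (-(c₀ / (2 * c₃)) * (t - a))).le
    rw [div_mul_eq_mul_div, div_mul_eq_mul_div, le_div_iff₀ hc₂]
    linarith
  intro t ht
  refine step t ht ?_
  by_contra hcon
  push Not at hcon
  obtain ⟨s, hs, hs'⟩ := hcon
  let S : Set ℝ := Icc a t ∩ (fun t => ‖e t‖) ⁻¹' Ici (c₀ / (2 * c₁))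
  have hS : IsCompact S := isCompact_Icc.of_isClosed_subset
    ((he t).norm.preimage_isClosed_of_isClosed isClosed_Icc isClosed_Ici) inter_subset_left
  obtain ⟨⟨h1, h2⟩, h3⟩ := hS.isLeast_sInf ⟨s, Ioo_subset_Icc_self hs, hs'.le⟩
  -- At the first time the threshold is reached, decay still holds and gives at most half the
  -- threshold, by the choice of the initial radius.
  have h4 := step (sInf S) h1.1 fun τ hτ => by
    by_contra hτ'
    exact hτ.2.not_ge (h3 ⟨⟨hτ.1.le, hτ.2.le.trans h1.2⟩, (not_le.1 hτ').le⟩)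
  have h5 : c₀ / (2 * c₁) ≤ ‖e (sInf S)‖ := h2
  have h6 : Real.exp (-(c₀ / (4 * c₃)) * (sInf S - a)) ≤ 1 := by
    rw [Real.exp_le_one_iff]
    have : 0 ≤ c₀ / (4 * c₃) := by positivity
    nlinarith [h1.1]
  have h7 : K * Real.exp (-(c₀ / (4 * c₃)) * (sInf S - a)) * ‖e a‖ ≤ K * 1 * (c₀ / (4 * c₁ * K)) := by
    gcongr
  have h8 : K * 1 * (c₀ / (4 * c₁ * K)) = c₀ / (2 * c₁) / 2 := by field_simp; norm_num
  have h9 : 0 < c₀ / (2 * c₁) := by positivity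
  linarith

/-- Domination of the coupling terms of a triangular system by geometric weights. -/
theorem sum_geometric_weights_le {n : ℕ} {s : Finset (Fin n)} (hs : ∀ i ∈ s, Finset.Ioi i ⊆ s)
    {θ d K : ℝ} (hθ : 1 ≤ θ) (hK : 0 ≤ K) (hd : 2 * (K * n) ≤ d * θ) {x : Fin n → ℝ}
    (hx : ∀ i, 0 ≤ x i) :
    ∑ i ∈ s, θ ^ (i : ℕ) * (-d * x i + K * ∑ j ∈ Finset.Ioi i, x j) ≤
      -(d / 2) * ∑ i ∈ s, θ ^ (i : ℕ) * x i := by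
  have hθ0 : 0 < θ := by linarith
  obtain ⟨W, hW⟩ : ∃ W, W = ∑ i ∈ s, θ ^ (i : ℕ) * x i := ⟨_, rfl⟩
  have hW0 : 0 ≤ W := hW ▸ Finset.sum_nonneg fun i _ => mul_nonneg (by positivity) (hx i)
  have h1 : ∀ i ∈ s, θ ^ (i : ℕ) * ∑ j ∈ Finset.Ioi i, x j ≤ θ⁻¹ * W := by
    intro i hi
    rw [hW, Finset.mul_sum, Finset.mul_sum]
    refine (Finset.sum_le_sum fun j hj => ?_).trans
      (Finset.sum_le_sum_of_subset_of_nonneg (f := fun j : Fin n => θ⁻¹ * (θ ^ (j : ℕ) * x j)) (hs i hi)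
        fun j _ _ => mul_nonneg (by positivity) (mul_nonneg (by positivity) (hx j)))
    have hij : (i : ℕ) + 1 ≤ (j : ℕ) := Finset.mem_Ioi.1 hj
    have h2 : θ ^ ((i : ℕ) + 1) ≤ θ ^ (j : ℕ) := pow_le_pow_right₀ hθ hij
    rw [pow_succ] at h2
    -- Row `i` involves only coordinates `j > i`, whose weights are larger by at least one factor
    -- `θ`.
    have h3 : θ ^ (i : ℕ) ≤ θ⁻¹ * θ ^ (j : ℕ) := by
      rw [le_inv_mul_iff₀ hθ0]; linarith
    calc θ ^ (i : ℕ) * x j ≤ θ⁻¹ * θ ^ (j : ℕ) * x j := mul_le_mul_of_nonneg_right h3 (hx j)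
      _ = _ := by ring
  have h2 : ∑ i ∈ s, θ ^ (i : ℕ) * (-d * x i + K * ∑ j ∈ Finset.Ioi i, x j) ≤
      -d * W + n * (K * (θ⁻¹ * W)) := by
    have e : ∀ i : Fin n, θ ^ (i : ℕ) * (-d * x i + K * ∑ j ∈ Finset.Ioi i, x j) =
      -d * (θ ^ (i : ℕ) * x i) + K * (θ ^ (i : ℕ) * ∑ j ∈ Finset.Ioi i, x j) := fun i => by ring
    simp only [e]
    rw [Finset.sum_add_distrib, ← Finset.mul_sum, ← hW]
    refine add_le_add le_rfl ((Finset.sum_le_sum fun i hi =>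
      mul_le_mul_of_nonneg_left (h1 i hi) hK).trans ?_)
    rw [Finset.sum_const, nsmul_eq_mul]
    have hcard : (s.card : ℝ) ≤ n := by
      have := s.card_le_univ
      rw [Fintype.card_fin] at this
      exact_mod_cast this
    exact mul_le_mul_of_nonneg_right hcard (by positivity)
  rw [← hW]
  refine h2.trans ?_
  have h3 : K * n * θ⁻¹ ≤ d / 2 := by
    rw [mul_inv_le_iff₀ hθ0]; linarith
  have h4 := mul_le_mul_of_nonneg_right h3 hW0
  linarith

end Bohl

/-! ### Lyapunov function on the range of the subspace -/

section Subspace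

variable {ι κ : Type*} [Fintype ι] [DecidableEq ι] [Fintype κ] [DecidableEq κ] {k : ℕ}

theorem PDeriv.toEuclideanLin {a b : ℝ} {M M' : ℝ → Matrix κ ι ℝ}
    {v v' : ℝ → EuclideanSpace ℝ ι} (hM : PDeriv a b M M') (hv : PDeriv a b v v') :
    PDeriv a b (fun t => Matrix.toEuclideanLin (M t) (v t))
      (fun t => Matrix.toEuclideanLin (M t) (v' t) + Matrix.toEuclideanLin (M' t) (v t)) :=
  PDeriv.bilin isBoundedBilinearMap_toEuclideanLin hM hv

theorem PDeriv.dotProduct {a b : ℝ} {v v' w w' : ℝ → EuclideanSpace ℝ ι}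
    (hv : PDeriv a b v v') (hw : PDeriv a b w w') :
    PDeriv a b (fun t => (v t).ofLp ⬝ᵥ (w t).ofLp)
      (fun t => (v t).ofLp ⬝ᵥ (w' t).ofLp + (v' t).ofLp ⬝ᵥ (w t).ofLp) := by
  have h := PDeriv.bilin (isBoundedBilinearMap_inner (𝕜 := ℝ) (E := EuclideanSpace ℝ ι)) hv hw
  simpa only [EuclideanSpace.inner_eq_star_dotProduct, star_trivial, dotProduct_comm] using h

theorem norm_sq_eq_dotProduct (v : EuclideanSpace ℝ ι) : ‖v‖ ^ 2 = v.ofLp ⬝ᵥ v.ofLp :=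
  norm_toLp_sq v.ofLp

theorem reducedB_add_transpose (A : Matrix ι ι ℝ) (Q : Matrix ι (Fin k) ℝ) :
    reducedB A Q + (reducedB A Q)ᵀ = Qᵀ * A * Q + Qᵀ * Aᵀ * Q := by
  have := skewPart_transpose A Q
  simp only [reducedB, Matrix.transpose_sub, this, Matrix.transpose_mul, Matrix.transpose_transpose,
    Matrix.mul_assoc]
  abel

/-- The coupling of the coordinates on the subspace with the orthogonal component. -/
def subspaceCoupling (A : Matrix ι ι ℝ) (C : Matrix κ ι ℝ) (P : Matrix (Fin k) (Fin k) ℝ)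
    (Q : Matrix ι (Fin k) ℝ) : Matrix (Fin k) ι ℝ :=
  Qᵀ * A + Qᵀ * Aᵀ - P * (C * Q)ᵀ * C

/-- This gives the dynamics of `w = Qᵀe`: the closed-loop reduced matrix acts on `w`, and all other
linear terms act on the residual `(1 - QQᵀ) e`. -/
theorem subspace_field_eq {A : Matrix ι ι ℝ} {C : Matrix κ ι ℝ} {P : Matrix (Fin k) (Fin k) ℝ}
    {Q : Matrix ι (Fin k) ℝ} (hQ : Qᵀ * Q = 1) :
    Qᵀ * (A - gain C P Q * C) + (A * Q - Q * reducedB A Q)ᵀ =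
      (reducedB A Q - P * (C * Q)ᵀ * (C * Q)) * Qᵀ
        + subspaceCoupling A C P Q * (1 - Q * Qᵀ) := by
  have h1 : Qᵀ * (gain C P Q * C) = P * (C * Q)ᵀ * C := by
    simp only [gain, ← Matrix.mul_assoc, hQ, Matrix.one_mul]
  have h2 : (reducedB A Q)ᵀ = Qᵀ * A * Q + Qᵀ * Aᵀ * Q - reducedB A Q := by
    rw [← reducedB_add_transpose]; abel
  rw [Matrix.mul_sub, h1, Matrix.transpose_sub, Matrix.transpose_mul A Q,
    Matrix.transpose_mul Q (reducedB A Q), h2,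
    subspaceCoupling]
  simp only [Matrix.sub_mul, Matrix.add_mul, Matrix.mul_sub, Matrix.mul_one, Matrix.mul_assoc]
  abel

theorem norm_subspaceCoupling_le {A : Matrix ι ι ℝ} {C : Matrix κ ι ℝ}
    {P : Matrix (Fin k) (Fin k) ℝ} {Q : Matrix ι (Fin k) ℝ} {α p : ℝ} (hQ : Qᵀ * Q = 1)
    (hA : ‖A‖ ≤ α) (hP : ‖P‖ ≤ p) : ‖subspaceCoupling A C P Q‖ ≤ 2 * α + p * ‖C‖ ^ 2 := by
  have hQ1 : ‖Qᵀ‖ ≤ 1 := (norm_transpose Q).trans_le (norm_le_one_of_orthonormal hQ)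
  have hα : 0 ≤ α := (norm_nonneg _).trans hA
  have hp : 0 ≤ p := (norm_nonneg _).trans hP
  have h1 : ‖Qᵀ * A‖ ≤ 1 * α :=
    (Matrix.l2_opNorm_mul _ _).trans (mul_le_mul hQ1 hA (norm_nonneg _) zero_le_one)
  have h2 : ‖Qᵀ * Aᵀ‖ ≤ 1 * α := (Matrix.l2_opNorm_mul _ _).trans
    (mul_le_mul hQ1 ((norm_transpose A).trans_le hA) (norm_nonneg _) zero_le_one)
  have h3 : ‖P * (C * Q)ᵀ * C‖ ≤ p * ‖C‖ * ‖C‖ := by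
    refine (Matrix.l2_opNorm_mul _ _).trans (mul_le_mul_of_nonneg_right ?_ (norm_nonneg _))
    refine (Matrix.l2_opNorm_mul _ _).trans (mul_le_mul hP ?_ (norm_nonneg _) hp)
    exact (norm_transpose _).trans_le (norm_output_le hQ)
  refine (norm_sub_le _ _).trans ?_
  have := norm_add_le (Qᵀ * A) (Qᵀ * Aᵀ)
  linarith

/-- In `y = Y w = P⁻¹ w`, the terms with `B` cancel and half of the output term survives with a
favourable sign. The dissipation is the weight `G` evaluated at `y`. -/
theorem riccati_lyapunov_deriv_eq {P Y B G : Matrix (Fin k) (Fin k) ℝ} {W : Matrix κ (Fin k) ℝ}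
    (hPY : P * Y = 1) (hP : Pᵀ = P) (hY : Yᵀ = Y) (w z : Fin k → ℝ) :
    w ⬝ᵥ (Y *ᵥ ((B - P * Wᵀ * W) *ᵥ w + z)
        + (-(Y * (B * P + P * Bᵀ - P * Wᵀ * W * P + G) * Y)) *ᵥ w)
      + ((B - P * Wᵀ * W) *ᵥ w + z) ⬝ᵥ (Y *ᵥ w) =
    -((W *ᵥ w) ⬝ᵥ (W *ᵥ w)) - (Y *ᵥ w) ⬝ᵥ G *ᵥ (Y *ᵥ w) + 2 * ((Y *ᵥ w) ⬝ᵥ z) := by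
  obtain ⟨y, hy⟩ : ∃ y, y = Y *ᵥ w := ⟨_, rfl⟩
  have hw : P *ᵥ y = w := by rw [hy, Matrix.mulVec_mulVec, hPY, Matrix.one_mulVec]
  have hYz : ∀ x, w ⬝ᵥ Y *ᵥ x = y ⬝ᵥ x := fun x => by
    rw [hy, ← dotProduct_transpose_mulVec, hY]
  have hPz : ∀ x, y ⬝ᵥ P *ᵥ x = w ⬝ᵥ x := fun x => by
    rw [← hw, ← dotProduct_transpose_mulVec, hP]
  have hB : y ⬝ᵥ B *ᵥ w = w ⬝ᵥ Bᵀ *ᵥ y := by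
    rw [dotProduct_transpose_mulVec, dotProduct_comm]
  have hW : w ⬝ᵥ Wᵀ *ᵥ (W *ᵥ w) = (W *ᵥ w) ⬝ᵥ (W *ᵥ w) := dotProduct_transpose_mulVec _ _ _
  rw [← hy, dotProduct_comm _ y]
  simp only [Matrix.neg_mulVec, Matrix.add_mulVec, Matrix.sub_mulVec, ← Matrix.mulVec_mulVec,
    dotProduct_add, dotProduct_sub, dotProduct_neg, hYz, ← hy, hw, hPz, hB, hW]
  ring

/-- Decrease of the Lyapunov function that is built from the inverse of the Riccati solution. -/
theorem riccati_lyapunov_deriv_le {P Y B G : Matrix (Fin k) (Fin k) ℝ} {W : Matrix κ (Fin k) ℝ}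
    {N : Matrix (Fin k) ι ℝ} {R : Matrix (Fin k) ι ℝ} {g ν : ℝ} (hg : 0 < g)
    (hPY : P * Y = 1) (hP : Pᵀ = P) (hY : Yᵀ = Y) (hG : ∀ x, g * (x ⬝ᵥ x) ≤ x ⬝ᵥ G *ᵥ x)
    (hN : ‖N‖ ≤ ν) (hR : ‖R‖ ≤ 1) (w : Fin k → ℝ) (r h : ι → ℝ) :
    w ⬝ᵥ (Y *ᵥ ((B - P * Wᵀ * W) *ᵥ w + (N *ᵥ r + R *ᵥ h))
        + (-(Y * (B * P + P * Bᵀ - P * Wᵀ * W * P + G) * Y)) *ᵥ w)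
      + ((B - P * Wᵀ * W) *ᵥ w + (N *ᵥ r + R *ᵥ h)) ⬝ᵥ (Y *ᵥ w) ≤
    -(g / 2) * ((Y *ᵥ w) ⬝ᵥ (Y *ᵥ w)) + 2 * ν ^ 2 / g * (r ⬝ᵥ r)
      + 2 * (‖WithLp.toLp 2 (Y *ᵥ w)‖ * ‖WithLp.toLp 2 h‖) := by
  rw [riccati_lyapunov_deriv_eq hPY hP hY]
  obtain ⟨y, hy⟩ : ∃ y, y = Y *ᵥ w := ⟨_, rfl⟩
  rw [← hy, dotProduct_add]
  have h1 := dotProduct_self_nonneg' (W *ᵥ w)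
  have h2 := hG y
  have h3 := (le_abs_self _).trans (abs_dotProduct_mulVec_le N y r)
  have h4 := (le_abs_self _).trans (abs_dotProduct_mulVec_le R y h)
  rw [← norm_toLp_sq y] at h2 ⊢
  rw [← norm_toLp_sq r]
  have h5 : ‖N‖ * ‖WithLp.toLp 2 y‖ * ‖WithLp.toLp 2 r‖ ≤
      ν * ‖WithLp.toLp 2 y‖ * ‖WithLp.toLp 2 r‖ := by gcongr
  have h6 : ‖R‖ * ‖WithLp.toLp 2 y‖ * ‖WithLp.toLp 2 h‖ ≤
      1 * ‖WithLp.toLp 2 y‖ * ‖WithLp.toLp 2 h‖ := by gcongr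
  have h7 : 2 * (ν * ‖WithLp.toLp 2 y‖ * ‖WithLp.toLp 2 r‖) ≤
      g / 2 * ‖WithLp.toLp 2 y‖ ^ 2 + 2 * ν ^ 2 / g * ‖WithLp.toLp 2 r‖ ^ 2 := by
    have := sq_nonneg (g * ‖WithLp.toLp 2 y‖ - 2 * ν * ‖WithLp.toLp 2 r‖)
    have e : g / 2 * ‖WithLp.toLp 2 y‖ ^ 2 + 2 * ν ^ 2 / g * ‖WithLp.toLp 2 r‖ ^ 2
        - 2 * (ν * ‖WithLp.toLp 2 y‖ * ‖WithLp.toLp 2 r‖) =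
        (g * ‖WithLp.toLp 2 y‖ - 2 * ν * ‖WithLp.toLp 2 r‖) ^ 2 / (2 * g) := by
      field_simp; ring
    have : 0 ≤ (g * ‖WithLp.toLp 2 y‖ - 2 * ν * ‖WithLp.toLp 2 r‖) ^ 2 / (2 * g) := by positivity
    linarith
  linarith

end Subspace

/-! ### Lyapunov function on the complement of the subspace -/

section Cascade

variable {ι : Type*} [Fintype ι] [DecidableEq ι] {k : ℕ}

theorem PDeriv.exp {a b : ℝ} {f f' : ℝ → ℝ} (h : PDeriv a b f f') :
    PDeriv a b (fun t => Real.exp (f t)) (fun t => Real.exp (f t) * f' t) :=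
  ⟨h.1.rexp, by filter_upwards [h.2] with t ht hm using (ht hm).exp⟩

theorem IsQRFactor.orthonormal {A : ℝ → Matrix ι ι ℝ}
    {Q : ℝ → Matrix ι (Fin (Fintype.card ι)) ℝ} (h : IsQRFactor A Q) {α : ℝ}
    (hA : ∀ t, 0 ≤ t → ‖A t‖ ≤ α) {t : ℝ} (ht : 0 ≤ t) : (Q t)ᵀ * Q t = 1 := by
  obtain ⟨c, hc, hS⟩ := exists_norm_skewPart_le (ι := ι) (Fintype.card ι)
  obtain ⟨M, hM⟩ := isCompact_Icc.exists_bound_of_continuousOn (h.2.2.pDeriv le_rfl t).1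
  refine orthonormal_of_pDeriv (K := c * (M * α * M)) (X := fun t => skewPart (A t) (Q t))
    (h.2.2.pDeriv le_rfl t) (fun s hs => ?_) (fun s _ => ?_) h.1 t (right_mem_Icc.2 ht)
  · have h1 := hM s (Ioo_subset_Icc_self hs)
    have h2 := hA s hs.1.le
    have h3 : 0 ≤ M := (norm_nonneg _).trans h1
    have h4 : 0 ≤ α := (norm_nonneg _).trans h2
    refine (hS _ _).trans (mul_le_mul_of_nonneg_left ((norm_sandwich_le _ _).trans ?_) hc)
    gcongr
  · have := skewPart_transpose (A s) (Q s)
    simp only [Matrix.transpose_mul, this, Matrix.mul_sub, Matrix.sub_mul, Matrix.mul_one,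
      Matrix.one_mul, Matrix.neg_mul, Matrix.mul_assoc]
    abel

theorem IsQRFactor.mul_transpose {A : ℝ → Matrix ι ι ℝ}
    {Q : ℝ → Matrix ι (Fin (Fintype.card ι)) ℝ} (h : IsQRFactor A Q) {α : ℝ}
    (hA : ∀ t, 0 ≤ t → ‖A t‖ ≤ α) {t : ℝ} (ht : 0 ≤ t) : Q t * (Q t)ᵀ = 1 :=
  (Matrix.mul_eq_one_comm_of_card_eq _ _ _ (Fintype.card_fin _)).1 (h.orthonormal hA ht)

/-- Completeness, `Q Qᵀ = 1`, lets the equation for `Qᵀe` close on `Qᵀe` itself, apart from the term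
with `F`. -/
theorem qrFactor_field_eq {A F : Matrix ι ι ℝ} {Q : Matrix ι (Fin k) ℝ} (hQ : Q * Qᵀ = 1) :
    Qᵀ * (A - F) + (Q * skewPart A Q)ᵀ = reducedB A Q * Qᵀ - Qᵀ * F := by
  have := skewPart_transpose A Q
  simp only [Matrix.transpose_mul, this, Matrix.mul_sub, reducedB, Matrix.sub_mul, Matrix.mul_assoc,
    hQ, Matrix.mul_one, Matrix.neg_mul]
  abel

/-- Subtracting the skew part cancels all entries below the diagonal and adds their mirror images
above it, so the reduced matrix is upper triangular. -/
theorem reducedB_mulVec_apply (A : Matrix ι ι ℝ) (Q : Matrix ι (Fin k) ℝ) (x : Fin k → ℝ)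
    (i : Fin k) : (reducedB A Q *ᵥ x) i = (Qᵀ * A * Q) i i * x i +
      ∑ j ∈ Finset.Ioi i, ((Qᵀ * A * Q) i j + (Qᵀ * A * Q) j i) * x j := by
  have h : ∀ j, reducedB A Q i j * x j = (if j = i then (Qᵀ * A * Q) i i * x i else 0) +
      if j ∈ Finset.Ioi i then ((Qᵀ * A * Q) i j + (Qᵀ * A * Q) j i) * x j else 0 := by
    intro j
    simp only [reducedB, skewPart, Matrix.sub_apply, Matrix.of_apply, Finset.mem_Ioi]
    rcases lt_trichotomy j i with h | h | h
    · simp [h, h.ne, h.not_gt]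
    · subst h; simp
    · simp [h, h.ne', h.not_gt]
  rw [Matrix.mulVec, dotProduct, Finset.sum_congr rfl fun j _ => h j, Finset.sum_add_distrib]
  rw [Finset.sum_ite_eq' , if_pos (Finset.mem_univ i), Finset.sum_ite_mem, Finset.univ_inter]

/-- Weights with a common decay rate for finitely many scalar equations with negative upper Bohl
exponents. -/
theorem exists_bohl_weights {n : ℕ} {b : Fin n → ℝ → ℝ} (hb : ∀ i, PiecewiseContinuous (b i))
    {β : ℝ} (hβ : ∀ i t, 0 ≤ t → |b i t| ≤ β) (h : ∀ i : Fin n, k ≤ (i : ℕ) → upperBohl (b i) < 0) :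
    ∃ (φ φ' : Fin n → ℝ → ℝ) (δ M : ℝ), 0 < δ ∧ ∀ i : Fin n, k ≤ (i : ℕ) →
      (∀ t, 0 ≤ t → |φ i t| ≤ M) ∧ (∀ T, PDeriv 0 T (φ i) (φ' i)) ∧
        ∀ t, 0 ≤ t → φ' i t + b i t ≤ -δ := by
  have h1 : ∀ i : Fin n, ∃ (φ φ' : ℝ → ℝ) (δ M : ℝ), 0 < δ ∧ (k ≤ (i : ℕ) →
      (∀ t, 0 ≤ t → |φ t| ≤ M) ∧ (∀ T, PDeriv 0 T φ φ') ∧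
        ∀ t, 0 ≤ t → φ' t + b i t ≤ -δ) := by
    intro i
    by_cases hi : k ≤ (i : ℕ)
    · obtain ⟨φ, φ', δ, M, hδ, -, hr⟩ := exists_bohl_weight (hb i) (hβ i) (h i hi)
      exact ⟨φ, φ', δ, M, hδ, fun _ => hr⟩
    -- Indices below `k` receive dummy data; only the positivity of their rate matters for the
    -- common rate.
    · exact ⟨0, 0, 1, 0, one_pos, fun hi' => absurd hi' hi⟩
  choose φ φ' δ M hδ hr using h1
  -- The filter argument replaces a minimum of the rates and also covers `n = 0`.
  obtain ⟨d, hd, hd0⟩ := ((eventually_all.2 fun i : Fin n =>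
    nhdsWithin_le_nhds (Iic_mem_nhds (hδ i)) : ∀ᶠ d in 𝓝[>] (0 : ℝ), ∀ i, d ≤ δ i).and
      self_mem_nhdsWithin).exists
  obtain ⟨m, hm⟩ := (eventually_all.2 fun i : Fin n => eventually_ge_atTop (M i) :
    ∀ᶠ m in atTop, ∀ i, M i ≤ m).exists
  refine ⟨φ, φ', d, m, hd0, fun i hi => ⟨fun t ht => ((hr i hi).1 t ht).trans (hm i), (hr i hi).2.1,
    fun t ht => ((hr i hi).2.2 t ht).trans (neg_le_neg (hd i))⟩⟩

/-- Derivative of one weighted square in a triangular system. -/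
theorem weighted_sq_deriv_le {n : ℕ} {s : Finset (Fin n)} {ψ φ' b δ M m α x h : ℝ}
    {y a : Fin n → ℝ} (hδ : 0 < δ) (hφ : φ' + b ≤ -δ) (hm : m ≤ ψ) (hm0 : 0 ≤ m) (hM : ψ ≤ M)
    (ha : ∀ j, |a j| ≤ 2 * α) :
    ψ * (2 * (x * (b * x + ∑ j ∈ s, a j * y j + h))) + ψ * (2 * φ') * x ^ 2 ≤
      -(m * δ) * x ^ 2 + M * (4 * α ^ 2 * n / δ) * ∑ j ∈ s, y j ^ 2 + 2 * M * (|x| * |h|) := by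
  have hψ : 0 ≤ ψ := hm0.trans hm
  have h1 : (∑ j ∈ s, a j * y j) ^ 2 ≤ 4 * α ^ 2 * n * ∑ j ∈ s, y j ^ 2 := by
    refine (Finset.sum_mul_sq_le_sq_mul_sq s a y).trans
      (mul_le_mul_of_nonneg_right ?_ (Finset.sum_nonneg fun _ _ => sq_nonneg _))
    have h2 : ∀ j ∈ s, a j ^ 2 ≤ 4 * α ^ 2 := fun j _ => by
      have := pow_le_pow_left₀ (abs_nonneg _) (ha j) 2
      rw [sq_abs] at this
      linarith
    refine (Finset.sum_le_card_nsmul s _ _ h2).trans ?_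
    rw [nsmul_eq_mul, mul_comm]
    have hcard : (s.card : ℝ) ≤ n := by
      have := s.card_le_univ
      rw [Fintype.card_fin] at this
      exact_mod_cast this
    gcongr
  obtain ⟨S, hS⟩ : ∃ S, S = ∑ j ∈ s, a j * y j := ⟨_, rfl⟩
  obtain ⟨Y, hY⟩ : ∃ Y, Y = ∑ j ∈ s, y j ^ 2 := ⟨_, rfl⟩
  rw [← hY] at h1 ⊢
  rw [← hS] at h1 ⊢
  have hY0 : 0 ≤ Y := hY ▸ Finset.sum_nonneg fun _ _ => sq_nonneg _
  have h2 : 2 * (x * S) ≤ δ * x ^ 2 + 4 * α ^ 2 * n / δ * Y := by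
    have h3 : 2 * (x * S) ≤ δ * x ^ 2 + S ^ 2 / δ := by
      have : 0 ≤ (δ * x - S) ^ 2 / δ := by positivity
      have e : (δ * x - S) ^ 2 / δ = δ * x ^ 2 + S ^ 2 / δ - 2 * (x * S) := by field_simp; ring
      linarith
    have h4 : S ^ 2 / δ ≤ 4 * α ^ 2 * n / δ * Y := by
      rw [div_mul_eq_mul_div]
      gcongr
    linarith
  have h3 : x * h ≤ |x| * |h| := (le_abs_self _).trans (abs_mul x h).le
  have h5 : (φ' + b) * x ^ 2 ≤ -δ * x ^ 2 := mul_le_mul_of_nonneg_right hφ (sq_nonneg x)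
  have h6 : 2 * (x * (b * x + S + h)) + 2 * φ' * x ^ 2 ≤
      -δ * x ^ 2 + (4 * α ^ 2 * n / δ * Y + 2 * (|x| * |h|)) := by linarith
  have h7 := mul_le_mul_of_nonneg_left h6 hψ
  have h8 : m * (δ * x ^ 2) ≤ ψ * (δ * x ^ 2) := by gcongr
  have h9 : ψ * (4 * α ^ 2 * n / δ * Y + 2 * (|x| * |h|)) ≤
      M * (4 * α ^ 2 * n / δ * Y + 2 * (|x| * |h|)) := by gcongr
  linarith

/-- The squared norm of the components of `v` along the columns `i ≥ k` of `Q`. -/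
def tailEnergy {n : ℕ} (k : ℕ) (Q : Matrix ι (Fin n) ℝ) (v : EuclideanSpace ℝ ι) : ℝ :=
  ∑ i ∈ Finset.univ.filter (fun i : Fin n => k ≤ (i : ℕ)), (Qᵀ *ᵥ v.ofLp) i ^ 2

theorem pDeriv_qrFactor_component {A F : ℝ → Matrix ι ι ℝ}
    {Q : ℝ → Matrix ι (Fin (Fintype.card ι)) ℝ} {α : ℝ} (hα : ∀ t, 0 ≤ t → ‖A t‖ ≤ α)
    (hQ : IsQRFactor A Q) {a : ℝ} (ha : 0 ≤ a) {e η : ℝ → EuclideanSpace ℝ ι}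
    (he : ∀ T, PDeriv a T e (fun t => Matrix.toEuclideanLin (A t - F t) (e t) + η t)) (T : ℝ)
    (i : Fin (Fintype.card ι)) :
    PDeriv a T (fun t => ((Q t)ᵀ *ᵥ (e t).ofLp) i) (fun t =>
      (reducedB (A t) (Q t) *ᵥ ((Q t)ᵀ *ᵥ (e t).ofLp)) i
        - (((Q t)ᵀ * F t) *ᵥ (e t).ofLp) i + ((Q t)ᵀ *ᵥ (η t).ofLp) i) := by
  have h1 := ((hQ.2.2.pDeriv ha T).transpose.toEuclideanLin (he T)).clm
    (EuclideanSpace.proj (𝕜 := ℝ) i)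
  refine h1.congr_deriv fun t ht => ?_
  have h2 := congrArg (fun X => (X *ᵥ (e t).ofLp) i)
    (qrFactor_field_eq (A := A t) (F := F t) (hQ.mul_transpose hα (ha.trans ht.1.le)))
  simp only [Matrix.add_mulVec, Matrix.sub_mulVec, ← Matrix.mulVec_mulVec, Pi.add_apply,
    Pi.sub_apply] at h2
  have h3 : ((Q t)ᵀ *ᵥ ((A t - F t) *ᵥ (e t).ofLp + (η t).ofLp)) i =
      ((Q t)ᵀ *ᵥ (A t - F t) *ᵥ (e t).ofLp) i + ((Q t)ᵀ *ᵥ (η t).ofLp) i := by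
    rw [Matrix.mulVec_add, Pi.add_apply]
  change ((Q t)ᵀ *ᵥ ((A t - F t) *ᵥ (e t).ofLp + (η t).ofLp)) i +
    ((Q t * skewPart (A t) (Q t))ᵀ *ᵥ (e t).ofLp) i = _
  rw [h3, ← Matrix.mulVec_mulVec, Matrix.sub_mulVec]
  linarith

/-- A Lyapunov function for the components along the last columns of the QR factor. The term `F`
does not act on these components. -/
theorem exists_cascade_lyapunov {A : ℝ → Matrix ι ι ℝ}
    {Q : ℝ → Matrix ι (Fin (Fintype.card ι)) ℝ} (hA : PiecewiseContinuous A) {α : ℝ}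
    (hα : ∀ t, 0 ≤ t → ‖A t‖ ≤ α) (hQ : IsQRFactor A Q)
    (hB : ∀ i : Fin (Fintype.card ι), k ≤ (i : ℕ) →
      upperBohl (fun t => ((Q t)ᵀ * A t * Q t) i i) < 0)
    {F : ℝ → Matrix ι ι ℝ} (hF : ∀ t, 0 ≤ t → ∀ i : Fin (Fintype.card ι), k ≤ (i : ℕ) →
      ∀ j, ((Q t)ᵀ * F t) i j = 0) :
    ∃ (d c m M : ℝ) (W : ℝ → EuclideanSpace ℝ ι → ℝ), 0 < d ∧ 0 ≤ c ∧ 0 < m ∧ 0 ≤ M ∧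
      (∀ t, 0 ≤ t → ∀ v, m * tailEnergy k (Q t) v ≤ W t v ∧ W t v ≤ M * tailEnergy k (Q t) v) ∧
      ∀ (a : ℝ) (e η : ℝ → EuclideanSpace ℝ ι), 0 ≤ a →
        (∀ T, PDeriv a T e (fun t => Matrix.toEuclideanLin (A t - F t) (e t) + η t)) →
        ∃ W' : ℝ → ℝ, (∀ T, PDeriv a T (fun t => W t (e t)) W') ∧
          ∀ t, a ≤ t → W' t ≤ -d * tailEnergy k (Q t) (e t) + c * (‖e t‖ * ‖η t‖) := by
  have hα0 : 0 ≤ α := (norm_nonneg _).trans (hα 0 le_rfl)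
  have hQn : ∀ t, 0 ≤ t → ‖Q t‖ ≤ 1 := fun t ht =>
    norm_le_one_of_orthonormal (hQ.orthonormal hα ht)
  have hX : ∀ t, 0 ≤ t → ∀ i j, |((Q t)ᵀ * A t * Q t) i j| ≤ α := fun t ht i j => by
    refine (abs_entry_le_norm _ i j).trans ((norm_sandwich_le _ _).trans ?_)
    calc ‖Q t‖ * ‖A t‖ * ‖Q t‖ ≤ 1 * α * 1 := by
          have := hQn t ht
          have := hα t ht
          gcongr
      _ = α := by ring
  have hbc : ∀ i, PiecewiseContinuous (fun t => ((Q t)ᵀ * A t * Q t) i i) := fun i => by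
    have hc : Continuous fun q : Matrix ι ι ℝ × Matrix ι (Fin (Fintype.card ι)) ℝ =>
        (q.2ᵀ * q.1 * q.2) i i := by fun_prop
    exact (hA.prodMk (PiecewiseContinuous.of_continuousOn hQ.2.2.1)).comp hc
  obtain ⟨φ, φ', δ, M, hδ, hφ⟩ := exists_bohl_weights hbc (fun i t ht => hX t ht i i) hB
  obtain ⟨m, hm⟩ : ∃ m, m = Real.exp (-(2 * M)) := ⟨_, rfl⟩
  obtain ⟨N, hN⟩ : ∃ N, N = Real.exp (2 * M) := ⟨_, rfl⟩
  have hm0 : 0 < m := hm ▸ Real.exp_pos _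
  have hN0 : 0 < N := hN ▸ Real.exp_pos _
  have hψ : ∀ i : Fin (Fintype.card ι), k ≤ (i : ℕ) → ∀ t, 0 ≤ t →
      m ≤ Real.exp (2 * φ i t) ∧ Real.exp (2 * φ i t) ≤ N := fun i hi t ht => by
    have := abs_le.1 ((hφ i hi).1 t ht)
    rw [hm, hN]
    exact ⟨Real.exp_le_exp.2 (by linarith), Real.exp_le_exp.2 (by linarith)⟩
  obtain ⟨K, hK⟩ : ∃ K, K = N * (4 * α ^ 2 * Fintype.card ι / δ) := ⟨_, rfl⟩
  have hK0 : 0 ≤ K := by rw [hK]; positivity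
  -- Large enough for the geometric weights to absorb the coupling constant `K` at the cost of half
  -- of the dissipation `m * δ`.
  obtain ⟨θ, hθ⟩ : ∃ θ, θ = 1 + 2 * (K * Fintype.card ι) / (m * δ) := ⟨_, rfl⟩
  have hθ1 : 1 ≤ θ := by
    rw [hθ]
    have : 0 ≤ 2 * (K * Fintype.card ι) / (m * δ) := by positivity
    linarith
  have hθK : 2 * (K * Fintype.card ι) ≤ (m * δ) * θ := by
    rw [hθ, mul_add, mul_div_cancel₀ _ (by positivity)]
    have : 0 < m * δ := by positivity
    linarith
  obtain ⟨s, hs⟩ : ∃ s, s = Finset.univ.filter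
    (fun i : Fin (Fintype.card ι) => k ≤ (i : ℕ)) := ⟨_, rfl⟩
  have hsm : ∀ i ∈ s, k ≤ (i : ℕ) := fun i hi => by
    rw [hs] at hi; exact (Finset.mem_filter.1 hi).2
  have hsI : ∀ i ∈ s, Finset.Ioi i ⊆ s := fun i hi j hj => by
    have := hsm i hi
    have hij : (i : ℕ) ≤ (j : ℕ) := le_of_lt (show i < j from Finset.mem_Ioi.1 hj)
    rw [hs]
    exact Finset.mem_filter.2 ⟨Finset.mem_univ j, this.trans hij⟩
  have htail : ∀ t v, tailEnergy k (Q t) v = ∑ i ∈ s, ((Q t)ᵀ *ᵥ v.ofLp) i ^ 2 := fun t v => by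
    rw [hs, tailEnergy]
  have hpow : ∀ i : Fin (Fintype.card ι), 1 ≤ θ ^ (i : ℕ) ∧ θ ^ (i : ℕ) ≤ θ ^ Fintype.card ι :=
    fun i => ⟨one_le_pow₀ hθ1, pow_le_pow_right₀ hθ1 i.2.le⟩
  refine ⟨m * δ / 2, 2 * N * (θ ^ Fintype.card ι * Fintype.card ι), m, θ ^ Fintype.card ι * N,
    fun t v => ∑ i ∈ s, θ ^ (i : ℕ) * (Real.exp (2 * φ i t) * ((Q t)ᵀ *ᵥ v.ofLp) i ^ 2),
    by positivity, by positivity, hm0, by positivity, fun t ht v => ?_, fun a e η ha he => ?_⟩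
  · rw [htail, Finset.mul_sum, Finset.mul_sum]
    refine ⟨Finset.sum_le_sum fun i hi => ?_, Finset.sum_le_sum fun i hi => ?_⟩
    · have h1 := (hψ i (hsm i hi) t ht).1
      have h2 := (hpow i).1
      have h3 := mul_le_mul_of_nonneg_right h1 (sq_nonneg (((Q t)ᵀ *ᵥ v.ofLp) i))
      refine h3.trans (le_mul_of_one_le_left ?_ h2)
      positivity
    · rw [mul_assoc]
      have h1 := (hψ i (hsm i hi) t ht).2
      have h2 := (hpow i).2
      gcongr
  · have hξ := pDeriv_qrFactor_component hα hQ ha he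
    refine ⟨fun t => ∑ i ∈ s, θ ^ (i : ℕ) * (Real.exp (2 * φ i t) *
        (2 * (((Q t)ᵀ *ᵥ (e t).ofLp) i * ((reducedB (A t) (Q t) *ᵥ ((Q t)ᵀ *ᵥ (e t).ofLp)) i
          - (((Q t)ᵀ * F t) *ᵥ (e t).ofLp) i + ((Q t)ᵀ *ᵥ (η t).ofLp) i))) +
        Real.exp (2 * φ i t) * (2 * φ' i t) * ((Q t)ᵀ *ᵥ (e t).ofLp) i ^ 2), fun T => ?_,
      fun t ht => ?_⟩
    · refine PDeriv.sum fun i hi => ?_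
      have h1 := ((PDeriv.const (2 : ℝ)).mul (((hφ i (hsm i hi)).2.1 T).restrict ha le_rfl)).exp
      have h2 := (PDeriv.const (θ ^ (i : ℕ))).mul (h1.mul ((hξ T i).mul (hξ T i)))
      simp only [← sq] at h2
      exact h2.congr_deriv fun t ht => by ring
    · have ht0 : 0 ≤ t := ha.trans ht
      have hn1 : ∀ (v : EuclideanSpace ℝ ι) i, |((Q t)ᵀ *ᵥ v.ofLp) i| ≤ ‖v‖ := fun v i => by
        have h1 := (PiLp.norm_apply_le (WithLp.toLp 2 ((Q t)ᵀ *ᵥ v.ofLp)) i).trans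
          (norm_toLp_mulVec_le (Q t)ᵀ v.ofLp)
        rw [norm_transpose] at h1
        exact h1.trans (mul_le_of_le_one_left (norm_nonneg _) (hQn t ht0))
      have h1 : ∀ i ∈ s, Real.exp (2 * φ i t) *
          (2 * (((Q t)ᵀ *ᵥ (e t).ofLp) i * ((reducedB (A t) (Q t) *ᵥ ((Q t)ᵀ *ᵥ (e t).ofLp)) i
          - (((Q t)ᵀ * F t) *ᵥ (e t).ofLp) i + ((Q t)ᵀ *ᵥ (η t).ofLp) i))) +
          Real.exp (2 * φ i t) * (2 * φ' i t) * ((Q t)ᵀ *ᵥ (e t).ofLp) i ^ 2 ≤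
          (-(m * δ) * ((Q t)ᵀ *ᵥ (e t).ofLp) i ^ 2 +
            K * ∑ j ∈ Finset.Ioi i, ((Q t)ᵀ *ᵥ (e t).ofLp) j ^ 2) + 2 * N * (‖e t‖ * ‖η t‖) := by
        intro i hi
        have hik := hsm i hi
        have h2 : (((Q t)ᵀ * F t) *ᵥ (e t).ofLp) i = 0 := by
          rw [Matrix.mulVec, dotProduct]
          exact Finset.sum_eq_zero fun j _ => by rw [hF t ht0 i hik j, zero_mul]
        rw [reducedB_mulVec_apply, h2, sub_zero, hK]
        refine (weighted_sq_deriv_le hδ ((hφ i hik).2.2 t ht0) (hψ i hik t ht0).1 hm0.le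
          (hψ i hik t ht0).2 (α := α) fun j => ?_).trans (add_le_add le_rfl ?_)
        · have h3 := hX t ht0 i j
          have h4 := hX t ht0 j i
          exact (abs_add_le _ _).trans (by linarith)
        · have h3 := hn1 (e t) i
          have h4 := hn1 (η t) i
          gcongr
      have h2 : ∀ i ∈ s, _ := fun i hi =>
        mul_le_mul_of_nonneg_left (h1 i hi) (zero_le_one.trans (hpow i).1)
      refine (Finset.sum_le_sum h2).trans ?_
      simp only [mul_add (θ ^ _) (_ + _)]
      rw [Finset.sum_add_distrib]
      have h3 := sum_geometric_weights_le hsI hθ1 hK0 hθK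
        (x := fun i => ((Q t)ᵀ *ᵥ (e t).ofLp) i ^ 2) fun i => sq_nonneg _
      have h4 : ∑ i ∈ s, ((Q t)ᵀ *ᵥ (e t).ofLp) i ^ 2 ≤
          ∑ i ∈ s, θ ^ (i : ℕ) * ((Q t)ᵀ *ᵥ (e t).ofLp) i ^ 2 :=
        Finset.sum_le_sum fun i _ => le_mul_of_one_le_left (sq_nonneg _) (hpow i).1
      have h5 : ∑ i ∈ s, θ ^ (i : ℕ) * (2 * N * (‖e t‖ * ‖η t‖)) ≤
          2 * N * (θ ^ Fintype.card ι * Fintype.card ι) * (‖e t‖ * ‖η t‖) := by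
        have h6 : ∀ i ∈ s, θ ^ (i : ℕ) * (2 * N * (‖e t‖ * ‖η t‖)) ≤
            θ ^ Fintype.card ι * (2 * N * (‖e t‖ * ‖η t‖)) := fun i _ =>
          mul_le_mul_of_nonneg_right (hpow i).2 (by positivity)
        refine (Finset.sum_le_card_nsmul s _ _ h6).trans ?_
        have hcard : (s.card : ℝ) ≤ Fintype.card ι := by
          have := s.card_le_univ
          rw [Fintype.card_fin] at this
          exact_mod_cast this
        rw [nsmul_eq_mul]
        have := mul_le_mul_of_nonneg_right hcard
          (show 0 ≤ θ ^ Fintype.card ι * (2 * N * (‖e t‖ * ‖η t‖)) by positivity)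
        linarith
      rw [htail]
      have h6 := mul_le_mul_of_nonneg_left h4 (show 0 ≤ m * δ / 2 by positivity)
      linarith

end Cascade

/-! ### Stability of the error dynamics -/

section Stability

variable {ι κ : Type*} [Fintype ι] [DecidableEq ι] [Fintype κ] [DecidableEq κ] {k : ℕ}

/-- `1 - QQᵀ` is an orthogonal projection, so this is Pythagoras' theorem. -/
theorem residual_dotProduct_self {Q : Matrix ι (Fin k) ℝ} (hQ : Qᵀ * Q = 1) (v : ι → ℝ) :
    ((1 - Q * Qᵀ) *ᵥ v) ⬝ᵥ ((1 - Q * Qᵀ) *ᵥ v) = v ⬝ᵥ v - (Qᵀ *ᵥ v) ⬝ᵥ (Qᵀ *ᵥ v) := by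
  have h1 : (1 - Q * Qᵀ)ᵀ * (1 - Q * Qᵀ) = 1 - Qᵀᵀ * Qᵀ := by
    have h2 : Q * (Qᵀ * (Q * Qᵀ)) = Q * Qᵀ := by rw [← Matrix.mul_assoc Qᵀ, hQ, Matrix.one_mul]
    simp only [Matrix.transpose_sub, Matrix.transpose_mul, Matrix.transpose_one,
      Matrix.transpose_transpose, Matrix.sub_mul, Matrix.mul_sub, Matrix.one_mul, Matrix.mul_one,
      Matrix.mul_assoc, h2]
    abel
  rw [← quad_gram, h1, Matrix.sub_mulVec, Matrix.one_mulVec, dotProduct_sub, quad_gram]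

/-- Bounds for `y = P⁻¹ w`. -/
theorem norm_inv_mulVec_bounds {P : Matrix (Fin k) (Fin k) ℝ} {p₁ p₂ : ℝ} (hp₁ : 0 < p₁)
    (hp₂ : 0 < p₂) (hs : Pᵀ = P) (h1 : ∀ x, p₁ * (x ⬝ᵥ x) ≤ x ⬝ᵥ P *ᵥ x)
    (h2 : ∀ x, x ⬝ᵥ P *ᵥ x ≤ p₂ * (x ⬝ᵥ x)) (w : Fin k → ℝ) :
    w ⬝ᵥ w ≤ p₂ ^ 2 * ((P⁻¹ *ᵥ w) ⬝ᵥ (P⁻¹ *ᵥ w)) ∧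
      p₁ * ‖WithLp.toLp 2 (P⁻¹ *ᵥ w)‖ ≤ ‖WithLp.toLp 2 w‖ := by
  have hu := isUnit_of_quad_ge hs hp₁ h1
  have hPY : P * P⁻¹ = 1 := Matrix.mul_nonsing_inv _ ((Matrix.isUnit_iff_isUnit_det P).1 hu)
  obtain ⟨y, hy⟩ : ∃ y, y = P⁻¹ *ᵥ w := ⟨_, rfl⟩
  have hw : w = P *ᵥ y := by rw [hy, Matrix.mulVec_mulVec, hPY, Matrix.one_mulVec]
  have h0 : ∀ x, 0 ≤ x ⬝ᵥ P *ᵥ x := fun x =>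
    (mul_nonneg hp₁.le (dotProduct_self_nonneg' x)).trans (h1 x)
  rw [← hy]
  constructor
  · have h3 := mulVec_self_le hs hp₂ h0 h2 y
    have h4 := mul_le_mul_of_nonneg_left (h2 y) hp₂.le
    rw [hw]
    linarith
  · have h3 := h1 y
    have h4 := (le_abs_self _).trans (abs_dotProduct_le y (P *ᵥ y))
    rw [← norm_toLp_sq] at h3
    rw [← hw] at h3 h4
    by_contra hcon
    push Not at hcon
    have h5 : 0 < ‖WithLp.toLp 2 y‖ := by
      by_contra h6
      have h7 : ‖WithLp.toLp 2 y‖ = 0 := le_antisymm (not_lt.1 h6) (norm_nonneg _)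
      rw [h7, mul_zero] at hcon
      exact hcon.not_ge (norm_nonneg _)
    have h6 := mul_lt_mul_of_pos_left hcon h5
    nlinarith

/-- The Lyapunov function on the range of the subspace along a solution of the error dynamics. -/
theorem exists_subspace_lyapunov {α g₁ g₂ p₁ p₂ : ℝ} {A : ℝ → Matrix ι ι ℝ} {C : Matrix κ ι ℝ}
    {G P : ℝ → Matrix (Fin k) (Fin k) ℝ} {Q : ℝ → Matrix ι (Fin k) ℝ} (hg₁ : 0 < g₁)
    (hr : ∀ T, ReducedTrajectory T α g₁ g₂ A C G P Q) (hp₁ : 0 < p₁) (hp₂ : 0 < p₂)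
    (hP : ∀ t, 0 ≤ t → ∀ x, p₁ * (x ⬝ᵥ x) ≤ x ⬝ᵥ P t *ᵥ x ∧ x ⬝ᵥ P t *ᵥ x ≤ p₂ * (x ⬝ᵥ x))
    {a : ℝ} (ha : 0 ≤ a) {e η : ℝ → EuclideanSpace ℝ ι}
    (he : ∀ T, PDeriv a T e
      (fun t => Matrix.toEuclideanLin (A t - gain C (P t) (Q t) * C) (e t) + η t)) :
    ∃ V' : ℝ → ℝ, (∀ T, PDeriv a T (fun t => ((Q t)ᵀ *ᵥ (e t).ofLp) ⬝ᵥ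
        (P t)⁻¹ *ᵥ ((Q t)ᵀ *ᵥ (e t).ofLp)) V') ∧
      ∀ t, a < t → V' t ≤
        -(g₁ / (2 * p₂ ^ 2)) * (((Q t)ᵀ *ᵥ (e t).ofLp) ⬝ᵥ ((Q t)ᵀ *ᵥ (e t).ofLp))
        + 2 * (2 * α + p₂ * ‖C‖ ^ 2) ^ 2 / g₁ *
          (‖e t‖ ^ 2 - ((Q t)ᵀ *ᵥ (e t).ofLp) ⬝ᵥ ((Q t)ᵀ *ᵥ (e t).ofLp))
        + 2 / p₁ * (‖e t‖ * ‖η t‖) := by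
  have hQ : ∀ t, 0 ≤ t → (Q t)ᵀ * Q t = 1 := fun t ht =>
    (hr t).orthonormal t (right_mem_Icc.2 ht)
  have hs : ∀ t, 0 ≤ t → (P t)ᵀ = P t := fun t ht => (hr t).symm t (right_mem_Icc.2 ht)
  have hu : ∀ t, 0 ≤ t → IsUnit (P t) := fun t ht =>
    isUnit_of_quad_ge (hs t ht) hp₁ fun x => (hP t ht x).1
  have h0 : ∀ t, 0 ≤ t → ∀ x, 0 ≤ x ⬝ᵥ P t *ᵥ x := fun t ht x =>
    (mul_nonneg hp₁.le (dotProduct_self_nonneg' x)).trans (hP t ht x).1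
  have hw : ∀ T, PDeriv a T (fun t => Matrix.toEuclideanLin (Q t)ᵀ (e t)) (fun t => WithLp.toLp 2
      ((reducedB (A t) (Q t) - P t * (C * Q t)ᵀ * (C * Q t)) *ᵥ ((Q t)ᵀ *ᵥ (e t).ofLp) +
        (subspaceCoupling (A t) C (P t) (Q t) *ᵥ ((1 - Q t * (Q t)ᵀ) *ᵥ (e t).ofLp)
          + (Q t)ᵀ *ᵥ (η t).ofLp))) := fun T => by
    refine ((((hr T).qr.restrict ha le_rfl).transpose).toEuclideanLin (he T)).congr_deriv
      fun t ht => ?_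
    have h1 := congrArg (fun X => X *ᵥ (e t).ofLp)
      (subspace_field_eq (A := A t) (C := C) (P := P t) (hQ t (ha.trans ht.1.le)))
    simp only [Matrix.add_mulVec, ← Matrix.mulVec_mulVec] at h1
    refine congrArg (WithLp.toLp 2) ?_
    change (Q t)ᵀ *ᵥ ((A t - gain C (P t) (Q t) * C) *ᵥ (e t).ofLp + (η t).ofLp) +
      ((1 - Q t * (Q t)ᵀ) * A t * Q t + Q t * skewPart (A t) (Q t))ᵀ *ᵥ (e t).ofLp = _
    rw [qr_field_eq, Matrix.mulVec_add, ← add_assoc, ← h1]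
    abel
  have hY : ∀ T, PDeriv a T (fun t => (P t)⁻¹) _ := fun T =>
    ((hr T).riccati.restrict ha le_rfl).matInv fun t ht => hu t (ha.trans ht.1)
  refine ⟨_, fun T => (hw T).dotProduct ((hY T).toEuclideanLin (hw T)), fun t ht => ?_⟩
  have ht0 : 0 ≤ t := ha.trans ht.le
  -- The bounds in `ReducedTrajectory` hold at interior times only, hence the horizon `t + 1`.
  have hm : t ∈ Ioo 0 (t + 1) := ⟨ha.trans_lt ht, by linarith⟩
  have hdet := (Matrix.isUnit_iff_isUnit_det (P t)).1 (hu t ht0)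
  have hQ1 : ‖(Q t)ᵀ‖ ≤ 1 := (norm_transpose _).trans_le (norm_le_one_of_orthonormal (hQ t ht0))
  have h1 := riccati_lyapunov_deriv_le (B := reducedB (A t) (Q t)) (W := C * Q t) (G := G t)
    (N := subspaceCoupling (A t) C (P t) (Q t)) (R := (Q t)ᵀ)
    hg₁ (Matrix.mul_nonsing_inv _ hdet) (hs t ht0)
    (by rw [Matrix.transpose_nonsing_inv, hs t ht0]) ((hr (t + 1)).weight_ge t hm)
    (norm_subspaceCoupling_le (hQ t ht0) ((hr (t + 1)).norm_le t hm)
      (norm_le_of_quad_le (hs t ht0) hp₂ (h0 t ht0) fun x => (hP t ht0 x).2)) hQ1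
    ((Q t)ᵀ *ᵥ (e t).ofLp) ((1 - Q t * (Q t)ᵀ) *ᵥ (e t).ofLp) (η t).ofLp
  refine (le_of_eq ?_).trans (h1.trans ?_)
  · rfl
  obtain ⟨h2, h3⟩ := norm_inv_mulVec_bounds hp₁ hp₂ (hs t ht0) (fun x => (hP t ht0 x).1)
    (fun x => (hP t ht0 x).2) ((Q t)ᵀ *ᵥ (e t).ofLp)
  rw [residual_dotProduct_self (hQ t ht0), ← norm_sq_eq_dotProduct (e t)]
  have h4 : ‖WithLp.toLp 2 ((Q t)ᵀ *ᵥ (e t).ofLp)‖ ≤ ‖e t‖ :=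
    (norm_toLp_mulVec_le (Q t)ᵀ (e t).ofLp).trans (mul_le_of_le_one_left (norm_nonneg _) hQ1)
  have h5 : 2 * (‖WithLp.toLp 2 ((P t)⁻¹ *ᵥ ((Q t)ᵀ *ᵥ (e t).ofLp))‖ * ‖η t‖) ≤
      2 / p₁ * (‖e t‖ * ‖η t‖) := by
    have h6 : ‖WithLp.toLp 2 ((P t)⁻¹ *ᵥ ((Q t)ᵀ *ᵥ (e t).ofLp))‖ ≤ ‖e t‖ / p₁ := by
      rw [le_div_iff₀ hp₁]; linarith
    have h7 := mul_le_mul_of_nonneg_right h6 (norm_nonneg (η t))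
    have e1 : 2 / p₁ * (‖e t‖ * ‖η t‖) = 2 * (‖e t‖ / p₁ * ‖η t‖) := by ring
    linarith
  have h6 : g₁ / (2 * p₂ ^ 2) * (((Q t)ᵀ *ᵥ (e t).ofLp) ⬝ᵥ ((Q t)ᵀ *ᵥ (e t).ofLp)) ≤ g₁ / 2 *
      (((P t)⁻¹ *ᵥ ((Q t)ᵀ *ᵥ (e t).ofLp)) ⬝ᵥ ((P t)⁻¹ *ᵥ ((Q t)ᵀ *ᵥ (e t).ofLp))) := by
    refine (mul_le_mul_of_nonneg_left h2 (by positivity)).trans_eq ?_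
    field_simp
  have h7 : ‖WithLp.toLp 2 (η t).ofLp‖ = ‖η t‖ := rfl
  rw [h7]
  linarith

/-- The first `k` columns of the completed factor are those of `Q`, so the tail measures the
component orthogonal to the range of `Q`. This links the two Lyapunov functions. -/
theorem tailEnergy_eq (hk : k ≤ Fintype.card ι) {Qf : Matrix ι (Fin (Fintype.card ι)) ℝ}
    {Q : Matrix ι (Fin k) ℝ} (hQf : Qf * Qfᵀ = 1)
    (hext : ∀ (r : ι) (j : Fin k), Qf r (Fin.castLE hk j) = Q r j) (v : EuclideanSpace ℝ ι) :
    tailEnergy k Qf v = ‖v‖ ^ 2 - (Qᵀ *ᵥ v.ofLp) ⬝ᵥ (Qᵀ *ᵥ v.ofLp) := by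
  have h1 : ‖v‖ ^ 2 = ∑ i, (Qfᵀ *ᵥ v.ofLp) i ^ 2 := by
    have h2 := quad_gram Qfᵀ v.ofLp
    rw [Matrix.transpose_transpose, hQf, Matrix.one_mulVec] at h2
    rw [norm_sq_eq_dotProduct, h2, dotProduct]
    simp only [sq]
  have h3 : (Qᵀ *ᵥ v.ofLp) ⬝ᵥ (Qᵀ *ᵥ v.ofLp) = ∑ i ∈ Finset.univ.filter
      (fun i : Fin (Fintype.card ι) => ¬ k ≤ (i : ℕ)), (Qfᵀ *ᵥ v.ofLp) i ^ 2 := by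
    have h4 : Finset.univ.filter (fun i : Fin (Fintype.card ι) => ¬ k ≤ (i : ℕ)) =
        Finset.univ.map (Fin.castLEEmb hk) := by
      ext i
      simp only [Finset.mem_filter, Finset.mem_univ, true_and, not_le, Finset.mem_map]
      exact ⟨fun h => ⟨⟨i, h⟩, rfl⟩, by rintro ⟨j, rfl⟩; exact j.2⟩
    rw [h4, Finset.sum_map, dotProduct]
    refine Finset.sum_congr rfl fun j _ => ?_
    have h5 : (Qfᵀ *ᵥ v.ofLp) (Fin.castLEEmb hk j) = (Qᵀ *ᵥ v.ofLp) j := by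
      simp only [Matrix.mulVec, dotProduct, Matrix.transpose_apply]
      exact Finset.sum_congr rfl fun r _ => by rw [← hext r j]; rfl
    rw [h5, sq]
  rw [tailEnergy, h1, h3, ← Finset.sum_filter_add_sum_filter_not Finset.univ
    (fun i : Fin (Fintype.card ι) => k ≤ (i : ℕ))]
  ring

end Stability

/-! ### Combination of the two Lyapunov functions. -/

section ErrorDynamics

variable {ι κ : Type*} [Fintype ι] [DecidableEq ι] [Fintype κ] [DecidableEq κ] {k : ℕ}

/-- The range of the gain lies in the span of the first `k` columns, to which every later column is
orthogonal. The output injection is thus invisible in the tail coordinates. -/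
theorem qrFactor_transpose_mul_gain_apply (hk : k ≤ Fintype.card ι)
    {Qf : Matrix ι (Fin (Fintype.card ι)) ℝ} {Q : Matrix ι (Fin k) ℝ} (hQf : Qfᵀ * Qf = 1)
    (hext : ∀ (r : ι) (j : Fin k), Qf r (Fin.castLE hk j) = Q r j) (C : Matrix κ ι ℝ)
    (P : Matrix (Fin k) (Fin k) ℝ) {i : Fin (Fintype.card ι)} (hi : k ≤ (i : ℕ)) (j : ι) :
    (Qfᵀ * (gain C P Q * C)) i j = 0 := by
  have h1 : ∀ r, (Qfᵀ * Q) i r = 0 := fun r => by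
    have h2 : (Qfᵀ * Q) i r = (Qfᵀ * Qf) i (Fin.castLE hk r) := by
      simp only [Matrix.mul_apply, hext]
    rw [h2, hQf, Matrix.one_apply_ne]
    intro h
    have := r.2
    rw [h] at hi
    simp only [Fin.val_castLE] at hi
    omega
  rw [gain, Matrix.mul_assoc Q, Matrix.mul_assoc Q, ← Matrix.mul_assoc Qfᵀ, Matrix.mul_apply]
  exact Finset.sum_eq_zero fun r _ => by rw [h1, zero_mul]

/-- Uniform exponential decay of the solutions of the error dynamics. -/
theorem exists_exp_decay {α g₁ g₂ p₁ p₂ κ' : ℝ} {A : ℝ → Matrix ι ι ℝ} {C : Matrix κ ι ℝ}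
    {G P : ℝ → Matrix (Fin k) (Fin k) ℝ} {Q : ℝ → Matrix ι (Fin k) ℝ}
    {Qf : ℝ → Matrix ι (Fin (Fintype.card ι)) ℝ} (hg₁ : 0 < g₁) (hκ : 0 < κ')
    (hA : PiecewiseContinuous A) (hα : ∀ t, 0 ≤ t → ‖A t‖ ≤ α)
    (hr : ∀ T, ReducedTrajectory T α g₁ g₂ A C G P Q) (hp₁ : 0 < p₁) (hp₂ : 0 < p₂)
    (hP : ∀ t, 0 ≤ t → ∀ x, p₁ * (x ⬝ᵥ x) ≤ x ⬝ᵥ P t *ᵥ x ∧ x ⬝ᵥ P t *ᵥ x ≤ p₂ * (x ⬝ᵥ x))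
    (hk : k ≤ Fintype.card ι) (hQf : IsQRFactor A Qf)
    (hext : ∀ t, 0 ≤ t → ∀ (r : ι) (j : Fin k), Qf t r (Fin.castLE hk j) = Q t r j)
    (hB : ∀ i : Fin (Fintype.card ι), k ≤ (i : ℕ) →
      upperBohl (fun t => ((Qf t)ᵀ * A t * Qf t) i i) < 0) :
    ∃ μ ρ K : ℝ, 0 < μ ∧ 0 < ρ ∧ 1 ≤ K ∧ ∀ (a : ℝ) (e η : ℝ → EuclideanSpace ℝ ι), 0 ≤ a →
      (∀ T, PDeriv a T e
        (fun t => Matrix.toEuclideanLin (A t - gain C (P t) (Q t) * C) (e t) + η t)) →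
      (∀ t, a ≤ t → ‖η t‖ ≤ κ' * ‖e t‖ ^ 2) → ‖e a‖ ≤ ρ →
      ∀ t, a ≤ t → ‖e t‖ ≤ K * Real.exp (-μ * (t - a)) * ‖e a‖ := by
  obtain ⟨d, c, m, M, W, hd, hc, hm, hM, hW, hW'⟩ := exists_cascade_lyapunov hA hα hQf hB
    (F := fun t => gain C (P t) (Q t) * C) fun t ht i hi j =>
      qrFactor_transpose_mul_gain_apply hk (hQf.orthonormal hα ht) (hext t ht) C (P t) hi j
  have htail : ∀ t, 0 ≤ t → ∀ v, tailEnergy k (Qf t) v =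
      ‖v‖ ^ 2 - ((Q t)ᵀ *ᵥ v.ofLp) ⬝ᵥ ((Q t)ᵀ *ᵥ v.ofLp) := fun t ht v =>
    tailEnergy_eq hk (hQf.mul_transpose hα ht) (hext t ht) v
  have htail0 : ∀ t v, 0 ≤ tailEnergy k (Qf t) v := fun t v =>
    Finset.sum_nonneg fun _ _ => sq_nonneg _
  obtain ⟨a₁, ha₁⟩ : ∃ a₁, a₁ = g₁ / (2 * p₂ ^ 2) := ⟨_, rfl⟩
  obtain ⟨a₂, ha₂⟩ : ∃ a₂, a₂ = 2 * (2 * α + p₂ * ‖C‖ ^ 2) ^ 2 / g₁ := ⟨_, rfl⟩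
  obtain ⟨a₃, ha₃⟩ : ∃ a₃, a₃ = 2 / p₁ := ⟨_, rfl⟩
  have ha₁0 : 0 < a₁ := by rw [ha₁]; positivity
  have ha₂0 : 0 ≤ a₂ := by rw [ha₂]; positivity
  have ha₃0 : 0 < a₃ := by rw [ha₃]; positivity
  -- The tail dissipation times `Θ` pays for the coupling `a₂` and supplies the missing rate `a₁`,
  -- so that the total quadratic part is exactly `-a₁ * ‖e‖ ^ 2`.
  obtain ⟨Θ, hΘ⟩ : ∃ Θ, Θ = (a₁ + a₂) / d := ⟨_, rfl⟩
  have hΘ0 : 0 < Θ := by rw [hΘ]; positivity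
  have hΘd : Θ * d = a₁ + a₂ := by rw [hΘ]; field_simp
  obtain ⟨c₁, hc₁⟩ : ∃ c₁, c₁ = (a₃ + Θ * c) * κ' := ⟨_, rfl⟩
  have hc₁0 : 0 < c₁ := by rw [hc₁]; positivity
  obtain ⟨c₂, hc₂⟩ : ∃ c₂, c₂ = min p₂⁻¹ (Θ * m) := ⟨_, rfl⟩
  have hc₂0 : 0 < c₂ := by rw [hc₂]; positivity
  -- The summand `c₂` only guarantees `c₂ ≤ c₃`, which the Lyapunov estimates do not give when the
  -- state space is trivial.
  obtain ⟨c₃, hc₃⟩ : ∃ c₃, c₃ = p₁⁻¹ + Θ * M + c₂ := ⟨_, rfl⟩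
  have hp₁i : 0 < p₁⁻¹ := inv_pos.2 hp₁
  have hΘM : 0 ≤ Θ * M := mul_nonneg hΘ0.le hM
  have hc₂₃ : c₂ ≤ c₃ := by linarith
  have hc₃0 : 0 < c₃ := hc₂0.trans_le hc₂₃
  refine ⟨a₁ / (4 * c₃), a₁ / (4 * c₁ * √(c₃ / c₂)), √(c₃ / c₂), by positivity, by positivity,
    Real.one_le_sqrt.2 ((one_le_div hc₂0).2 hc₂₃), fun a e η ha he hη hea => ?_⟩
  obtain ⟨V', hV, hV'⟩ := exists_subspace_lyapunov hg₁ hr hp₁ hp₂ hP ha he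
  obtain ⟨W', hWd, hWb⟩ := hW' a e η ha he
  have hbounds : ∀ t, a ≤ t →
      p₂⁻¹ * (((Q t)ᵀ *ᵥ (e t).ofLp) ⬝ᵥ ((Q t)ᵀ *ᵥ (e t).ofLp)) ≤
        ((Q t)ᵀ *ᵥ (e t).ofLp) ⬝ᵥ (P t)⁻¹ *ᵥ ((Q t)ᵀ *ᵥ (e t).ofLp) ∧
      ((Q t)ᵀ *ᵥ (e t).ofLp) ⬝ᵥ (P t)⁻¹ *ᵥ ((Q t)ᵀ *ᵥ (e t).ofLp) ≤
        p₁⁻¹ * (((Q t)ᵀ *ᵥ (e t).ofLp) ⬝ᵥ ((Q t)ᵀ *ᵥ (e t).ofLp)) := fun t ht => by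
    have ht0 := ha.trans ht
    have hs : (P t)ᵀ = P t := (hr t).symm t (right_mem_Icc.2 ht0)
    have hu := isUnit_of_quad_ge hs hp₁ fun x => (hP t ht0 x).1
    rw [inv_mul_le_iff₀ hp₂, le_inv_mul_iff₀ hp₁]
    exact ⟨quad_inv_ge hs hu hp₂
      (fun x => (mul_nonneg hp₁.le (dotProduct_self_nonneg' x)).trans (hP t ht0 x).1)
      (fun x => (hP t ht0 x).2) _, quad_inv_le hu hp₁.le (fun x => (hP t ht0 x).1) _⟩
  refine exp_decay_of_lyapunov ha₁0 hc₁0 hc₂0 hc₂₃ (fun T => (he T).1)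
    (fun T => (hV T).add ((PDeriv.const Θ).mul (hWd T))) (fun t ht => ?_) (fun t ht => ?_)
    (fun t ht => ?_) hea
  · have ht0 := ha.trans ht
    have h1 := (hbounds t ht).1
    have h2 := (hW t ht0 (e t)).1
    have h3 := htail t ht0 (e t)
    have h4 := htail0 t (e t)
    have h5 := dotProduct_self_nonneg' ((Q t)ᵀ *ᵥ (e t).ofLp)
    have h6 : c₂ * tailEnergy k (Qf t) (e t) ≤ Θ * m * tailEnergy k (Qf t) (e t) :=
      mul_le_mul_of_nonneg_right (hc₂ ▸ min_le_right _ _) h4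
    have h7 := mul_le_mul_of_nonneg_right (hc₂ ▸ min_le_left _ _ : c₂ ≤ p₂⁻¹) h5
    have h8 := mul_le_mul_of_nonneg_left h2 hΘ0.le
    have h9 : c₂ * ‖e t‖ ^ 2 = c₂ * tailEnergy k (Qf t) (e t) +
      c₂ * (((Q t)ᵀ *ᵥ (e t).ofLp) ⬝ᵥ ((Q t)ᵀ *ᵥ (e t).ofLp)) := by rw [h3]; ring
    linarith
  · have ht0 := ha.trans ht
    have h1 := (hbounds t ht).2
    have h2 := mul_le_mul_of_nonneg_left (hW t ht0 (e t)).2 hΘ0.le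
    have h3 := htail t ht0 (e t)
    have h4 := htail0 t (e t)
    have h5 := dotProduct_self_nonneg' ((Q t)ᵀ *ᵥ (e t).ofLp)
    have h6 := mul_nonneg (add_nonneg hp₁i.le hc₂0.le) h4
    have h7 := mul_nonneg (add_nonneg hΘM hc₂0.le) h5
    have h9 : c₃ * ‖e t‖ ^ 2 = (p₁⁻¹ + c₂) * tailEnergy k (Qf t) (e t)
      + Θ * (M * tailEnergy k (Qf t) (e t))
      + p₁⁻¹ * (((Q t)ᵀ *ᵥ (e t).ofLp) ⬝ᵥ ((Q t)ᵀ *ᵥ (e t).ofLp))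
      + (Θ * M + c₂) * (((Q t)ᵀ *ᵥ (e t).ofLp) ⬝ᵥ ((Q t)ᵀ *ᵥ (e t).ofLp)) := by
        rw [h3, hc₃]; ring
    linarith
  · have ht0 := ha.trans ht.le
    have h1 := hV' t ht
    rw [← ha₁, ← ha₂, ← ha₃, ← htail t ht0] at h1
    have h2 := mul_le_mul_of_nonneg_left (hWb t ht.le) hΘ0.le
    have h3 := htail t ht0 (e t)
    have h4 := mul_le_mul_of_nonneg_left (hη t ht.le)
      (mul_nonneg (show 0 ≤ a₃ + Θ * c by positivity) (norm_nonneg (e t)))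
    have h5 : Θ * (-d * tailEnergy k (Qf t) (e t) + c * (‖e t‖ * ‖η t‖)) =
      -(a₁ + a₂) * tailEnergy k (Qf t) (e t) + Θ * c * (‖e t‖ * ‖η t‖) := by rw [← hΘd]; ring
    have h6 : ((Q t)ᵀ *ᵥ (e t).ofLp) ⬝ᵥ ((Q t)ᵀ *ᵥ (e t).ofLp) =
      ‖e t‖ ^ 2 - tailEnergy k (Qf t) (e t) := by rw [h3]; ring
    rw [h6] at h1
    have h7 : c₁ * ‖e t‖ ^ 3 = (a₃ + Θ * c) * ‖e t‖ * (κ' * ‖e t‖ ^ 2) := by rw [hc₁]; ring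
    rw [zero_mul, add_zero]
    linarith

end ErrorDynamics

/-! ### Existence of solutions of the error dynamics. -/

section ErrorExistence

variable {ι κ V : Type*} [Fintype ι] [DecidableEq ι] [Fintype κ] [DecidableEq κ]
  [NormedAddCommGroup V] [NormedSpace ℝ V] {k : ℕ}

/-- The Jacobian cancels. The resulting increment of `f` makes global linear growth evident and
needs only `C¹` regularity of `f`. -/
theorem errorField_eq (f : EuclideanSpace ℝ ι → V → EuclideanSpace ℝ ι) (C : Matrix κ ι ℝ)
    (u : ℝ → V) (xh : ℝ → EuclideanSpace ℝ ι) (P : ℝ → Matrix (Fin k) (Fin k) ℝ)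
    (Q : ℝ → Matrix ι (Fin k) ℝ) (t : ℝ) (e : EuclideanSpace ℝ ι) :
    errorField f C u xh P Q t e = f (xh t + e) (u t) - f (xh t) (u t)
      - Matrix.toEuclideanLin (gain C (P t) (Q t) * C) e := by
  simp only [errorField, taylorRemainder, map_sub, LinearMap.sub_apply]
  abel

/-- The error dynamics as a function of the data and the error. -/
def errorMap (f : EuclideanSpace ℝ ι → V → EuclideanSpace ℝ ι) (C : Matrix κ ι ℝ)
    (q : ((EuclideanSpace ℝ ι × V) × Matrix (Fin k) (Fin k) ℝ × Matrix ι (Fin k) ℝ) ×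
      EuclideanSpace ℝ ι) : EuclideanSpace ℝ ι :=
  f (q.1.1.1 + q.2) q.1.1.2 - f q.1.1.1 q.1.1.2
    - Matrix.toEuclideanLin (gain C q.1.2.1 q.1.2.2 * C) q.2

theorem contDiff_errorMap {f : EuclideanSpace ℝ ι → V → EuclideanSpace ℝ ι} (C : Matrix κ ι ℝ)
    (hf : ContDiff ℝ 1 (fun q : EuclideanSpace ℝ ι × V => f q.1 q.2)) :
    ContDiff ℝ 1 (errorMap (k := k) f C) := by
  have hx : ContDiff ℝ 1 fun q : ((EuclideanSpace ℝ ι × V) × Matrix (Fin k) (Fin k) ℝ ×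
      Matrix ι (Fin k) ℝ) × EuclideanSpace ℝ ι => q.1.1.1 := contDiff_fst.fst.fst
  have hu : ContDiff ℝ 1 fun q : ((EuclideanSpace ℝ ι × V) × Matrix (Fin k) (Fin k) ℝ ×
      Matrix ι (Fin k) ℝ) × EuclideanSpace ℝ ι => q.1.1.2 := contDiff_fst.fst.snd
  have hP : ContDiff ℝ 1 fun q : ((EuclideanSpace ℝ ι × V) × Matrix (Fin k) (Fin k) ℝ ×
      Matrix ι (Fin k) ℝ) × EuclideanSpace ℝ ι => q.1.2.1 := contDiff_fst.snd.fst
  have hQ : ContDiff ℝ 1 fun q : ((EuclideanSpace ℝ ι × V) × Matrix (Fin k) (Fin k) ℝ ×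
      Matrix ι (Fin k) ℝ) × EuclideanSpace ℝ ι => q.1.2.2 := contDiff_fst.snd.snd
  have he : ContDiff ℝ 1 fun q : ((EuclideanSpace ℝ ι × V) × Matrix (Fin k) (Fin k) ℝ ×
      Matrix ι (Fin k) ℝ) × EuclideanSpace ℝ ι => q.2 := contDiff_snd
  have h1 := hf.comp ((hx.add he).prodMk hu)
  have h2 := hf.comp (hx.prodMk hu)
  have h3 := contDiff_matMul (contDiff_matMul (contDiff_matMul hQ hP)
    (contDiff_transpose (contDiff_matMul (contDiff_const (c := C)) hQ))) (contDiff_const (c := C))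
  exact (h1.sub h2).sub (contDiff_toEuclideanLin h3 he)

/-- Global existence of solutions of the error dynamics. -/
theorem exists_error_solution {f : EuclideanSpace ℝ ι → V → EuclideanSpace ℝ ι} {C : Matrix κ ι ℝ}
    (hf : ContDiff ℝ 1 (fun q : EuclideanSpace ℝ ι × V => f q.1 q.2)) {Λ : ℝ}
    [FiniteDimensional ℝ V]
    (hlip : ∀ x z u, ‖f x u - f z u‖ ≤ Λ * ‖x - z‖) {u : ℝ → V} {xh : ℝ → EuclideanSpace ℝ ι}
    {P : ℝ → Matrix (Fin k) (Fin k) ℝ} {Q : ℝ → Matrix ι (Fin k) ℝ} (hu : PiecewiseContinuous u)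
    (hx : ContinuousOn xh (Ici 0)) (hP : ContinuousOn P (Ici 0)) (hQ : ContinuousOn Q (Ici 0))
    {γ : ℝ} (hγ : ∀ t, 0 ≤ t → ‖gain C (P t) (Q t)‖ ≤ γ) {a : ℝ} (ha : 0 ≤ a)
    (e₀ : EuclideanSpace ℝ ι) : ∃ e, SolvesFrom a (errorField f C u xh P Q) e ∧ e a = e₀ := by
  have hd := ((PiecewiseContinuous.of_continuousOn hx).prodMk hu).prodMk
    (PiecewiseContinuous.of_continuousOn (hP.prodMk hQ))
  have hγ0 : 0 ≤ γ := (norm_nonneg _).trans (hγ 0 le_rfl)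
  obtain ⟨e, he, he0⟩ := exists_solvesFrom (contDiff_errorMap (k := k) C hf) hd ha e₀ (by
    intro T hT
    refine ⟨‖e₀‖ * Real.exp (|Λ| * (T - a) + γ * ‖C‖ * (T - a)), fun b hb z hz hz0 => ?_⟩
    have h1 := hz.norm_le_mul_exp (K := |Λ| + γ * ‖C‖) hb.1 (fun t ht => by
      have h2 := hlip (xh t + z t) (xh t) (u t)
      rw [add_sub_cancel_left] at h2
      have h3 := norm_toEuclideanLin_le (gain C (P t) (Q t) * C) (z t)
      have h4 : ‖gain C (P t) (Q t) * C‖ ≤ γ * ‖C‖ := (Matrix.l2_opNorm_mul _ _).trans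
        (mul_le_mul_of_nonneg_right (hγ t (ha.trans ht.1.le)) (norm_nonneg _))
      have h5 := mul_le_mul_of_nonneg_right h4 (norm_nonneg (z t))
      have h6 := mul_le_mul_of_nonneg_right (le_abs_self Λ) (norm_nonneg (z t))
      refine (norm_sub_le _ _).trans ?_
      dsimp only
      linarith)
    rw [hz0] at h1
    refine h1.trans (mul_le_mul_of_nonneg_left (Real.exp_le_exp.2 ?_) (norm_nonneg _))
    have h2 : 0 ≤ |Λ| + γ * ‖C‖ := by positivity
    have h3 := mul_le_mul_of_nonneg_left (sub_le_sub_right hb.2 a) h2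
    linarith)
  refine ⟨e, ?_, he0⟩
  have h1 : (fun t w => errorMap f C (((xh t, u t), P t, Q t), w)) = errorField f C u xh P Q := by
    funext t w
    rw [errorField_eq]
    rfl
  rwa [h1] at he

end ErrorExistence

/-! ### Stability along observer trajectories. -/

section Main

theorem upperBohl_neg_of_jStar_le {ι : Type*} [Fintype ι] [DecidableEq ι]
    {A : ℝ → Matrix ι ι ℝ} {Q : ℝ → Matrix ι (Fin (Fintype.card ι)) ℝ} {k : ℕ}
    (h : jStar A Q ≤ k) (i : Fin (Fintype.card ι)) (hi : k ≤ (i : ℕ)) :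
    upperBohl (fun t => ((Q t)ᵀ * A t * Q t) i i) < 0 := by
  -- The set contains `n`, for which the condition is vacuous, so the infimum is attained and not
  -- the default value of an empty set.
  have hmem := Nat.sInf_mem (s := {j : ℕ | j ≤ Fintype.card ι ∧ ∀ i : Fin (Fintype.card ι),
    j ≤ (i : ℕ) → upperBohl (fun t => ((Q t)ᵀ * A t * Q t) i i) < 0})
    ⟨Fintype.card ι, le_rfl, fun i hi => absurd i.2 hi.not_gt⟩
  exact hmem.2 i (h.trans hi)

variable {p m : ℕ} {l : Fin p → ℕ}
  {fbar : EuclideanSpace ℝ (StateIndex l) → EuclideanSpace ℝ (Fin m) →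
      EuclideanSpace ℝ (StateIndex l)}

/-- Stability of the error dynamics along a bounded trajectory of the observer. -/
theorem locallyUniformlyExponentiallyStable_errorField (hsmooth : ContDiff ℝ 2
      (fun q : EuclideanSpace ℝ (StateIndex l) × EuclideanSpace ℝ (Fin m) => fbar q.1 q.2))
    {Lam : NNReal} (hlip : ∀ u : EuclideanSpace ℝ (Fin m), LipschitzWith Lam (fun x => fbar x u))
    {κ' : ℝ} (hκ : 0 < κ')
    (hη : ∀ e x u, ‖taylorRemainder (canonicalField l fbar) e x u‖ ≤ κ' * ‖e‖ ^ 2)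
    {k : ℕ} (hk : k ≤ Fintype.card (StateIndex l)) {g₁ g₂ p₁ p₂ : ℝ} (hg₁ : 0 < g₁)
    (hp₁ : 0 < p₁) (hp₂ : 0 < p₂) {G : ℝ → Matrix (Fin k) (Fin k) ℝ}
    {u : ℝ → EuclideanSpace ℝ (Fin m)} {y : ℝ → EuclideanSpace ℝ (Fin p)}
    (hu : PiecewiseContinuous u) {xh : ℝ → EuclideanSpace ℝ (StateIndex l)}
    {P : ℝ → Matrix (Fin k) (Fin k) ℝ} {Q : ℝ → Matrix (StateIndex l) (Fin k) ℝ}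
    (ho : IsObserverTrajectory (canonicalField l fbar) (Cbar l) u y G xh P Q)
    (hr : ∀ T, ReducedTrajectory T (‖Abar l‖ + Lam) g₁ g₂
      (fun t => jacobian (canonicalField l fbar) (xh t) (u t)) (Cbar l) G P Q)
    (hP : ∀ t, 0 ≤ t → ∀ x, p₁ * (x ⬝ᵥ x) ≤ x ⬝ᵥ P t *ᵥ x ∧ x ⬝ᵥ P t *ᵥ x ≤ p₂ * (x ⬝ᵥ x))
    {Qf : ℝ → Matrix (StateIndex l) (Fin (Fintype.card (StateIndex l))) ℝ}
    (hQf : IsQRFactor (fun t => jacobian (canonicalField l fbar) (xh t) (u t)) Qf)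
    (hext : ∀ t, 0 ≤ t → ∀ (r : StateIndex l) (j : Fin k), Qf t r (Fin.castLE hk j) = Q t r j)
    (hj : jStar (fun t => jacobian (canonicalField l fbar) (xh t) (u t)) Qf ≤ k) :
    LocallyUniformlyExponentiallyStable
      (errorField (canonicalField l fbar) (Cbar l) u xh P Q) := by
  have hf := contDiff_canonicalField (l := l) hsmooth
  have hJ : Continuous fun q : EuclideanSpace ℝ (StateIndex l) × EuclideanSpace ℝ (Fin m) =>
      jacobian (canonicalField l fbar) q.1 q.2 :=
    (contDiff_jacobian hf contDiff_fst contDiff_snd).continuous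
  have hA : PiecewiseContinuous fun t => jacobian (canonicalField l fbar) (xh t) (u t) :=
    ((PiecewiseContinuous.of_continuousOn ho.state.1).prodMk hu).comp hJ
  obtain ⟨μ, ρ, K, hμ, hρ, hK, hdecay⟩ := exists_exp_decay hg₁ hκ hA
    (fun t _ => norm_jacobian_canonicalField_le hsmooth hlip (xh t) (u t)) hr hp₁ hp₂ hP hk hQf hext
    (upperBohl_neg_of_jStar_le hj)
  refine ⟨fun t _ => ?_, μ, ρ, K, hμ, hρ, hK, fun t₀ ht₀ => ⟨fun e₀ _ => ?_, fun e he he0 => ?_⟩⟩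
  · simp only [errorField_eq, add_zero, sub_self, map_zero]
  · refine exists_error_solution (hf.of_le one_le_two) (Λ := ‖Abar l‖ + Lam)
      (norm_canonicalField_sub_le hlip) hu ho.state.1 ho.riccati.1 ho.qr.1
      (γ := p₂ * ‖Cbar l‖) (fun t ht => ?_) ht₀ e₀
    have hm := right_mem_Icc.2 ht
    exact norm_gain_le ((hr t).orthonormal t hm) (norm_le_of_quad_le ((hr t).symm t hm) hp₂
      (fun x => (mul_nonneg hp₁.le (dotProduct_self_nonneg' x)).trans (hP t ht x).1)
      fun x => (hP t ht x).2)
  · exact hdecay t₀ e (fun t => taylorRemainder (canonicalField l fbar) (e t) (xh t) (u t)) ht₀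
      (fun T => he.pDeriv le_rfl T) (fun t _ => hη _ _ _) he0

end Main

end SubspaceObserver

end

open SubspaceObserver in
theorem mainTheorem3 {p m : ℕ} (l : Fin p → ℕ)
    (fbar : EuclideanSpace ℝ (StateIndex l) → EuclideanSpace ℝ (Fin m) →
      EuclideanSpace ℝ (StateIndex l))
    -- `f̄` is twice continuously differentiable
    (hsmooth : ContDiff ℝ 2
      (fun q : EuclideanSpace ℝ (StateIndex l) × EuclideanSpace ℝ (Fin m) => fbar q.1 q.2))
    -- `f̄` is globally Lipschitz continuous in `x`
    (hlip : ∃ Λ : NNReal, ∀ u : EuclideanSpace ℝ (Fin m), LipschitzWith Λ (fun x => fbar x u))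
    -- the Hessian with respect to `x` of each component of `f̄` is bounded
    (hhess : ∃ H : ℝ, ∀ (r : StateIndex l) (x : EuclideanSpace ℝ (StateIndex l))
      (u : EuclideanSpace ℝ (Fin m)),
        ‖fderiv ℝ (fun z => fderiv ℝ (fun w => (fbar w u) r) z) x‖ ≤ H)
    -- `∂f_{i,j} / ∂x_{v,w} = 0` for `w > j`
    (htri : ∀ (x : EuclideanSpace ℝ (StateIndex l)) (u : EuclideanSpace ℝ (Fin m))
      (r s : StateIndex l), (r.2 : ℕ) < (s.2 : ℕ) → jacobian fbar x u r s = 0) :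
    -- (a3)
    (∃ ε κ : ℝ, 0 < ε ∧ 0 < κ ∧
      ∀ (e x : EuclideanSpace ℝ (StateIndex l)) (u : EuclideanSpace ℝ (Fin m)), ‖e‖ ≤ ε →
        ‖taylorRemainder (canonicalField l fbar) e x u‖ ≤ κ * ‖e‖ ^ 2) ∧
    ∀ (k : ℕ) (hk : k ≤ Fintype.card (StateIndex l))
      (P₀ : Matrix (Fin k) (Fin k) ℝ) (g₁ g₂ : ℝ), P₀.PosDef → 0 < g₁ → g₁ ≤ g₂ →
      -- the bounds in (a1) and (a2) do not depend on the trajectory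
      ∃ α p₁ p₂ : ℝ, 0 < α ∧ 0 < p₁ ∧ 0 < p₂ ∧
        ∀ (G : ℝ → Matrix (Fin k) (Fin k) ℝ) (u : ℝ → EuclideanSpace ℝ (Fin m))
          (x : ℝ → EuclideanSpace ℝ (StateIndex l))
          (xh₀ : EuclideanSpace ℝ (StateIndex l)) (Q₀ : Matrix (StateIndex l) (Fin k) ℝ),
          PiecewiseContinuous G →
          (∀ t : ℝ, 0 ≤ t → (G t - g₁ • (1 : Matrix (Fin k) (Fin k) ℝ)).PosSemidef ∧
            (g₂ • (1 : Matrix (Fin k) (Fin k) ℝ) - G t).PosSemidef) →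
          PiecewiseContinuous u →
          SolvesFrom 0 (fun t z => canonicalField l fbar z (u t)) x →
          Q₀ᵀ * Q₀ = 1 →
          -- the observer has a trajectory on `[0, ∞)` with the given initial values
          (∃ (xh : ℝ → EuclideanSpace ℝ (StateIndex l)) (P : ℝ → Matrix (Fin k) (Fin k) ℝ)
            (Q : ℝ → Matrix (StateIndex l) (Fin k) ℝ),
            IsObserverTrajectory (canonicalField l fbar) (Cbar l) u
              (fun t => Matrix.toEuclideanLin (Cbar l) (x t)) G xh P Q ∧
            xh 0 = xh₀ ∧ P 0 = P₀ ∧ Q 0 = Q₀) ∧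
          ∀ (xh : ℝ → EuclideanSpace ℝ (StateIndex l)) (P : ℝ → Matrix (Fin k) (Fin k) ℝ)
            (Q : ℝ → Matrix (StateIndex l) (Fin k) ℝ),
            IsObserverTrajectory (canonicalField l fbar) (Cbar l) u
              (fun t => Matrix.toEuclideanLin (Cbar l) (x t)) G xh P Q →
            xh 0 = xh₀ → P 0 = P₀ → Q 0 = Q₀ →
            -- (a1)
            (∀ t : ℝ, 0 ≤ t → ‖jacobian (canonicalField l fbar) (xh t) (u t)‖ ≤ α) ∧
            -- (a2)
            (∀ t : ℝ, 0 ≤ t → (P t - p₁ • (1 : Matrix (Fin k) (Fin k) ℝ)).PosSemidef ∧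
              (p₂ • (1 : Matrix (Fin k) (Fin k) ℝ) - P t).PosSemidef) ∧
            -- stability of the error dynamics whenever `j⋆ ≤ k`
            ∀ Qf : ℝ → Matrix (StateIndex l) (Fin (Fintype.card (StateIndex l))) ℝ,
              IsQRFactor (fun t => jacobian (canonicalField l fbar) (xh t) (u t)) Qf →
              (∀ t : ℝ, 0 ≤ t → ∀ (r : StateIndex l) (j : Fin k),
                Qf t r (Fin.castLE hk j) = Q t r j) →
              jStar (fun t => jacobian (canonicalField l fbar) (xh t) (u t)) Qf ≤ k →
              LocallyUniformlyExponentiallyStable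
                (errorField (canonicalField l fbar) (Cbar l) u xh P Q) := by
  obtain ⟨Lam, hlip⟩ := hlip
  obtain ⟨H, hH⟩ := hhess
  obtain ⟨κ', hκ, hη⟩ := norm_taylorRemainder_le (contDiff_slice hsmooth) hH
  have hη' : ∀ e x u, ‖taylorRemainder (canonicalField l fbar) e x u‖ ≤ κ' * ‖e‖ ^ 2 :=
    fun e x u => by rw [taylorRemainder_canonicalField hsmooth]; exact hη e x u
  -- The quadratic bound is global because the Hessian is bounded everywhere, so any radius serves
  -- as `ε`.
  refine ⟨⟨1, κ', one_pos, hκ, fun e x u _ => hη' e x u⟩, fun k hk P₀ g₁ g₂ hP₀ hg₁ hg => ?_⟩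
  obtain ⟨p₁, p₂, hp₁, hp₂, hbd⟩ :=
    exists_riccati_bounds l (‖Abar l‖ + Lam) Lam g₁ g₂ hP₀ hg₁ hg
  -- The summand `1` only makes the bound positive when `Ā` and the Lipschitz constant vanish.
  refine ⟨‖Abar l‖ + Lam + 1, p₁, p₂, by positivity, hp₁, hp₂,
    fun G u x xh₀ Q₀ hGc hG hu hx hQ₀ => ?_⟩
  have hP₀s : P₀ᵀ = P₀ := by
    rw [← Matrix.conjTranspose_eq_transpose_of_trivial]; exact hP₀.isHermitian
  have hGl := fun t ht => posSemidef_sub_smul_one_iff.1 (hG t ht).1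
  have hGu := fun t ht => posSemidef_smul_one_sub_iff.1 (hG t ht).2
  have hy : PiecewiseContinuous fun t => Matrix.toEuclideanLin (Cbar l) (x t) := by
    have hc : Continuous (Matrix.toEuclideanLin (Cbar l)) :=
      LinearMap.continuous_of_finiteDimensional _
    exact (PiecewiseContinuous.of_continuousOn hx.1).comp hc
  have hred : ∀ (T : ℝ) (xh : ℝ → EuclideanSpace ℝ (StateIndex l))
      (P : ℝ → Matrix (Fin k) (Fin k) ℝ) (Q : ℝ → Matrix (StateIndex l) (Fin k) ℝ), P 0 = P₀ →
      PDeriv 0 T P (fun t => reducedB (jacobian (canonicalField l fbar) (xh t) (u t)) (Q t) * P t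
        + P t * (reducedB (jacobian (canonicalField l fbar) (xh t) (u t)) (Q t))ᵀ
        - P t * (Cbar l * Q t)ᵀ * (Cbar l * Q t) * P t + G t) →
      PDeriv 0 T Q (fun t => (1 - Q t * (Q t)ᵀ) * jacobian (canonicalField l fbar) (xh t) (u t)
        * Q t + Q t * skewPart (jacobian (canonicalField l fbar) (xh t) (u t)) (Q t)) →
      (Q 0)ᵀ * Q 0 = 1 →
      ReducedTrajectory T (‖Abar l‖ + Lam) g₁ g₂
        (fun t => jacobian (canonicalField l fbar) (xh t) (u t)) (Cbar l) G P Q :=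
    fun T xh P Q hP0 hP hQ hQ0 =>
      ⟨fun t _ => norm_jacobian_canonicalField_le hsmooth hlip _ _, fun t ht => (hGl t ht.1.le).1,
        fun t ht => (hGl t ht.1.le).2, fun t ht => (hGu t ht.1.le).2, hQ0, by rw [hP0, hP₀s], hP, hQ⟩
  refine ⟨exists_isObserverTrajectory hsmooth hlip (g₁ := g₁) (g₂ := g₂) hp₂ hGc hu hy
    (fun T xh P Q hT hP0 hP hQ hQ0 => ?_) xh₀ hQ₀, fun xh P Q ho _ hP0 hQ0 => ?_⟩
  · have hr := hred T xh P Q hP0 hP hQ hQ0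
    have hb := hbd T _ G P Q hT hr hP0 fun t _ =>
      exists_jacobian_canonicalField_eq hsmooth hlip htri (xh t) (u t)
    exact ⟨hr, fun t ht => norm_le_of_quad_le (hb t ht).1 hp₂
      (fun x => (mul_nonneg hp₁.le (dotProduct_self_nonneg' x)).trans ((hb t ht).2 x).1)
      fun x => ((hb t ht).2 x).2⟩
  · have hr : ∀ T, ReducedTrajectory T (‖Abar l‖ + Lam) g₁ g₂
        (fun t => jacobian (canonicalField l fbar) (xh t) (u t)) (Cbar l) G P Q := fun T =>
      hred T xh P Q hP0 (ho.riccati.pDeriv le_rfl T) (ho.qr.pDeriv le_rfl T) (by rw [hQ0, hQ₀])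
    have hb : ∀ t, 0 ≤ t → (P t)ᵀ = P t ∧ ∀ x, p₁ * (x ⬝ᵥ x) ≤ x ⬝ᵥ P t *ᵥ x ∧
        x ⬝ᵥ P t *ᵥ x ≤ p₂ * (x ⬝ᵥ x) := fun t ht =>
      hbd t _ G P Q ht (hr t) hP0 (fun s _ =>
        exists_jacobian_canonicalField_eq hsmooth hlip htri (xh s) (u s)) t (right_mem_Icc.2 ht)
    refine ⟨fun t _ => ?_, fun t ht => ⟨?_, ?_⟩, fun Qf hQf hext hj => ?_⟩
    · have := norm_jacobian_canonicalField_le (l := l) hsmooth hlip (xh t) (u t)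
      linarith
    · exact posSemidef_sub_smul_one_iff.2 ⟨(hb t ht).1, fun x => ((hb t ht).2 x).1⟩
    · exact posSemidef_smul_one_sub_iff.2 ⟨(hb t ht).1, fun x => ((hb t ht).2 x).2⟩
    · exact locallyUniformlyExponentiallyStable_errorField hsmooth hlip hκ hη' hk hg₁ hp₁ hp₂ hu ho
        hr (fun t ht => (hb t ht).2) hQf hext hj
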